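/- Let $q\in\mathbb R$ with $q\neq 0$ and $|q|\neq 1$, and let $n\ge 1$ be an integer. Let $A(S^{2n}_q)$ be the unital complex $*$-algebra generated by $x_0=x_0^*,x_1,\dots,x_n$ with the relations $$x_ix_j=q\,x_jx_i\ (0\le i<j\le n),\qquad x_i^*x_j=q\,x_jx_i^*\ (i\ne j),\qquad [x_i,x_i^*]=(1-q^{-2})\,s_{i-1}\ (1\le i\le n),\qquad s_n=1,$$ where $s_0=x_0^2$ and $s_i=s_{i-1}+x_i^*x_i$. Let $A(S^{2n-1}_q)$ be the $*$-algebra obtained by adding the relation $x_0=0$; it is generated by $x_1,\dots,x_n$. Let $\mathcal C(S^{2n}_q)$ and $\mathcal C(S^{2n-1}_q)$ be the universal C*-algebras, i.e. the C*-algebraic completions of these $*$-algebras with respect to the supremum of the operator norms over all unital $*$-representations on a countably infinite-dimensional Hilbert space. Let $\mathcal K$ be the C*-algebra of compact operators on a countably infinite-dimensional Hilbert space. (a) There is a short exact sequence of C*-algebras and $*$-homomorphisms $$0\to\mathcal K\oplus\mathcal K\to\mathcal C(S^{2n}_q)\xrightarrow{\ \pi\ }\mathcal C(S^{2n-1}_q)\to0,$$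 in which $\pi$ is unital with $\pi(x_0)=0$ and $\pi(x_i)=x_i$ for $1\le i\le n$, and the image of $\mathcal K\oplus\mathcal K$ is the closed two-sided ideal of $\mathcal C(S^{2n}_q)$ generated by $x_0$. (b) There is a short exact sequence of C*-algebras and $*$-homomorphisms $$0\to\mathcal C(S^1)\otimes\mathcal K\to\mathcal C(S^{2n+1}_q)\xrightarrow{\ \pi\ }\mathcal C(S^{2n-1}_q)\to0,$$ in which $\pi$ is unital with $\pi(x_1)=0$ and $\pi(x_{i+1})=x_i$ for $1\le i\le n$, and the image of $\mathcal C(S^1)\otimes\mathcal K$ is the closed two-sided ideal of $\mathcal C(S^{2n+1}_q)$ generated by $x_1$. -/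

import Mathlib

open scoped ENNReal

noncomputable section

namespace QuantumSphere

/-- The countably infinite-dimensional Hilbert space `ℓ²(ℕ)`. -/
abbrev Hilb : Type := lp (fun _ : ℕ => ℂ) 2

/-- The bounded operators on `ℓ²(ℕ)`. -/
abbrev BOp : Type := Hilb →L[ℂ] Hilb

instance instNontrivialHilb : Nontrivial Hilb :=
  ⟨lp.single 2 0 1, 0, fun h => by
    have := congrArg (fun v : Hilb => v 0) h
    simp at this⟩

instance instCStarAlgebraBOp : CStarAlgebra BOp := inferInstance

instance instNormOneClassBOp : NormOneClass BOp := inferInstance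

section Relations

variable {A : Type*} [Ring A] [StarRing A] [Algebra ℂ A] {n : ℕ}

/-- The defining relations of the `*`-algebra `A(S^{2n}_q)` for elements `x₀, x₁, …, xₙ` of a
unital complex `*`-algebra. The partial radius `s_i = x₀² + x₁* x₁ + ⋯ + x_i* x_i` is written
as `∑_{j ≤ i} x_j* x_j`, which is the same because `x₀` is self-adjoint. -/
structure EvenRel (q : ℝ) (x : Fin (n + 1) → A) : Prop where
  /-- `x₀* = x₀` -/
  selfAdjoint : star (x 0) = x 0
  /-- `x_i x_j = q x_j x_i` for `0 ≤ i < j ≤ n` -/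
  comm : ∀ i j, i < j → x i * x j = (q : ℂ) • (x j * x i)
  /-- `x_i* x_j = q x_j x_i*` for `i ≠ j` -/
  star_comm : ∀ i j, i ≠ j → star (x i) * x j = (q : ℂ) • (x j * star (x i))
  /-- `[x_i, x_i*] = (1 - q⁻²) s_{i-1}` for `1 ≤ i ≤ n` -/
  commutator : ∀ i, i ≠ 0 → x i * star (x i) - star (x i) * x i =
    (1 - ((q : ℂ) ^ 2)⁻¹) • ∑ j ∈ Finset.Iio i, star (x j) * x j
  /-- `s_n = 1` -/
  radius : ∑ j, star (x j) * x j = 1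

/-- The defining relations of `A(S^{2n-1}_q)`: those of `A(S^{2n}_q)` together with `x₀ = 0`. -/
structure OddRel (q : ℝ) (x : Fin (n + 1) → A) : Prop extends EvenRel q x where
  zero : x 0 = 0

end Relations

/-- The relation `s_n = 1` forces `‖x_i‖ ≤ 1` in every representation. -/
theorem EvenRel.norm_le_one {n : ℕ} {q : ℝ} {x : Fin (n + 1) → BOp} (h : EvenRel q x)
    (i : Fin (n + 1)) : ‖x i‖ ≤ 1 := by
  refine ContinuousLinearMap.opNorm_le_bound _ zero_le_one fun v => ?_
  have h1 : ∑ j, ‖x j v‖ ^ 2 = ‖v‖ ^ 2 := by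
    have h2 := congrArg (fun T : BOp => RCLike.re (inner ℂ (T v) v)) h.radius
    simp only [sum_apply, sum_inner, map_sum, mul_apply_eq_comp,
      ContinuousLinearMap.star_eq_adjoint, ContinuousLinearMap.adjoint_inner_left,
      one_apply_eq_self, inner_self_eq_norm_sq] at h2
    exact h2
  have h3 : ‖x i v‖ ^ 2 ≤ ‖v‖ ^ 2 := by
    rw [← h1]
    exact Finset.single_le_sum (f := fun j => ‖x j v‖ ^ 2) (fun j _ => by positivity)
      (Finset.mem_univ i)
  rw [one_mul]
  exact (sq_le_sq₀ (norm_nonneg _) (norm_nonneg _)).1 h3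

/-! ### The universal C*-algebras

A unital `*`-representation on `ℓ²(ℕ)` of a `*`-algebra given by generators and relations is a
tuple of bounded operators that satisfies the relations. The norm of a `*`-polynomial in the
generators is the supremum of the norms of its values in all these representations. So the
completion is the closure of the `*`-algebra generated by the tautological tuple inside the
C*-algebra of bounded families of operators indexed by all representations. -/

/-- Bounded families of operators on `ℓ²(ℕ)`, with the supremum norm. -/
abbrev Families (I : Type) : Type := lp (fun _ : I => BOp) ∞

instance instCStarAlgebraFamilies (I : Type) : CStarAlgebra (Families I) :=
  { lp.inftyNormedRing, lp.inftyStarRing, lp.inftyCStarRing, lp.inftyNormedAlgebra with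
    star_smul := star_smul
    toCompleteSpace := inferInstance }

variable (q : ℝ) (n : ℕ)

/-- The unital `*`-representations of `A(S^{2n}_q)` on `ℓ²(ℕ)`. -/
abbrev EvenRep : Type := {x : Fin (n + 1) → BOp // EvenRel q x}

/-- The unital `*`-representations of `A(S^{2n-1}_q)` on `ℓ²(ℕ)`. -/
abbrev OddRep : Type := {x : Fin (n + 1) → BOp // OddRel q x}

/-- The generator `x_i` evaluated in all representations of `A(S^{2n}_q)`. -/
def evenFamily (i : Fin (n + 1)) : Families (EvenRep q n) :=
  ⟨fun ρ => ρ.1 i, memℓp_infty ⟨1, by rintro _ ⟨ρ, rfl⟩; exact ρ.2.norm_le_one i⟩⟩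

/-- The generator `x_i` evaluated in all representations of `A(S^{2n-1}_q)`. -/
def oddFamily (i : Fin (n + 1)) : Families (OddRep q n) :=
  ⟨fun ρ => ρ.1 i, memℓp_infty ⟨1, by rintro _ ⟨ρ, rfl⟩; exact ρ.2.toEvenRel.norm_le_one i⟩⟩

/-- The closed `*`-algebra of families generated by `x₀, x₁, …, xₙ`. -/
def evenAlg : StarSubalgebra ℂ (Families (EvenRep q n)) :=
  (StarAlgebra.adjoin ℂ (Set.range (evenFamily q n))).topologicalClosure

/-- The closed `*`-algebra of families generated by `x₁, …, xₙ` (and `x₀ = 0`). -/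
def oddAlg : StarSubalgebra ℂ (Families (OddRep q n)) :=
  (StarAlgebra.adjoin ℂ (Set.range (oddFamily q n))).topologicalClosure

/-- The C*-algebra `C(S^{2n}_q)`. -/
def CEven : Type := evenAlg q n

/-- The C*-algebra `C(S^{2n-1}_q)`. -/
def COdd : Type := oddAlg q n

instance instCStarAlgebraCEven : CStarAlgebra (CEven q n) :=
  have : IsClosed (evenAlg q n : Set (Families (EvenRep q n))) :=
    StarSubalgebra.isClosed_topologicalClosure _
  StarSubalgebra.cstarAlgebra (evenAlg q n)

instance instCStarAlgebraCOdd : CStarAlgebra (COdd q n) :=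
  have : IsClosed (oddAlg q n : Set (Families (OddRep q n))) :=
    StarSubalgebra.isClosed_topologicalClosure _
  StarSubalgebra.cstarAlgebra (oddAlg q n)

/-- The generators `x₀, x₁, …, xₙ` of `C(S^{2n}_q)`. -/
def evenGen (i : Fin (n + 1)) : CEven q n :=
  (⟨evenFamily q n i, StarSubalgebra.le_topologicalClosure _
    (StarAlgebra.subset_adjoin ℂ _ ⟨i, rfl⟩)⟩ : evenAlg q n)

/-- The generators `x₁, …, xₙ` of `C(S^{2n-1}_q)`, together with `x₀ = 0`. -/
def oddGen (i : Fin (n + 1)) : COdd q n :=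
  (⟨oddFamily q n i, StarSubalgebra.le_topologicalClosure _
    (StarAlgebra.subset_adjoin ℂ _ ⟨i, rfl⟩)⟩ : oddAlg q n)

/-! ### Compact operators -/

/-- The adjoint of a compact operator on `ℓ²(ℕ)` is compact. -/
theorem isCompactOperator_star {T : BOp} (hT : IsCompactOperator T) :
    IsCompactOperator (star T : BOp) := by
  have hS : IsCompactOperator (T * star T : BOp) := hT.comp_clm (star T)
  have htb : TotallyBounded ((T * star T : BOp) '' Metric.closedBall 0 1) :=
    (hS.isCompact_closure_image_closedBall (f := (T * star T : BOp).toLinearMap) 1).totallyBounded.subset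
      subset_closure
  refine (isCompactOperator_iff_isCompact_closure_image_closedBall
    (star T : BOp).toLinearMap zero_lt_one).2 ?_
  refine (TotallyBounded.closure ?_).isCompact_of_isClosed isClosed_closure
  refine Metric.totallyBounded_iff.2 fun ε hε => ?_
  obtain ⟨t, hts, htf, hcov⟩ := Metric.finite_approx_of_totallyBounded htb (ε ^ 2 / 2) (by positivity)
  have hts' : ∀ y : Hilb, ∃ v : Hilb, y ∈ t → v ∈ Metric.closedBall (0 : Hilb) 1 ∧
      (T * star T : BOp) v = y := fun y => by
    by_cases hy : y ∈ t
    · obtain ⟨v, hv⟩ := hts hy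
      exact ⟨v, fun _ => hv⟩
    · exact ⟨0, fun h => absurd h hy⟩
  choose g hg using hts'
  refine ⟨(fun y => (star T : BOp) (g y)) '' t, htf.image _, ?_⟩
  rintro _ ⟨v, hv, rfl⟩
  obtain ⟨y, hy, hvy⟩ := Set.mem_iUnion₂.1 (hcov ⟨v, hv, rfl⟩)
  refine Set.mem_iUnion₂.2 ⟨_, ⟨y, hy, rfl⟩, ?_⟩
  obtain ⟨hgy, hgy'⟩ := hg y hy
  rw [mem_ball_iff_norm] at hvy ⊢
  rw [← hgy'] at hvy
  have hvg : ‖v - g y‖ ≤ 2 := by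
    have h1 := norm_sub_le v (g y)
    have h2 := mem_closedBall_zero_iff.1 hv
    have h3 := mem_closedBall_zero_iff.1 hgy
    linarith
  have key : ‖(star T : BOp) (v - g y)‖ ^ 2 ≤ ‖(T * star T : BOp) (v - g y)‖ * ‖v - g y‖ := by
    rw [← inner_self_eq_norm_sq (𝕜 := ℂ)]
    nth_rewrite 1 [ContinuousLinearMap.star_eq_adjoint]
    rw [ContinuousLinearMap.adjoint_inner_left, inner_re_symm]
    exact re_inner_le_norm _ _
  rw [← map_sub] at hvy
  have h4 : ‖(star T : BOp) (v - g y)‖ ^ 2 < ε ^ 2 := by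
    nlinarith [norm_nonneg ((T * star T : BOp) (v - g y))]
  have h5 := lt_of_pow_lt_pow_left₀ 2 hε.le h4
  simpa using h5

/-- The compact operators on `ℓ²(ℕ)`, as a `*`-subalgebra of the bounded operators. -/
def compactOps : NonUnitalStarSubalgebra ℂ BOp where
  carrier := {T | IsCompactOperator T}
  add_mem' hS hT := hS.add hT
  zero_mem' := isCompactOperator_zero
  mul_mem' hS _ := hS.comp_clm _
  smul_mem' c _ hT := hT.smul c
  star_mem' hT := isCompactOperator_star hT

/-- The C*-algebra `K` of compact operators on `ℓ²(ℕ)`. -/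
def Compact : Type := compactOps

instance instNonUnitalCStarAlgebraCompact : NonUnitalCStarAlgebra Compact :=
  have : IsClosed (compactOps : Set BOp) :=
    isClosed_setOfPred_isCompactOperator
  NonUnitalStarSubalgebra.nonUnitalCStarAlgebra compactOps

instance instCStarAlgebraCircle : CStarAlgebra C(Circle, BOp) := inferInstance

/-- The elementary tensor `f ⊗ T`, realized as the operator-valued function `z ↦ f(z) T`. -/
def elemTensor (f : C(Circle, ℂ)) (T : BOp) : C(Circle, BOp) :=
  ⟨fun z => f z • T, f.continuous.smul continuous_const⟩

/-- The C*-subalgebra of `C(S¹, B(ℓ²(ℕ)))` generated by the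
elementary tensors `f ⊗ T`, with `f` continuous on the circle and `T` compact. -/
def circleTensorCompact : NonUnitalStarSubalgebra ℂ C(Circle, BOp) :=
  (NonUnitalStarAlgebra.adjoin ℂ
    {F | ∃ (f : C(Circle, ℂ)) (T : BOp), T ∈ compactOps ∧ F = elemTensor f T}).topologicalClosure

/-- The C*-tensor product `C(S¹) ⊗ K`, realized as operator-valued functions on the circle. -/
def CircleTensorCompact : Type := circleTensorCompact

instance instNonUnitalCStarAlgebraCircleTensorCompact :
    NonUnitalCStarAlgebra CircleTensorCompact :=
  have : IsClosed (circleTensorCompact : Set C(Circle, BOp)) :=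
    NonUnitalStarSubalgebra.isClosed_topologicalClosure _
  NonUnitalStarSubalgebra.nonUnitalCStarAlgebra circleTensorCompact

/-- The closed two-sided ideal of a C*-algebra generated by an element. -/
def closedIdeal {A : Type*} [CStarAlgebra A] (a : A) : Set A :=
  closure (TwoSidedIdeal.span {a} : Set A)

end QuantumSphere

end

/-!
The two extensions have a common source. Deleting the generator `x₀ = 0` from the odd sphere
`S^{2n+1}_q` leaves the relations of the even sphere `S^{2n}_q` in which the first generator, again
called `x₀`, is only normal (`SphereRel`, `oddRel_cons_iff`). The map `x ↦ (q^{i-n} x_i*)` turns a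
solution of the relations for `q` into one for `q⁻¹` (`SphereRel.invTuple`), so that one may assume
`|q| > 1` when the ideal is computed.

**The ideal.** The relations `x_j* f(x₀) x_j = x_j* x_j f(q x₀)` and `∑_{j ≥ 1} x_j* x_j = 1 - x₀* x₀`
force the spectrum of `x₀` into `0` and the circles of radius `|q|⁻ᵐ`. The spectral projection `e` of
the unit circle, the vacuum projection, is annihilated by all `x_j` with `j ≥ 1`; it generates the
same closed ideal as `x₀` (`SphereRel.zero_mem_closure`), and its corner is generated by `x₀ e`
(`SphereRel.exists_vacuum_mul_mul_vacuum`). The Fock representation on `ℓ²(ℕⁿ)`, in which the `x_j*`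
act as weighted shifts and `x₀` is diagonal, exists with an arbitrary phase on `x₀`
(`exists_fockModel`, `FockModel.twist`). With the possible phases as parameter space `X`, these
representations combine to a homomorphism to `C(X, B(ℓ²(ℕ)))`. It is isometric on the corner of `e`,
hence injective on the ideal, and by the Stone–Weierstrass theorem and matrix units the image of the
ideal is `C(X) ⊗ K` (`IsFockHom.exists_embedding`). The phases are `1` and `-1` for the even sphere and
fill the circle for the odd sphere.

**The quotient.** The map `π` restricts families of operators to the representations in which `x₀`
vanishes. Both the kernel and the surjectivity of `π` follow from one estimate
(`SphereRel.exists_norm_mul_residue_le`): the infimum of the norms `‖a (1 - x₀* x₀)ᴺ‖` over all `N` is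
at most `‖π a‖`. If these norms stayed above `c`, vectors on which these operators are large would have a
weak-* limit functional that vanishes on `x₀* x₀`. Its GNS representation annihilates `x₀`, acts on a
separable space, and is therefore part of a representation of the smaller sphere on `ℓ²(ℕ)`, whence
`c ≤ ‖π a‖`. Since `a - a (1 - x₀* x₀)ᴺ` lies in the ideal generated by `x₀`, the kernel of `π` is the
closure of this ideal. Since both elements have the same image, elements in the range of `π` have
preimages of comparable norm, so that the range is closed.
-/

noncomputable section

open scoped CStarAlgebra

namespace QuantumSphere

/-! ### The defining relations with a normal first generator -/

section SphereRel

variable {A : Type*} [Ring A] [StarRing A] [Algebra ℂ A] {n : ℕ}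

/-- The relations of `A(S^{2n}_q)` with the self-adjointness of `x₀` weakened to normality.
Adding `x₀* = x₀` gives the even sphere `S^{2n}_q`; without it these are the relations of
`x₁, …, x_{n+1}` in the odd sphere `S^{2n+1}_q`. -/
structure SphereRel (q : ℝ) (x : Fin (n + 1) → A) : Prop where
  normal : star (x 0) * x 0 = x 0 * star (x 0)
  comm : ∀ i j, i < j → x i * x j = (q : ℂ) • (x j * x i)
  star_comm : ∀ i j, i ≠ j → star (x i) * x j = (q : ℂ) • (x j * star (x i))
  commutator : ∀ i, i ≠ 0 → x i * star (x i) - star (x i) * x i =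
    (1 - ((q : ℂ) ^ 2)⁻¹) • ∑ j ∈ Finset.Iio i, star (x j) * x j
  radius : ∑ j, star (x j) * x j = 1

theorem EvenRel.sphereRel {q : ℝ} {x : Fin (n + 1) → A} (h : EvenRel q x) : SphereRel q x where
  normal := by rw [h.selfAdjoint]
  comm := h.comm
  star_comm := h.star_comm
  commutator := h.commutator
  radius := h.radius

theorem sum_Iio_fin_succ {M : Type*} [AddCommMonoid M] {n : ℕ} (f : Fin (n + 1) → M) (i : Fin n) :
    ∑ j ∈ Finset.Iio i.succ, f j = f 0 + ∑ j ∈ Finset.Iio i, f j.succ := by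
  have h : Finset.Iio i.succ = Finset.cons 0 ((Finset.Iio i).map (Fin.succEmb n)) (by simp) := by
    ext j
    refine Fin.cases ?_ (fun j => ?_) j <;> simp
  rw [h, Finset.sum_cons, Finset.sum_map]
  simp

/-- A tuple with `x₀ = 0` satisfies the relations of the odd sphere exactly when the remaining
generators satisfy the relations with a normal first generator. -/
theorem oddRel_cons_iff {q : ℝ} {x : Fin (n + 1) → A} :
    OddRel q (Fin.cons 0 x : Fin (n + 2) → A) ↔ SphereRel q x := by
  constructor
  · intro h
    refine ⟨?_, fun i j hij => ?_, fun i j hij => ?_, fun i hi => ?_, ?_⟩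
    · have := h.commutator 1 (by simp)
      rw [← Fin.succ_zero_eq_one, sum_Iio_fin_succ] at this
      simp only [Fin.cons_succ, Fin.cons_zero] at this
      have h0 : (Finset.Iio (0 : Fin (n + 1))) = ∅ := by ext; simp
      rw [h0] at this
      simp only [mul_zero, Finset.sum_empty, add_zero, smul_zero, sub_eq_zero] at this
      exact this.symm
    · simpa using h.comm i.succ j.succ (by simpa using hij)
    · simpa using h.star_comm i.succ j.succ (by simpa using hij)
    · have := h.commutator i.succ (by simp)
      rw [sum_Iio_fin_succ] at this
      simpa using this
    · have := h.radius
      rw [Fin.sum_univ_succ] at this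
      simpa using this
  · intro h
    refine ⟨⟨by simp, fun i j hij => ?_, fun i j hij => ?_, fun i hi => ?_, ?_⟩, by simp⟩
    · induction i using Fin.cases with
      | zero => simp
      | succ i =>
        induction j using Fin.cases with
        | zero => simp at hij
        | succ j => simpa using h.comm i j (by simpa using hij)
    · induction i using Fin.cases with
      | zero => simp
      | succ i =>
        induction j using Fin.cases with
        | zero => simp
        | succ j => simpa using h.star_comm i j (by simpa using hij)
    · induction i using Fin.cases with
      | zero => simp at hi
      | succ i =>
        rw [sum_Iio_fin_succ]
        induction i using Fin.cases with
        | zero =>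
          have h0 : (Finset.Iio (0 : Fin (n + 1))) = ∅ := by ext; simp
          simp [h0, h.normal]
        | succ i => simpa using h.commutator i.succ (by simp)
    · rw [Fin.sum_univ_succ]
      simpa using h.radius

theorem OddRel.sphereRel_tail {q : ℝ} {x : Fin (n + 2) → A} (h : OddRel q x) :
    SphereRel q (Fin.tail x) := by
  rw [← oddRel_cons_iff, ← h.zero, Fin.cons_self_tail]
  exact h

theorem OddRel.cons_zero {q : ℝ} {x : Fin (n + 1) → A} (h : OddRel q x) :
    OddRel q (Fin.cons 0 x : Fin (n + 2) → A) :=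
  oddRel_cons_iff.2 h.toEvenRel.sphereRel

section Map

variable {B : Type*} [Ring B] [StarRing B] [Algebra ℂ B] {q : ℝ} {x : Fin (n + 1) → A}

theorem SphereRel.map (h : SphereRel q x) (φ : A →⋆ₐ[ℂ] B) : SphereRel q (fun i => φ (x i)) where
  normal := by rw [← map_star, ← map_mul, h.normal, map_mul]
  comm i j hij := by rw [← map_mul, h.comm i j hij, map_smul, map_mul]
  star_comm i j hij := by rw [← map_star, ← map_mul, h.star_comm i j hij, map_smul, map_mul]
  commutator i hi := by
    simp only [← map_star, ← map_mul, ← map_sub, h.commutator i hi, map_smul, map_sum]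
  radius := by simp only [← map_star, ← map_mul, ← map_sum, h.radius, map_one]

theorem SphereRel.evenRel (h : SphereRel q x) (h0 : star (x 0) = x 0) : EvenRel q x :=
  ⟨h0, h.comm, h.star_comm, h.commutator, h.radius⟩

end Map

/-! ### The symmetry `q ↔ q⁻¹` -/

variable [StarModule ℂ A]

/-- The rescaled adjoints `q^{i-n} x_i*`. If `x` satisfies the relations for `q`, then these
satisfy them for `q⁻¹`. -/
def invTuple (q : ℝ) (x : Fin (n + 1) → A) (i : Fin (n + 1)) : A :=
  ((q⁻¹ : ℂ) ^ (n - i : ℕ)) • star (x i)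

theorem star_invTuple (q : ℝ) (x : Fin (n + 1) → A) (i : Fin (n + 1)) :
    star (invTuple q x i) = ((q⁻¹ : ℂ) ^ (n - i : ℕ)) • x i := by
  simp [invTuple]

/-- The rescaling factors are chosen such that the partial radii of the two tuples are
proportional. -/
theorem SphereRel.sum_invTuple {q : ℝ} (hq : q ≠ 0) {x : Fin (n + 1) → A} (h : SphereRel q x)
    (m : ℕ) (hm : m ≤ n + 1) :
    ∑ j with j.val < m, star (invTuple q x j) * invTuple q x j =
      (((q : ℂ) ^ 2)⁻¹ ^ (n + 1 - m : ℕ)) • ∑ j with j.val < m, star (x j) * x j := by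
  have hqc : (q : ℂ) ≠ 0 := by exact_mod_cast hq
  induction m with
  | zero => simp
  | succ m ih =>
    have hm' : m < n + 1 := by omega
    have hfil : (Finset.univ.filter fun j : Fin (n + 1) => j.val < m + 1) =
        Finset.cons ⟨m, hm'⟩ (Finset.univ.filter fun j : Fin (n + 1) => j.val < m) (by simp) := by
      ext j
      simp only [Finset.mem_filter, Finset.mem_univ, true_and, Finset.mem_cons, Fin.ext_iff]
      omega
    rw [hfil, Finset.sum_cons, Finset.sum_cons, ih (by omega), star_invTuple, invTuple]
    simp only [smul_mul_smul_comm]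
    have hIio : (Finset.univ.filter fun j : Fin (n + 1) => j.val < m) =
        Finset.Iio ⟨m, hm'⟩ := by
      ext j
      simp [Fin.lt_def]
    rw [hIio]
    have hcomm : x ⟨m, hm'⟩ * star (x ⟨m, hm'⟩) = star (x ⟨m, hm'⟩) * x ⟨m, hm'⟩ +
        (1 - ((q : ℂ) ^ 2)⁻¹) • ∑ j ∈ Finset.Iio (⟨m, hm'⟩ : Fin (n + 1)), star (x j) * x j := by
      by_cases h0 : (⟨m, hm'⟩ : Fin (n + 1)) = 0
      · have hE : (Finset.Iio (0 : Fin (n + 1))) = ∅ := by ext; simp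
        rw [h0, hE, h.normal]
        simp
      · rw [← h.commutator _ h0]
        abel
    rw [hcomm]
    obtain ⟨k, rfl⟩ : ∃ k, n = m + k := ⟨n - m, by omega⟩
    have e1 : m + k - m = k := by omega
    have e2 : m + k + 1 - m = k + 1 := by omega
    have e3 : m + k + 1 - (m + 1) = k := by omega
    simp only [e1, e2, e3, smul_add, smul_smul]
    rw [add_assoc, ← add_smul]
    congr 2
    · rw [← mul_pow]
      congr 1
      field_simp
    · rw [show ((q : ℂ) ^ 2)⁻¹ = (q : ℂ)⁻¹ * (q : ℂ)⁻¹ by rw [sq, mul_inv]]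
      ring

/-- The inversion `q ↔ q⁻¹`: the tuple `q^{i-n} x_i*` satisfies the relations for `q⁻¹`. -/
theorem SphereRel.invTuple {q : ℝ} (hq : q ≠ 0) {x : Fin (n + 1) → A} (h : SphereRel q x) :
    SphereRel q⁻¹ (invTuple q x) where
  normal := by
    rw [star_invTuple, QuantumSphere.invTuple]
    simp only [smul_mul_smul_comm, h.normal]
  comm i j hij := by
    have hqc : (q : ℂ) ≠ 0 := by exact_mod_cast hq
    have := congrArg star (h.comm i j hij)
    simp only [star_mul, star_smul, Complex.star_def, Complex.conj_ofReal] at this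
    simp only [QuantumSphere.invTuple, smul_mul_smul_comm, this, smul_smul]
    congr 1
    push_cast
    field_simp
  star_comm i j hij := by
    have hqc : (q : ℂ) ≠ 0 := by exact_mod_cast hq
    simp only [QuantumSphere.invTuple, star_smul, star_star, smul_mul_smul_comm,
      h.star_comm j i hij.symm, smul_smul]
    congr 1
    simp
    field_simp
  commutator i hi := by
    have hqc : (q : ℂ) ≠ 0 := by exact_mod_cast hq
    have hIio : Finset.Iio i = (Finset.univ.filter fun j : Fin (n + 1) => j.val < i) := by
      ext j
      simp
    rw [hIio, h.sum_invTuple hq _ (by omega), star_invTuple, QuantumSphere.invTuple]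
    have := h.commutator i hi
    rw [hIio] at this
    simp only [smul_mul_smul_comm]
    rw [← smul_sub, ← neg_sub (x i * star (x i)), this, smul_smul, smul_neg, ← neg_smul, smul_smul]
    congr 1
    have e : n + 1 - (i : ℕ) = (n - i) + 1 := by omega
    have hc : (q : ℂ) * (q : ℂ)⁻¹ = 1 := mul_inv_cancel₀ hqc
    rw [e, show ((q : ℂ) ^ 2)⁻¹ = (q : ℂ)⁻¹ * (q : ℂ)⁻¹ by rw [sq, mul_inv]]
    push_cast
    rw [show (((q : ℂ)⁻¹) ^ 2)⁻¹ = (q : ℂ) ^ 2 by rw [inv_pow, inv_inv]]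
    generalize (q : ℂ)⁻¹ = c at hc
    linear_combination (c ^ (n - i : ℕ)) ^ 2 * ((q : ℂ) * c + 1) * hc
  radius := by
    have := h.sum_invTuple hq (n + 1) le_rfl
    have hu : (Finset.univ.filter fun j : Fin (n + 1) => j.val < n + 1) = Finset.univ := by
      ext j
      simp only [Finset.mem_filter, Finset.mem_univ, true_and, iff_true]
      exact j.isLt
    rw [hu] at this
    rw [this, h.radius]
    simp

theorem invTuple_invTuple {q : ℝ} (hq : q ≠ 0) (x : Fin (n + 1) → A) :
    QuantumSphere.invTuple q⁻¹ (QuantumSphere.invTuple q x) = x := by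
  have hqc : (q : ℂ) ≠ 0 := by exact_mod_cast hq
  funext i
  simp only [QuantumSphere.invTuple, star_smul, star_star, smul_smul]
  simp [hqc]

end SphereRel

/-! ### The spectrum of the first generator -/

/-- An intertwiner of two normal elements, and of their adjoints, intertwines their continuous
functional calculi. -/
theorem cfc_mul_eq_mul_cfc {A : Type*} [CStarAlgebra A] {a b y : A} [ha : IsStarNormal a]
    [hb : IsStarNormal b] (h : a * y = y * b) (h' : star a * y = y * star b) {f : ℂ → ℂ}
    (hf : Continuous f) : cfc f a * y = y * cfc f b := by
  -- the pairs of intertwined elements form a closed star subalgebra of `A × A`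
  let S : StarSubalgebra ℂ (A × A) :=
    { carrier := {p | p.1 * y = y * p.2 ∧ star p.1 * y = y * star p.2}
      mul_mem' := by
        rintro p r ⟨hp, hp'⟩ ⟨hr, hr'⟩
        refine ⟨?_, ?_⟩
        · simp only [Prod.fst_mul, Prod.snd_mul]
          rw [mul_assoc, hr, ← mul_assoc, hp, mul_assoc]
        · simp only [Prod.fst_mul, Prod.snd_mul, star_mul]
          rw [mul_assoc, hp', ← mul_assoc, hr', mul_assoc]
      add_mem' := by
        rintro p r ⟨hp, hp'⟩ ⟨hr, hr'⟩
        refine ⟨?_, ?_⟩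
        · simp only [Prod.fst_add, Prod.snd_add, add_mul, mul_add, hp, hr]
        · simp only [Prod.fst_add, Prod.snd_add, star_add, add_mul, mul_add, hp', hr']
      algebraMap_mem' := by
        intro r
        simp [Algebra.algebraMap_eq_smul_one]
      star_mem' := by
        rintro p ⟨hp, hp'⟩
        exact ⟨hp', by simpa using hp⟩ }
  have hS : IsClosed (S : Set (A × A)) := by
    refine IsClosed.inter (isClosed_eq ?_ ?_) (isClosed_eq ?_ ?_) <;> fun_prop
  have hab : IsStarNormal (a, b) :=
    ⟨by ext <;> simp [star_comm_self' a, star_comm_self' b]⟩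
  have hmem : cfc f (a, b) ∈ S := cfc_mem (hs := hS) (𝕜' := ℂ) f (show (a, b) ∈ S from ⟨h, h'⟩)
  rw [cfc_map_prod (S := ℂ) f a b] at hmem
  exact hmem.1

/-- A continuous bump at `1` that vanishes at the other integer powers of `r > 1` and at `0`. -/
def bump (r u : ℝ) : ℝ := max 0 (1 - |u - 1| / (1 - r⁻¹))

@[fun_prop]
theorem continuous_bump (r : ℝ) : Continuous (bump r) := by
  unfold bump
  fun_prop

theorem bump_one (r : ℝ) : bump r 1 = 1 := by simp [bump]

theorem bump_eq_zero {r u : ℝ} (hr : 1 < r) (hu : u ≤ r⁻¹ ∨ r ≤ u) : bump r u = 0 := by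
  have h1 : r⁻¹ < 1 := inv_lt_one_of_one_lt₀ hr
  have h2 : 1 - r⁻¹ ≤ r - 1 := by
    have : 0 ≤ (r - 1) ^ 2 * r⁻¹ := by positivity
    have h3 : r * r⁻¹ = 1 := mul_inv_cancel₀ (by positivity)
    nlinarith
  refine max_eq_left ?_
  rw [sub_nonpos, le_div_iff₀ (by linarith), one_mul]
  rcases hu with hu | hu
  · rw [abs_of_nonpos (by linarith)]
    linarith
  · rw [abs_of_nonneg (by linarith)]
    linarith

theorem bump_zpow {r : ℝ} (hr : 1 < r) {k : ℤ} (hk : k ≠ 0) : bump r (r ^ k) = 0 := by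
  refine bump_eq_zero hr ?_
  rcases lt_or_gt_of_ne hk with h | h
  · left
    rw [← zpow_neg_one]
    exact zpow_le_zpow_right₀ hr.le (by omega)
  · right
    calc r = r ^ (1 : ℤ) := (zpow_one r).symm
      _ ≤ r ^ k := zpow_le_zpow_right₀ hr.le (by omega)

theorem bump_zero {r : ℝ} (hr : 1 < r) : bump r 0 = 0 :=
  bump_eq_zero hr (Or.inl (by positivity))

section

variable {A : Type*} [CStarAlgebra A] {n : ℕ} {q : ℝ} {x : Fin (n + 1) → A}

theorem SphereRel.isStarNormal (h : SphereRel q x) : IsStarNormal (x 0) := ⟨h.normal⟩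

theorem SphereRel.star_zero_mul (h : SphereRel q x) {j : Fin (n + 1)} (hj : j ≠ 0) :
    star (x 0) * x j = (q : ℂ) • (x j * star (x 0)) :=
  h.star_comm 0 j hj.symm

theorem SphereRel.zero_mul (h : SphereRel q x) {j : Fin (n + 1)} (hj : j ≠ 0) :
    x 0 * x j = (q : ℂ) • (x j * x 0) :=
  h.comm 0 j (Fin.pos_of_ne_zero hj)

/-- Moving `x_j` through a function of `x₀` rescales the argument by `q`. -/
theorem SphereRel.cfc_mul (h : SphereRel q x) {j : Fin (n + 1)} (hj : j ≠ 0) {f : ℂ → ℂ}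
    (hf : Continuous f) : cfc f (x 0) * x j = x j * cfc (fun t => f (q * t)) (x 0) := by
  have := h.isStarNormal
  have hq : IsStarNormal ((q : ℂ) • x 0) := ⟨by
    simp only [star_smul, commute_iff_eq, smul_mul_smul_comm, h.normal, Complex.star_def,
      Complex.conj_ofReal]⟩
  rw [cfc_mul_eq_mul_cfc (b := (q : ℂ) • x 0) (by rw [h.zero_mul hj, mul_smul_comm])
    (by simp [h.star_zero_mul hj]) hf, ← cfc_comp_smul (q : ℂ) f (x 0) hf.continuousOn]
  rfl

theorem SphereRel.sum_succ (h : SphereRel q x) :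
    ∑ j : Fin n, star (x j.succ) * x j.succ = 1 - star (x 0) * x 0 := by
  rw [eq_sub_iff_add_eq', ← h.radius, Fin.sum_univ_succ]

theorem SphereRel.cfc_norm_sq (h : SphereRel q x) :
    cfc (fun t : ℂ => 1 - star t * t) (x 0) = 1 - star (x 0) * x 0 := by
  have := h.isStarNormal
  rw [cfc_sub _ _ _, _root_.cfc_mul _ _ _, cfc_const_one ℂ (x 0),
    cfc_star_id (R := ℂ) (a := x 0), cfc_id' ℂ (x 0)]

/-- Summing the relations `x_j* f(x₀) x_j = x_j* x_j f(q x₀)` over `j ≥ 1`. -/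
theorem SphereRel.sum_star_mul_cfc_mul (h : SphereRel q x) {f : ℂ → ℂ} (hf : Continuous f) :
    ∑ j : Fin n, star (x j.succ) * cfc f (x 0) * x j.succ =
      cfc (fun t : ℂ => (1 - star t * t) * f (q * t)) (x 0) := by
  have := h.isStarNormal
  rw [_root_.cfc_mul _ _ _ (by fun_prop) (by fun_prop), h.cfc_norm_sq, ← h.sum_succ,
    Finset.sum_mul]
  refine Finset.sum_congr rfl fun j _ => ?_
  rw [mul_assoc, h.cfc_mul (Fin.succ_ne_zero j) hf, mul_assoc]

/-- The spectrum of `x₀` is invariant under multiplication by `q` away from the unit circle: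
apply `sum_star_mul_cfc_mul` to a function vanishing exactly on the spectrum. -/
theorem SphereRel.mul_mem_spectrum (h : SphereRel q x) {t : ℂ} (ht : t ∈ spectrum ℂ (x 0))
    (ht1 : ‖t‖ ≠ 1) : q * t ∈ spectrum ℂ (x 0) := by
  have := h.isStarNormal
  have hcl : IsClosed (spectrum ℂ (x 0)) := spectrum.isClosed (x 0)
  let f : ℂ → ℂ := fun u => (Metric.infDist u (spectrum ℂ (x 0)) : ℝ)
  have hf : Continuous f := Complex.continuous_ofReal.comp (Metric.continuous_infDist_pt _)
  have hf0 : cfc f (x 0) = 0 := by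
    rw [cfc_congr (g := fun _ => 0), cfc_const_zero ℂ (x 0)]
    intro u hu
    simp [f, Metric.infDist_zero_of_mem hu]
  have h1 := h.sum_star_mul_cfc_mul hf
  simp only [hf0, mul_zero, MulZeroClass.zero_mul, Finset.sum_const_zero] at h1
  rw [← cfc_const_zero ℂ (x 0), cfc_eq_cfc_iff_eqOn (by cfc_tac) (by fun_prop)
    (by fun_prop)] at h1
  have h2 := (h1 ht).symm
  simp only [mul_eq_zero, sub_eq_zero] at h2
  rcases h2 with h2 | h2
  · refine absurd ?_ ht1
    have h3 := congrArg norm h2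
    simp only [norm_one, norm_mul, norm_star] at h3
    nlinarith [norm_nonneg t]
  · rw [hcl.mem_iff_infDist_zero ⟨t, ht⟩]
    exact Complex.ofReal_eq_zero.1 h2

/-- For `|q| > 1` the nonzero points of the spectrum of `x₀` have modulus `|q|⁻ᵐ`, `m ≥ 0`:
otherwise all `qᵐ t` would lie in the bounded set `σ(x₀)`. -/
theorem SphereRel.norm_of_mem_spectrum (h : SphereRel q x) (hq : 1 < |q|) {t : ℂ}
    (ht : t ∈ spectrum ℂ (x 0)) : t = 0 ∨ ∃ m : ℕ, ‖t‖ = |q| ^ (-m : ℤ) := by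
  by_contra! hcon
  obtain ⟨ht0, hm⟩ := hcon
  have key : ∀ m : ℕ, (q : ℂ) ^ m * t ∈ spectrum ℂ (x 0) := by
    intro m
    induction m with
    | zero => simpa using ht
    | succ m ih =>
      have := h.mul_mem_spectrum ih fun h1 => hm m ?_
      · rwa [← mul_assoc, ← pow_succ'] at this
      · rw [norm_mul, norm_pow, Complex.norm_real, Real.norm_eq_abs] at h1
        rw [zpow_neg, zpow_natCast]
        exact eq_inv_of_mul_eq_one_right h1
  obtain ⟨m, hm'⟩ := pow_unbounded_of_one_lt ((‖x 0‖ * ‖(1 : A)‖) / ‖t‖) hq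
  have h2 := spectrum.norm_le_norm_mul_of_mem (key m)
  rw [div_lt_iff₀ (norm_pos_iff.2 ht0)] at hm'
  rw [norm_mul, norm_pow, Complex.norm_real, Real.norm_eq_abs] at h2
  linarith

/-! ### The vacuum projection -/

/-- The spectral projection of `x₀` for the points of modulus `|q|⁻ᵐ`. It is defined by a continuous
function that takes only the values `0` and `1` on the spectrum if `x` satisfies the relations and
`|q| > 1`. -/
def levelProj (q : ℝ) (x₀ : A) (m : ℕ) : A := cfc (fun t => (bump |q| (|q| ^ m * ‖t‖) : ℂ)) x₀

/-- The spectral projection of `x₀` for the unit circle, the projection onto the vacuum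
vectors. -/
def vacuum (q : ℝ) (x₀ : A) : A := levelProj q x₀ 0

theorem bump_mul_norm (hq : 1 < |q|) (m k : ℕ) {t : ℂ} (ht : ‖t‖ = |q| ^ (-k : ℤ)) :
    bump |q| (|q| ^ m * ‖t‖) = if m = k then 1 else 0 := by
  have h0 : |q| ≠ 0 := by positivity
  rw [ht, ← zpow_natCast, ← zpow_add₀ h0]
  split_ifs with h
  · rw [h, add_neg_cancel, zpow_zero, bump_one]
  · exact bump_zpow hq (by omega)

theorem SphereRel.bump_spectrum (h : SphereRel q x) (hq : 1 < |q|) (m : ℕ) {t : ℂ}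
    (ht : t ∈ spectrum ℂ (x 0)) : (bump |q| (|q| ^ m * ‖t‖) = 0) ∨
      (bump |q| (|q| ^ m * ‖t‖) = 1 ∧ |q| ^ m * ‖t‖ = 1) := by
  rcases h.norm_of_mem_spectrum hq ht with rfl | ⟨k, hk⟩
  · left
    simp [bump_zero hq]
  · rw [bump_mul_norm hq m k hk]
    split_ifs with hmk
    · right
      have h0 : |q| ≠ 0 := by positivity
      rw [hk, hmk, ← zpow_natCast, ← zpow_add₀ h0, add_neg_cancel, zpow_zero]
      simp
    · left; rfl

theorem star_vacuum (x₀ : A) : star (vacuum q x₀) = vacuum q x₀ := by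
  rw [vacuum, levelProj, ← cfc_star]
  simp

theorem SphereRel.vacuum_mul_self (h : SphereRel q x) (hq : 1 < |q|) :
    vacuum q (x 0) * vacuum q (x 0) = vacuum q (x 0) := by
  have := h.isStarNormal
  rw [vacuum, levelProj, ← _root_.cfc_mul _ _ _ (by fun_prop) (by fun_prop)]
  refine cfc_congr fun t ht => ?_
  rcases h.bump_spectrum hq 0 ht with h0 | ⟨h0, -⟩ <;> simp only [h0] <;> simp

/-- On the vacuum vectors `x₀` is isometric. -/
theorem SphereRel.star_mul_vacuum (h : SphereRel q x) (hq : 1 < |q|) :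
    star (x 0) * x 0 * vacuum q (x 0) = vacuum q (x 0) := by
  have := h.isStarNormal
  have h1 : cfc (fun t : ℂ => star t * t) (x 0) = star (x 0) * x 0 := by
    rw [_root_.cfc_mul _ _ _, cfc_star_id (R := ℂ) (a := x 0), cfc_id' ℂ (x 0)]
  rw [← h1, vacuum, levelProj, ← _root_.cfc_mul _ _ _ (by fun_prop) (by fun_prop)]
  refine cfc_congr fun t ht => ?_
  rcases h.bump_spectrum hq 0 ht with h0 | ⟨h0, h2⟩
  · simp only [h0]
    simp
  · have : (starRingEnd ℂ) t * t = 1 := by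
      rw [← Complex.normSq_eq_conj_mul_self, Complex.normSq_eq_norm_sq]
      simp only [pow_zero, one_mul] at h2
      simp [h2]
    simp only [h0, Complex.star_def, this, one_mul]

theorem SphereRel.zero_mul_vacuum (h : SphereRel q x) :
    x 0 * vacuum q (x 0) = vacuum q (x 0) * x 0 := by
  have := h.isStarNormal
  exact cfc_mul_eq_mul_cfc (f := fun t => (bump |q| (|q| ^ 0 * ‖t‖) : ℂ)) rfl h.normal
    (by fun_prop) |>.symm

/-- The operators `x_j` with `j ≥ 1` annihilate the vacuum. -/
theorem SphereRel.mul_vacuum (h : SphereRel q x) (hq : 1 < |q|) {j : Fin (n + 1)} (hj : j ≠ 0) :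
    x j * vacuum q (x 0) = 0 := by
  let P := CStarAlgebra.spectralOrder A
  have hP := CStarAlgebra.spectralOrderedRing A
  have h1 : ∑ j : Fin n, star (x j.succ * vacuum q (x 0)) * (x j.succ * vacuum q (x 0)) = 0 := by
    simp only [star_mul, star_vacuum, mul_assoc]
    rw [← Finset.mul_sum]
    simp only [← mul_assoc (star _)]
    rw [← Finset.sum_mul, h.sum_succ, sub_mul, one_mul, h.star_mul_vacuum hq, sub_self, mul_zero]
  -- a vanishing sum of positive elements has vanishing summands
  obtain ⟨i, rfl⟩ := Fin.exists_succ_eq.2 hj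
  exact CStarRing.star_mul_self_eq_zero_iff _ |>.1
    ((Finset.sum_eq_zero_iff_of_nonneg fun i _ => star_mul_self_nonneg _).1 h1 i
      (Finset.mem_univ i))

theorem SphereRel.vacuum_mul_star (h : SphereRel q x) (hq : 1 < |q|) {j : Fin (n + 1)}
    (hj : j ≠ 0) : vacuum q (x 0) * star (x j) = 0 := by
  have := congrArg star (h.mul_vacuum hq hj)
  simpa [star_vacuum] using this

/-- The two-sided ideal generated by an element, as a linear span. -/
def idealSpan (e : A) : Submodule ℂ A := Submodule.span ℂ (Set.range fun p : A × A => p.1 * e * p.2)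

theorem mul_mem_idealSpan {e y : A} (a : A) (hy : y ∈ idealSpan e) : a * y ∈ idealSpan e := by
  induction hy using Submodule.span_induction with
  | mem y hy =>
    obtain ⟨p, rfl⟩ := hy
    refine Submodule.subset_span ⟨(a * p.1, p.2), ?_⟩
    simp [mul_assoc]
  | zero => simp
  | add y z _ _ hy hz => rw [mul_add]; exact add_mem hy hz
  | smul c y _ hy => rw [mul_smul_comm]; exact Submodule.smul_mem _ _ hy

theorem idealSpan_mul_mem {e y : A} (a : A) (hy : y ∈ idealSpan e) : y * a ∈ idealSpan e := by
  induction hy using Submodule.span_induction with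
  | mem y hy =>
    obtain ⟨p, rfl⟩ := hy
    refine Submodule.subset_span ⟨(p.1, p.2 * a), ?_⟩
    simp [mul_assoc]
  | zero => simp
  | add y z _ _ hy hz => rw [add_mul]; exact add_mem hy hz
  | smul c y _ hy => rw [smul_mul_assoc]; exact Submodule.smul_mem _ _ hy

theorem self_mem_idealSpan (e : A) : e ∈ idealSpan e :=
  Submodule.subset_span ⟨(1, 1), by simp⟩

/-- The spectral projections of all levels lie in the ideal generated by the vacuum projection,
because `(1 - |q|⁻²⁽ᵐ⁺¹⁾) p_{m+1} = ∑_{j ≥ 1} x_j* p_m x_j`. -/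
theorem SphereRel.levelProj_mem (h : SphereRel q x) (hq : 1 < |q|) (m : ℕ) :
    levelProj q (x 0) m ∈ idealSpan (vacuum q (x 0)) := by
  induction m with
  | zero => exact self_mem_idealSpan _
  | succ m ih =>
    have := h.isStarNormal
    have h1 := h.sum_star_mul_cfc_mul
      (f := fun t => (bump |q| (|q| ^ m * ‖t‖) : ℂ)) (by fun_prop)
    let c : ℂ := 1 - ((|q| ^ (m + 1) : ℝ) ^ 2)⁻¹
    have hc : c ≠ 0 := by
      have h2 : (1 : ℝ) < (|q| ^ (m + 1)) ^ 2 :=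
        one_lt_pow₀ (one_lt_pow₀ hq (by omega)) (by omega)
      have h3 := inv_lt_one_of_one_lt₀ h2
      have h4 : (1 - ((|q| ^ (m + 1)) ^ 2)⁻¹ : ℝ) ≠ 0 := by linarith
      simp only [c]
      exact_mod_cast h4
    have h2 : cfc (fun t : ℂ => (1 - star t * t) * (bump |q| (|q| ^ m * ‖q * t‖) : ℂ)) (x 0) =
        c • levelProj q (x 0) (m + 1) := by
      rw [levelProj, ← cfc_smul c _ _ (by fun_prop)]
      refine cfc_congr fun t ht => ?_
      have e : |q| ^ m * ‖q * t‖ = |q| ^ (m + 1) * ‖t‖ := by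
        rw [norm_mul, Complex.norm_real, Real.norm_eq_abs]
        ring
      simp only [e]
      rcases h.bump_spectrum hq (m + 1) ht with h0 | ⟨h0, h2⟩
      · simp [h0]
      · have h3 : (starRingEnd ℂ) t * t = (((|q| ^ (m + 1) : ℝ) ^ 2)⁻¹ : ℝ) := by
          rw [← Complex.normSq_eq_conj_mul_self, Complex.normSq_eq_norm_sq,
            eq_inv_of_mul_eq_one_right h2, inv_pow]
        simp only [h0, Complex.star_def, h3, c, smul_eq_mul]
    have h3 : levelProj q (x 0) (m + 1) =
        c⁻¹ • ∑ j : Fin n, star (x j.succ) * levelProj q (x 0) m * x j.succ := by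
      rw [levelProj, levelProj, h1, h2, smul_smul, inv_mul_cancel₀ hc, one_smul, levelProj]
    rw [h3]
    exact Submodule.smul_mem _ _ (Submodule.sum_mem _ fun j _ =>
      idealSpan_mul_mem _ (mul_mem_idealSpan _ ih))

/-- The generator `x₀` is the norm limit of `x₀ (p₀ + ⋯ + p_{N-1})`, because its spectrum outside the
levels `0, …, N - 1` has modulus at most `|q|⁻ᴺ`. -/
theorem SphereRel.zero_mem_closure (h : SphereRel q x) (hq : 1 < |q|) :
    x 0 ∈ closure (idealSpan (vacuum q (x 0)) : Set A) := by
  have := h.isStarNormal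
  refine Metric.mem_closure_iff.2 fun ε hε => ?_
  obtain ⟨N, hN⟩ := exists_pow_lt_of_lt_one hε (inv_lt_one_of_one_lt₀ hq)
  refine ⟨x 0 * ∑ m ∈ Finset.range N, levelProj q (x 0) m, mul_mem_idealSpan _
    (Submodule.sum_mem _ fun m _ => h.levelProj_mem hq m), ?_⟩
  have e1 : x 0 - x 0 * ∑ m ∈ Finset.range N, levelProj q (x 0) m = cfc (fun t : ℂ =>
      t - t * ∑ m ∈ Finset.range N, (bump |q| (|q| ^ m * ‖t‖) : ℂ)) (x 0) := by
    have e2 : cfc (fun t : ℂ => ∑ m ∈ Finset.range N, (bump |q| (|q| ^ m * ‖t‖) : ℂ)) (x 0) =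
        ∑ m ∈ Finset.range N, levelProj q (x 0) m := by
      have := cfc_sum (fun (m : ℕ) (t : ℂ) => (bump |q| (|q| ^ m * ‖t‖) : ℂ)) (x 0)
        (Finset.range N) (fun m _ => by fun_prop)
      simp only [levelProj, ← this]
      congr 1
      funext t
      simp
    rw [cfc_sub _ _ _, _root_.cfc_mul _ _ _, cfc_id' ℂ (x 0), e2]
  rw [dist_eq_norm, e1]
  refine (norm_cfc_le (by positivity) fun t ht => ?_).trans_lt hN
  rcases h.norm_of_mem_spectrum hq ht with rfl | ⟨k, hk⟩
  · simp
  · have e3 : ∀ m ∈ Finset.range N, (bump |q| (|q| ^ m * ‖t‖) : ℂ) = if m = k then 1 else 0 := by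
      intro m _
      rw [bump_mul_norm hq m k hk]
      split_ifs <;> simp
    rw [Finset.sum_congr rfl e3, Finset.sum_ite_eq']
    split_ifs with hkN
    · simp
    · simp only [mul_zero, sub_zero, hk, zpow_neg, zpow_natCast, ← inv_pow]
      exact pow_le_pow_of_le_one (by positivity) (inv_lt_one_of_one_lt₀ hq).le
        (by simpa using hkN)

end

/-! ### The corner of the vacuum projection -/

section

variable {A : Type*} [CStarAlgebra A] {n : ℕ} {q : ℝ} {x : Fin (n + 1) → A}

/-- The linear span of the elements `x_{j₁}* ⋯ x_{jₘ}* g e`, where all `j_k ≥ 1`, `g` is a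
`*`-polynomial in `x₀` and `e` is the vacuum projection. -/
inductive RaisedSpan (q : ℝ) (x : Fin (n + 1) → A) : A → Prop
  | base (g : A) : g ∈ StarAlgebra.adjoin ℂ {x 0} → RaisedSpan q x (g * vacuum q (x 0))
  | raise (j : Fin (n + 1)) (y : A) : j ≠ 0 → RaisedSpan q x y → RaisedSpan q x (star (x j) * y)
  | add (y z : A) : RaisedSpan q x y → RaisedSpan q x z → RaisedSpan q x (y + z)
  | smul (c : ℂ) (y : A) : RaisedSpan q x y → RaisedSpan q x (c • y)

namespace RaisedSpan

theorem zero : RaisedSpan q x (0 : A) := by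
  simpa using base (q := q) (x := x) 0 (zero_mem _)

theorem sum {ι : Type*} (s : Finset ι) (f : ι → A) (hf : ∀ i ∈ s, RaisedSpan q x (f i)) :
    RaisedSpan q x (∑ i ∈ s, f i) := by
  classical
  induction s using Finset.induction_on with
  | empty => simpa using zero
  | insert i s hi ih =>
    rw [Finset.sum_insert hi]
    exact add _ _ (hf i (by simp)) (ih fun j hj => hf j (by simp [hj]))

theorem zero_mul (h : SphereRel q x) (hq : q ≠ 0) {y : A} (hy : RaisedSpan q x y) :
    RaisedSpan q x (x 0 * y) := by
  have hqc : (q : ℂ) ≠ 0 := by exact_mod_cast hq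
  induction hy with
  | base g hg =>
    rw [← mul_assoc]
    exact base _ (mul_mem (StarAlgebra.self_mem_adjoin_singleton ℂ _) hg)
  | raise j y hj _ ih =>
    have : x 0 * star (x j) = (q : ℂ)⁻¹ • (star (x j) * x 0) := by
      rw [h.star_comm j 0 hj, smul_smul, inv_mul_cancel₀ hqc, one_smul]
    rw [← mul_assoc, this, smul_mul_assoc, mul_assoc]
    exact smul _ _ (raise j _ hj ih)
  | add y z _ _ hy hz => rw [mul_add]; exact add _ _ hy hz
  | smul c y _ hy => rw [mul_smul_comm]; exact smul _ _ hy

theorem star_zero_mul (h : SphereRel q x) (hq : q ≠ 0) {y : A} (hy : RaisedSpan q x y) :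
    RaisedSpan q x (star (x 0) * y) := by
  have hqc : (q : ℂ) ≠ 0 := by exact_mod_cast hq
  induction hy with
  | base g hg =>
    rw [← mul_assoc]
    exact base _ (mul_mem (StarAlgebra.star_self_mem_adjoin_singleton ℂ _) hg)
  | raise j y hj _ ih =>
    have h1 : star (x j) * star (x 0) = (q : ℂ) • (star (x 0) * star (x j)) := by
      simpa using congrArg star (h.zero_mul hj)
    have : star (x 0) * star (x j) = (q : ℂ)⁻¹ • (star (x j) * star (x 0)) := by
      rw [h1, smul_smul, inv_mul_cancel₀ hqc, one_smul]
    rw [← mul_assoc, this, smul_mul_assoc, mul_assoc]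
    exact smul _ _ (raise j _ hj ih)
  | add y z _ _ hy hz => rw [mul_add]; exact add _ _ hy hz
  | smul c y _ hy => rw [mul_smul_comm]; exact smul _ _ hy

end RaisedSpan

/-- Polynomials in `x₀` commute with the vacuum projection. -/
theorem SphereRel.mul_vacuum_of_mem_adjoin (h : SphereRel q x) {g : A}
    (hg : g ∈ StarAlgebra.adjoin ℂ {x 0}) : g * vacuum q (x 0) = vacuum q (x 0) * g := by
  induction hg using StarAlgebra.adjoin_induction with
  | mem y hy => rw [Set.mem_singleton_iff.1 hy, h.zero_mul_vacuum]
  | algebraMap r => exact Algebra.commutes r _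
  | add y z _ _ hy hz => rw [add_mul, mul_add, hy, hz]
  | mul y z _ _ hy hz => rw [mul_assoc, hz, ← mul_assoc, hy, mul_assoc]
  | star y _ hy => simpa [star_vacuum] using (congrArg star hy).symm

/-- The span of the raised vacuum elements is invariant under the lowering operators `x_j`: these
are moved to the right through the raising operators, until they annihilate the vacuum. -/
theorem RaisedSpan.lower (h : SphereRel q x) (hq : 1 < |q|) {y : A} (hy : RaisedSpan q x y)
    {j : Fin (n + 1)} (hj : j ≠ 0) : RaisedSpan q x (x j * y) := by
  have hq0 : q ≠ 0 := by
    rintro rfl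
    simp at hq
    linarith
  have hqc : (q : ℂ) ≠ 0 := by exact_mod_cast hq0
  induction hy generalizing j with
  | base g hg =>
    rw [h.mul_vacuum_of_mem_adjoin hg, ← mul_assoc, h.mul_vacuum hq hj, MulZeroClass.zero_mul]
    exact zero
  | raise i y hi hy ih =>
    by_cases hij : i = j
    · subst hij
      have h1 : x i * star (x i) = star (x i) * x i +
          (1 - ((q : ℂ) ^ 2)⁻¹) • ∑ k ∈ Finset.Iio i, star (x k) * x k := by
        rw [← h.commutator i hi]
        abel
      rw [← mul_assoc, h1, add_mul, smul_mul_assoc, Finset.sum_mul]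
      refine add _ _ ?_ (smul _ _ (sum _ _ fun k _ => ?_))
      · rw [mul_assoc]
        exact raise _ _ hi (ih hi)
      · rw [mul_assoc]
        by_cases hk : k = 0
        · rw [hk]
          exact star_zero_mul h hq0 (zero_mul h hq0 hy)
        · exact raise _ _ hk (ih hk)
    · have : x j * star (x i) = (q : ℂ)⁻¹ • (star (x i) * x j) := by
        rw [h.star_comm i j hij, smul_smul, inv_mul_cancel₀ hqc, one_smul]
      rw [← mul_assoc, this, smul_mul_assoc, mul_assoc]
      exact smul _ _ (raise i _ hi (ih hj))
  | add y z _ _ hy hz => rw [mul_add]; exact add _ _ (hy hj) (hz hj)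
  | smul c y _ hy => rw [mul_smul_comm]; exact smul _ _ (hy hj)

theorem RaisedSpan.mul_of_mem_adjoin (h : SphereRel q x) (hq : 1 < |q|) {a : A}
    (ha : a ∈ StarAlgebra.adjoin ℂ (Set.range x)) :
    ∀ y, RaisedSpan q x y → RaisedSpan q x (a * y) := by
  have hq0 : q ≠ 0 := by
    rintro rfl
    simp at hq
    linarith
  rw [← StarSubalgebra.mem_toSubalgebra, StarAlgebra.adjoin_toSubalgebra] at ha
  induction ha using Algebra.adjoin_induction with
  | mem a ha =>
    intro y hy
    rcases ha with ⟨j, rfl⟩ | ha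
    · by_cases hj : j = 0
      · rw [hj]
        exact hy.zero_mul h hq0
      · exact hy.lower h hq hj
    · obtain ⟨j, hj'⟩ := ha
      obtain rfl : star (x j) = a := by rw [hj', star_star]
      by_cases hj : j = 0
      · rw [hj]
        exact hy.star_zero_mul h hq0
      · exact raise _ _ hj hy
  | algebraMap r =>
    intro y hy
    rw [← Algebra.smul_def]
    exact smul _ _ hy
  | add a b _ _ ha hb => intro y hy; rw [add_mul]; exact add _ _ (ha y hy) (hb y hy)
  | mul a b _ _ ha hb => intro y hy; rw [mul_assoc]; exact ha _ (hb y hy)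

theorem RaisedSpan.vacuum_mul (h : SphereRel q x) (hq : 1 < |q|) {y : A}
    (hy : RaisedSpan q x y) :
    ∃ g ∈ StarAlgebra.adjoin ℂ {x 0}, vacuum q (x 0) * y = g * vacuum q (x 0) := by
  induction hy with
  | base g hg =>
    exact ⟨g, hg, by rw [← mul_assoc, ← h.mul_vacuum_of_mem_adjoin hg, mul_assoc,
      h.vacuum_mul_self hq]⟩
  | raise j y hj _ _ =>
    exact ⟨0, zero_mem _, by
      rw [← mul_assoc, h.vacuum_mul_star hq hj, MulZeroClass.zero_mul, MulZeroClass.zero_mul]⟩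
  | add y z _ _ hy hz =>
    obtain ⟨g, hg, hg'⟩ := hy
    obtain ⟨k, hk, hk'⟩ := hz
    exact ⟨g + k, add_mem hg hk, by rw [mul_add, add_mul, hg', hk']⟩
  | smul c y _ hy =>
    obtain ⟨g, hg, hg'⟩ := hy
    exact ⟨c • g, SMulMemClass.smul_mem c hg, by rw [mul_smul_comm, smul_mul_assoc, hg']⟩

/-- The corner `e 𝒜 e` of the `*`-algebra generated by `x` consists of the elements `g e` with `g`
a `*`-polynomial in `x₀`. -/
theorem SphereRel.exists_vacuum_mul_mul_vacuum (h : SphereRel q x) (hq : 1 < |q|) {a : A}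
    (ha : a ∈ StarAlgebra.adjoin ℂ (Set.range x)) :
    ∃ g ∈ StarAlgebra.adjoin ℂ {x 0},
      vacuum q (x 0) * a * vacuum q (x 0) = g * vacuum q (x 0) := by
  have h1 : RaisedSpan q x (vacuum q (x 0)) := by
    simpa using RaisedSpan.base (q := q) (x := x) 1 (one_mem _)
  rw [mul_assoc]
  exact (RaisedSpan.mul_of_mem_adjoin h hq ha _ h1).vacuum_mul h hq

theorem exists_eq_cfc_of_mem_adjoin {a g : A} [IsStarNormal a]
    (hg : g ∈ StarAlgebra.adjoin ℂ {a}) : ∃ f : ℂ → ℂ, Continuous f ∧ g = cfc f a := by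
  induction hg using StarAlgebra.adjoin_induction with
  | mem y hy => exact ⟨id, continuous_id, by rw [Set.mem_singleton_iff.1 hy, cfc_id ℂ a]⟩
  | algebraMap r => exact ⟨fun _ => r, continuous_const, by rw [cfc_const r a]⟩
  | add y z _ _ hy hz =>
    obtain ⟨f, hf, rfl⟩ := hy
    obtain ⟨k, hk, rfl⟩ := hz
    exact ⟨fun t => f t + k t, hf.add hk, by rw [cfc_add ..]⟩
  | mul y z _ _ hy hz =>
    obtain ⟨f, hf, rfl⟩ := hy
    obtain ⟨k, hk, rfl⟩ := hz
    exact ⟨fun t => f t * k t, hf.mul hk, by rw [cfc_mul ..]⟩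
  | star y _ hy =>
    obtain ⟨f, hf, rfl⟩ := hy
    exact ⟨fun t => star (f t), hf.star, by rw [cfc_star ..]⟩

end

/-- The continuous functional calculus of a normal operator on an eigenvector. -/
theorem cfc_apply_eigenvector {N : BOp} [IsStarNormal N] {v : Hilb} {c : ℂ} (h : N v = c • v)
    (h' : (star N) v = star c • v) {f : ℂ → ℂ} (hf : Continuous f) : cfc f N v = f c • v := by
  by_cases hv : v = 0
  · simp [hv]
  -- the rank one operator `|v⟩⟨v|` intertwines `N` and the scalar `c`
  let R : BOp := (innerSL ℂ v).smulRight v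
  have hR : ∀ w, R w = inner ℂ v w • v := fun w => rfl
  have h1 : N * R = R * algebraMap ℂ BOp c := by
    ext1 w
    simp [hR, Algebra.algebraMap_eq_smul_one, h, smul_smul, mul_comm]
  have h2 : star N * R = R * star (algebraMap ℂ BOp c) := by
    ext1 w
    have : star (algebraMap ℂ BOp c) = algebraMap ℂ BOp (star c) := by
      rw [algebraMap_star_comm]
    rw [this]
    simp [hR, Algebra.algebraMap_eq_smul_one, h', smul_smul, mul_comm]
  have hn : IsStarNormal (algebraMap ℂ BOp c) := ⟨by
    rw [← algebraMap_star_comm]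
    exact Algebra.commutes _ _⟩
  have h3 := cfc_mul_eq_mul_cfc h1 h2 hf
  rw [cfc_algebraMap c f] at h3
  have h4 := congrArg (fun T : BOp => T v) h3
  simp only [mul_apply_eq_comp, hR, map_smul, Algebra.algebraMap_eq_smul_one, smul_apply,
    one_apply_eq_self, inner_smul_right, mul_smul] at h4
  rw [smul_comm (f c)] at h4
  exact smul_right_injective _ (inner_self_ne_zero (𝕜 := ℂ).2 hv) h4

/-! ### Matrix units and compact operators -/

section Compact

variable {ι : Type*} (b : HilbertBasis ι ℂ Hilb)

/-- The matrix unit `|b_k⟩⟨b_l|`. -/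
def matUnit (k l : ι) : BOp := (innerSL ℂ (b l)).smulRight (b k)

theorem matUnit_apply (k l : ι) (v : Hilb) : matUnit b k l v = inner ℂ (b l) v • b k := rfl

theorem matUnit_basis [DecidableEq ι] (k l m : ι) :
    matUnit b k l (b m) = if l = m then b k else 0 := by
  rw [matUnit_apply, orthonormal_iff_ite.1 b.orthonormal l m]
  split_ifs <;> simp

theorem clm_ext_basis {S T : BOp} (h : ∀ k, S (b k) = T (b k)) : S = T := by
  refine ContinuousLinearMap.ext_on (s := Set.range b) ?_ ?_
  · rw [dense_iff_closure_eq, ← Submodule.topologicalClosure_coe, b.dense_span]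
    rfl
  · rintro _ ⟨k, rfl⟩
    exact h k

theorem matUnit_mem_compactOps (k l : ι) : matUnit b k l ∈ compactOps := by
  have h : IsCompactOperator (ContinuousLinearMap.toSpanSingleton ℂ (b k)) :=
    isCompactOperator_of_locallyCompactSpace_rng
      (ContinuousLinearMap.toSpanSingleton ℂ (b k))
  exact h.comp_clm (innerSL ℂ (b l))

theorem star_matUnit (k l : ι) : star (matUnit b k l) = matUnit b l k := by
  rw [ContinuousLinearMap.star_eq_adjoint]
  symm
  rw [ContinuousLinearMap.eq_adjoint_iff]
  intro v w
  simp only [matUnit_apply, inner_smul_left, inner_smul_right, inner_conj_symm]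
  ring

theorem matUnit_mul_matUnit (k l m : ι) : matUnit b k l * matUnit b l m = matUnit b k m := by
  ext1 v
  simp [matUnit_apply, b.orthonormal.1 l]

theorem mul_matUnit_mul (T : BOp) (k l : ι) :
    matUnit b k k * T * matUnit b l l = inner ℂ (b k) (T (b l)) • matUnit b k l := by
  ext1 v
  simp [matUnit_apply, smul_smul, mul_comm]

/-- The orthogonal projection onto the span of finitely many basis vectors. -/
def finProj (s : Finset ι) : BOp := ∑ k ∈ s, matUnit b k k

theorem star_finProj (s : Finset ι) : star (finProj b s) = finProj b s := by
  simp [finProj, star_sum, star_matUnit]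

theorem finProj_mul_self (s : Finset ι) : finProj b s * finProj b s = finProj b s := by
  classical
  refine clm_ext_basis b fun m => ?_
  simp only [finProj, mul_apply_eq_comp, sum_apply, matUnit_basis, Finset.sum_ite_eq']
  split_ifs with h <;> simp [matUnit_basis, h]

theorem norm_finProj_le (s : Finset ι) : ‖finProj b s‖ ≤ 1 := by
  have h := CStarRing.norm_star_mul_self (x := finProj b s)
  rw [star_finProj, finProj_mul_self] at h
  nlinarith [norm_nonneg (finProj b s)]

theorem tendsto_finProj (v : Hilb) :
    Filter.Tendsto (fun s => finProj b s v) Filter.atTop (nhds v) := by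
  have h := b.hasSum_repr v
  rw [HasSum] at h
  simpa [finProj, sum_apply, matUnit_apply, b.repr_apply_apply] using h

/-- Finite truncations of a compact operator converge in norm. -/
theorem tendsto_finProj_mul {T : BOp} (hT : T ∈ compactOps) :
    Filter.Tendsto (fun s => finProj b s * T) Filter.atTop (nhds T) := by
  have hT' : IsCompactOperator T := hT
  have htb : TotallyBounded (T '' Metric.closedBall 0 1) :=
    (hT'.isCompact_closure_image_closedBall (f := T.toLinearMap) 1).totallyBounded.subset
      subset_closure
  refine Metric.tendsto_nhds.2 fun ε hε => ?_
  obtain ⟨t, htf, hcov⟩ := Metric.totallyBounded_iff.1 htb (ε / 4) (by positivity)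
  have hev : ∀ᶠ s in Filter.atTop, ∀ y ∈ t, dist (finProj b s y) y < ε / 4 :=
    (Filter.eventually_all_finite htf).2 fun y _ =>
      Metric.tendsto_nhds.1 (tendsto_finProj b y) _ (by positivity)
  filter_upwards [hev] with s hs
  rw [dist_eq_norm]
  refine lt_of_le_of_lt (b := 3 * (ε / 4)) ?_ (by linarith)
  refine ContinuousLinearMap.opNorm_le_of_unit_norm (by positivity) fun v hv => ?_
  obtain ⟨y, hy, hvy⟩ := Set.mem_iUnion₂.1 (hcov ⟨v, by simp [hv], rfl⟩)
  rw [Metric.mem_ball, dist_eq_norm] at hvy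
  have h1 := hs y hy
  rw [dist_eq_norm] at h1
  have e : (finProj b s * T - T) v =
      finProj b s (T v - y) + (finProj b s y - y) - (T v - y) := by
    simp only [sub_apply, mul_apply_eq_comp, map_sub]
    abel
  have h2 : ‖finProj b s (T v - y)‖ ≤ ‖T v - y‖ := by
    simpa using (finProj b s).le_of_opNorm_le (norm_finProj_le b s) (T v - y)
  rw [e]
  have h3 := norm_sub_le (finProj b s (T v - y) + (finProj b s y - y)) (T v - y)
  have h4 := norm_add_le (finProj b s (T v - y)) (finProj b s y - y)
  linarith

/-- Every compact operator is a norm limit of linear combinations of matrix units. -/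
theorem mem_closure_span_matUnit {T : BOp} (hT : T ∈ compactOps) :
    T ∈ closure (Submodule.span ℂ (Set.range fun p : ι × ι => matUnit b p.1 p.2) : Set BOp) := by
  have h1 := tendsto_finProj_mul b hT
  have h2 : Filter.Tendsto (fun s => T * finProj b s) Filter.atTop (nhds T) := by
    have := (tendsto_finProj_mul b (star_mem hT)).star
    simpa [star_finProj] using this
  have h3 : Filter.Tendsto (fun s => finProj b s * T * finProj b s) Filter.atTop (nhds T) := by
    rw [tendsto_iff_norm_sub_tendsto_zero] at h1 h2 ⊢
    refine squeeze_zero (fun _ => norm_nonneg _) (fun s => ?_) (by simpa using h2.add h1)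
    have e : finProj b s * T * finProj b s - T =
        finProj b s * (T * finProj b s - T) + (finProj b s * T - T) := by
      noncomm_ring
    rw [e]
    refine (norm_add_le _ _).trans (add_le_add_left ?_ _)
    calc ‖finProj b s * (T * finProj b s - T)‖ ≤ ‖finProj b s‖ * ‖T * finProj b s - T‖ :=
          norm_mul_le _ _
      _ ≤ 1 * ‖T * finProj b s - T‖ := by gcongr; exact norm_finProj_le b s
      _ = _ := one_mul _
  refine mem_closure_of_tendsto h3 (Filter.Eventually.of_forall fun s => ?_)
  rw [finProj, Finset.sum_mul, Finset.sum_mul_sum]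
  refine Submodule.sum_mem _ fun k _ => Submodule.sum_mem _ fun l _ => ?_
  rw [mul_matUnit_mul]
  exact Submodule.smul_mem _ _ (Submodule.subset_span ⟨(k, l), rfl⟩)

end Compact

/-! ### Operator-valued functions -/

section Tensor

variable {X : Type*} [TopologicalSpace X]

/-- The elementary tensor `f ⊗ T` in `C(X) ⊗ B(ℓ²(ℕ))`, realized as the function
`z ↦ f(z) T`. -/
def funTensor (f : C(X, ℂ)) (T : BOp) : C(X, BOp) :=
  ⟨fun z => f z • T, f.continuous.smul continuous_const⟩

@[simp]
theorem funTensor_apply (f : C(X, ℂ)) (T : BOp) (z : X) : funTensor f T z = f z • T := rfl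

theorem funTensor_mul (f g : C(X, ℂ)) (S T : BOp) :
    funTensor f S * funTensor g T = funTensor (f * g) (S * T) := by
  ext1 z
  simp [smul_smul, mul_comm]

theorem star_funTensor (f : C(X, ℂ)) (T : BOp) :
    star (funTensor f T) = funTensor (star f) (star T) := by
  ext1 z
  simp

theorem continuous_funTensor_left (T : BOp) : Continuous fun f : C(X, ℂ) => funTensor f T :=
  ContinuousMap.continuous_postcomp (X := X)
    (⟨fun c : ℂ => c • T, by fun_prop⟩ : C(ℂ, BOp))

variable [CompactSpace X]

theorem continuous_funTensor_right (f : C(X, ℂ)) : Continuous fun T : BOp => funTensor f T := by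
  have h : (fun T : BOp => funTensor f T) = fun T => funTensor f 1 * ContinuousMap.const X T := by
    funext T
    ext1 z
    simp
  rw [h]
  exact continuous_const.mul ContinuousMap.continuous_const'

variable (X) in
/-- The C*-tensor product `C(X) ⊗ K`, realized inside `C(X, B(ℓ²(ℕ)))`. -/
def tensorCompact : NonUnitalStarSubalgebra ℂ C(X, BOp) :=
  (NonUnitalStarAlgebra.adjoin ℂ
    {F | ∃ (f : C(X, ℂ)) (T : BOp), T ∈ compactOps ∧ F = funTensor f T}).topologicalClosure

theorem isClosed_tensorCompact : IsClosed (tensorCompact X : Set C(X, BOp)) :=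
  NonUnitalStarSubalgebra.isClosed_topologicalClosure _

theorem funTensor_mem_tensorCompact (f : C(X, ℂ)) {T : BOp} (hT : T ∈ compactOps) :
    funTensor f T ∈ tensorCompact X :=
  NonUnitalStarSubalgebra.le_topologicalClosure _
    (NonUnitalStarAlgebra.subset_adjoin ℂ _ ⟨f, T, hT, rfl⟩)

theorem tensorCompact_le {S : NonUnitalStarSubalgebra ℂ C(X, BOp)}
    (hS : IsClosed (S : Set C(X, BOp))) (h : ∀ f : C(X, ℂ), ∀ T ∈ compactOps, funTensor f T ∈ S) :
    tensorCompact X ≤ S := by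
  refine NonUnitalStarSubalgebra.topologicalClosure_minimal _
    (NonUnitalStarAlgebra.adjoin_le ?_) hS
  rintro _ ⟨f, T, hT, rfl⟩
  exact h f T hT

theorem apply_mem_compactOps {F : C(X, BOp)} (hF : F ∈ tensorCompact X) (z : X) :
    F z ∈ compactOps := by
  let ev : C(X, BOp) →⋆ₙₐ[ℂ] BOp :=
    { toFun := fun F => F z
      map_smul' := fun _ _ => rfl
      map_zero' := rfl
      map_add' := fun _ _ => rfl
      map_mul' := fun _ _ => rfl
      map_star' := fun _ => rfl }
  have hc : IsClosed (compactOps : Set BOp) := isClosed_setOfPred_isCompactOperator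
  exact tensorCompact_le (S := compactOps.comap ev)
    (hc.preimage (continuous_eval_const z))
    (fun f T hT => SMulMemClass.smul_mem (f z) hT) hF

/-- `C(X) ⊗ K` is invariant under multiplication by `f ⊗ S` with `S` bounded. -/
theorem funTensor_mul_mem_tensorCompact (f : C(X, ℂ)) (S : BOp) {F : C(X, BOp)}
    (hF : F ∈ tensorCompact X) : funTensor f S * F ∈ tensorCompact X := by
  -- the elements that stay in `C(X) ⊗ K` under multiplication from either side; the two-sided
  -- condition makes this set closed under adjoints
  let D : NonUnitalStarSubalgebra ℂ C(X, BOp) :=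
    { carrier := {F | F ∈ tensorCompact X ∧ ∀ f S, funTensor f S * F ∈ tensorCompact X ∧
        F * funTensor f S ∈ tensorCompact X}
      zero_mem' := ⟨zero_mem _, fun f S => by simp⟩
      add_mem' := fun {F G} hF hG => ⟨add_mem hF.1 hG.1, fun f S => by
        rw [mul_add, add_mul]
        exact ⟨add_mem (hF.2 f S).1 (hG.2 f S).1, add_mem (hF.2 f S).2 (hG.2 f S).2⟩⟩
      mul_mem' := fun {F G} hF hG => ⟨mul_mem hF.1 hG.1, fun f S => by
        rw [← mul_assoc, mul_assoc F]
        exact ⟨mul_mem (hF.2 f S).1 hG.1, mul_mem hF.1 (hG.2 f S).2⟩⟩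
      smul_mem' := fun c F hF => ⟨SMulMemClass.smul_mem c hF.1, fun f S => by
        rw [mul_smul_comm, smul_mul_assoc]
        exact ⟨SMulMemClass.smul_mem c (hF.2 f S).1, SMulMemClass.smul_mem c (hF.2 f S).2⟩⟩
      star_mem' := fun {F} hF => ⟨star_mem hF.1, fun f S => by
        have h := hF.2 (star f) (star S)
        rw [← star_funTensor] at h
        have h1 := star_mem h.1
        have h2 := star_mem h.2
        have e1 : star (star (funTensor f S) * F) = star F * funTensor f S := by
          ext1 z
          simp
        have e2 : star (F * star (funTensor f S)) = funTensor f S * star F := by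
          ext1 z
          simp
        exact ⟨e2 ▸ h2, e1 ▸ h1⟩⟩ }
  have hD : IsClosed (D : Set C(X, BOp)) := by
    have e : (D : Set C(X, BOp)) = {F | F ∈ (tensorCompact X : Set C(X, BOp))} ∩
        ⋂ f : C(X, ℂ), ⋂ S : BOp, {F | funTensor f S * F ∈ (tensorCompact X : Set C(X, BOp))} ∩
          {F | F * funTensor f S ∈ (tensorCompact X : Set C(X, BOp))} := by
      ext F
      simp only [Set.mem_inter_iff, Set.mem_iInter]
      rfl
    rw [e]
    refine isClosed_tensorCompact.inter (isClosed_iInter fun f => isClosed_iInter fun S => ?_)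
    exact (isClosed_tensorCompact.preimage (continuous_const_mul _)).inter
      (isClosed_tensorCompact.preimage (continuous_mul_const _))
  have hle : tensorCompact X ≤ D := tensorCompact_le hD fun g T hT =>
    ⟨funTensor_mem_tensorCompact g hT, fun f S => by
      have hT' : IsCompactOperator T := hT
      rw [funTensor_mul, funTensor_mul]
      exact ⟨funTensor_mem_tensorCompact _ (T := S * T) (hT'.clm_comp S),
        funTensor_mem_tensorCompact _ (T := T * S) (hT'.comp_clm S)⟩⟩
  exact ((hle hF).2 f S).1

end Tensor

/-! ### Fock models and Fock homomorphisms -/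

/-- A representation of the relations on `ℓ²(ℕ)` with self-adjoint first generator and
one-dimensional vacuum space: an orthonormal basis of eigenvectors of `x₀`, each obtained from the
vacuum vector by the raising operators. -/
structure FockModel (q : ℝ) (n : ℕ) where
  ι : Type
  basis : HilbertBasis ι ℂ Hilb
  vac : ι
  op : Fin (n + 1) → BOp
  rel : SphereRel q op
  star_zero : star (op 0) = op 0
  zero_vac : op 0 (basis vac) = basis vac
  zero_apply : ∀ k, k ≠ vac → ∃ c : ℝ, |c| ≤ |q|⁻¹ ∧ op 0 (basis k) = (c : ℂ) • basis k
  raise : ∀ k, ∃ (w : List (Fin n)) (c : ℂ), c ≠ 0 ∧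
    ((w.map fun j => star (op j.succ)).prod : BOp) (basis vac) = c • basis k

namespace FockModel

variable {q : ℝ} {n : ℕ} (M : FockModel q n)

/-- Multiplying the first generator of a Fock model by a phase. -/
def twist (c : ℂ) : Fin (n + 1) → BOp := Function.update M.op 0 (c • M.op 0)

@[simp]
theorem twist_zero (c : ℂ) : M.twist c 0 = c • M.op 0 := by simp [twist]

theorem twist_of_ne (c : ℂ) {j : Fin (n + 1)} (hj : j ≠ 0) : M.twist c j = M.op j := by
  simp [twist, hj]

theorem star_twist_mul_self {c : ℂ} (hc : ‖c‖ = 1) (j : Fin (n + 1)) :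
    star (M.twist c j) * M.twist c j = star (M.op j) * M.op j := by
  by_cases hj : j = 0
  · subst hj
    have : star c * c = 1 := by
      rw [Complex.star_def, ← Complex.normSq_eq_conj_mul_self, Complex.normSq_eq_norm_sq, hc]
      simp
    rw [twist_zero, star_smul, smul_mul_smul_comm, this, one_smul]
  · rw [twist_of_ne M c hj]

theorem twist_rel {c : ℂ} (hc : ‖c‖ = 1) : SphereRel q (M.twist c) where
  normal := by
    simp only [twist_zero, star_smul, smul_mul_smul_comm, M.rel.normal, mul_comm]
  comm i j hij := by
    have hj : j ≠ 0 := fun h => by simp [h] at hij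
    rw [twist_of_ne M c hj]
    by_cases hi : i = 0
    · subst hi
      rw [twist_zero, smul_mul_assoc, M.rel.comm 0 j hij, mul_smul_comm, smul_comm]
    · rw [twist_of_ne M c hi]
      exact M.rel.comm i j hij
  star_comm i j hij := by
    by_cases hi : i = 0
    · subst hi
      rw [twist_zero, twist_of_ne M c hij.symm, star_smul, smul_mul_assoc,
        M.rel.star_comm 0 j hij, mul_smul_comm, smul_comm]
    · rw [twist_of_ne M c hi]
      by_cases hj : j = 0
      · subst hj
        rw [twist_zero, mul_smul_comm, M.rel.star_comm i 0 hij, smul_mul_assoc, smul_comm]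
      · rw [twist_of_ne M c hj]
        exact M.rel.star_comm i j hij
  commutator i hi := by
    simp only [star_twist_mul_self M hc]
    rw [twist_of_ne M c hi]
    exact M.rel.commutator i hi
  radius := by
    simp only [star_twist_mul_self M hc]
    exact M.rel.radius

end FockModel

section

variable {A : Type*} [CStarAlgebra A] {n : ℕ} {q : ℝ} {x : Fin (n + 1) → A}
  {X : Type*} [TopologicalSpace X]

/-- A `*`-homomorphism `A → C(X, B(ℓ²(ℕ)))` restricting at each `z : X` to the Fock model with
phase `ζ z`. -/
structure IsFockHom (M : FockModel q n) (x : Fin (n + 1) → A) (ζ : C(X, ℂ))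
    (Ψ : A →⋆ₐ[ℂ] C(X, BOp)) : Prop where
  norm_phase : ∀ z, ‖ζ z‖ = 1
  apply : ∀ i z, Ψ (x i) z = M.twist (ζ z) i

namespace IsFockHom

variable {M : FockModel q n} {ζ : C(X, ℂ)} {Ψ : A →⋆ₐ[ℂ] C(X, BOp)}

theorem map_zero_gen (hΨ : IsFockHom M x ζ Ψ) : Ψ (x 0) = funTensor ζ (M.op 0) := by
  ext1 z
  rw [hΨ.apply, M.twist_zero, funTensor_apply]

theorem map_succ_gen (hΨ : IsFockHom M x ζ Ψ) {j : Fin (n + 1)} (hj : j ≠ 0) :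
    Ψ (x j) = funTensor 1 (M.op j) := by
  ext1 z
  rw [hΨ.apply, M.twist_of_ne _ hj, funTensor_apply]
  simp

/-- Evaluation at a point, as a homomorphism to the bounded operators. -/
def evalHom (Ψ : A →⋆ₐ[ℂ] C(X, BOp)) (z : X) : A →⋆ₐ[ℂ] BOp where
  toFun a := Ψ a z
  map_one' := by simp
  map_mul' a b := by simp
  map_zero' := by simp
  map_add' a b := by simp
  commutes' r := by rw [AlgHomClass.commutes]; rfl
  map_star' a := by rw [map_star]; rfl

theorem evalHom_apply (z : X) (a : A) : evalHom Ψ z a = Ψ a z := rfl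

/-- A function of `x₀` acts on eigenvectors of `x₀` by evaluation at the eigenvalue. -/
theorem cfc_apply (h : SphereRel q x) (hΨ : IsFockHom M x ζ Ψ) {f : ℂ → ℂ}
    (hf : Continuous f) (z : X) {v : Hilb} {c : ℝ} (hv : M.op 0 v = (c : ℂ) • v) :
    Ψ (cfc f (x 0)) z v = f (ζ z * c) • v := by
  have := h.isStarNormal
  have hn : IsStarNormal (evalHom Ψ z (x 0)) := this.map (evalHom Ψ z)
  have h1 : evalHom Ψ z (cfc f (x 0)) = cfc f (evalHom Ψ z (x 0)) :=
    StarAlgHomClass.map_cfc (S := ℂ) _ f (x 0) (by fun_prop) (map_continuous _) this hn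
  rw [← evalHom_apply (Ψ := Ψ), h1]
  refine cfc_apply_eigenvector ?_ ?_ hf
  · rw [evalHom_apply, hΨ.apply, M.twist_zero, smul_apply, hv, smul_smul]
  · rw [evalHom_apply, hΨ.apply, M.twist_zero, star_smul, M.star_zero, smul_apply, hv, smul_smul]
    simp

/-- The vacuum projection is mapped to the constant rank one projection onto the vacuum vector. -/
theorem map_vacuum (h : SphereRel q x) (hq : 1 < |q|) (hΨ : IsFockHom M x ζ Ψ) :
    Ψ (vacuum q (x 0)) = funTensor 1 (matUnit M.basis M.vac M.vac) := by
  classical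
  ext1 z
  refine clm_ext_basis M.basis fun k => ?_
  rw [funTensor_apply, smul_apply, matUnit_basis, vacuum, levelProj]
  by_cases hk : k = M.vac
  · subst hk
    rw [cfc_apply (c := 1) h hΨ (by fun_prop) z (by simpa using M.zero_vac)]
    simp [hΨ.norm_phase, bump_one]
  · obtain ⟨c, hc, hc'⟩ := M.zero_apply k hk
    rw [cfc_apply h hΨ (by fun_prop) z hc', if_neg (Ne.symm hk)]
    have : bump |q| |c| = 0 := bump_eq_zero hq (Or.inl hc)
    simp [hΨ.norm_phase, this]

variable [CompactSpace X]

/-- A Fock homomorphism whose phases exhaust the spectrum of `x₀` on the unit circle is isometric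
on the corner of the vacuum projection. -/
theorem norm_corner_le (h : SphereRel q x) (hq : 1 < |q|) (hΨ : IsFockHom M x ζ Ψ)
    (hspec : ∀ t ∈ spectrum ℂ (x 0), ‖t‖ = 1 → ∃ z, ζ z = t)
    (hgen : closure (StarAlgebra.adjoin ℂ (Set.range x) : Set A) = Set.univ) (a : A) :
    ‖vacuum q (x 0) * a * vacuum q (x 0)‖ ≤
      ‖Ψ (vacuum q (x 0) * a * vacuum q (x 0))‖ := by
  have hnorm := h.isStarNormal
  have hΨc : Continuous Ψ := map_continuous Ψ
  have ha : a ∈ closure (StarAlgebra.adjoin ℂ (Set.range x) : Set A) := hgen ▸ Set.mem_univ a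
  -- by density and `exists_vacuum_mul_mul_vacuum` it suffices to treat `f(x₀) e`
  refine closure_minimal (s := (StarAlgebra.adjoin ℂ (Set.range x) : Set A))
    (t := {a | ‖vacuum q (x 0) * a * vacuum q (x 0)‖ ≤
      ‖Ψ (vacuum q (x 0) * a * vacuum q (x 0))‖}) (fun a ha => ?_)
    (isClosed_le (by fun_prop) (by fun_prop)) ha
  obtain ⟨g, hg, hg'⟩ := h.exists_vacuum_mul_mul_vacuum hq ha
  obtain ⟨f, hf, rfl⟩ := exists_eq_cfc_of_mem_adjoin hg
  simp only [Set.mem_ofPred_eq]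
  rw [hg']
  set C := ‖Ψ (cfc f (x 0) * vacuum q (x 0))‖ with hC
  rw [vacuum, levelProj, ← _root_.cfc_mul _ _ _ (by fun_prop) (by fun_prop)]
  refine norm_cfc_le (norm_nonneg _) fun t ht => ?_
  rcases h.bump_spectrum hq 0 ht with h0 | ⟨h0, h1⟩
  · rw [h0, Complex.ofReal_zero, mul_zero, norm_zero]
    exact norm_nonneg _
  · rw [pow_zero, one_mul] at h1
    obtain ⟨z, rfl⟩ := hspec t ht h1
    rw [h0, Complex.ofReal_one, mul_one]
    have hv : ‖M.basis M.vac‖ = 1 := M.basis.orthonormal.1 _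
    have h2 : Ψ (cfc f (x 0) * vacuum q (x 0)) z (M.basis M.vac) =
        f (ζ z) • M.basis M.vac := by
      classical
      rw [map_mul, map_vacuum h hq hΨ, ContinuousMap.mul_apply, mul_apply_eq_comp,
        funTensor_apply, smul_apply, matUnit_basis, if_pos rfl, ContinuousMap.one_apply, one_smul,
        cfc_apply (c := 1) h hΨ hf z (by simpa using M.zero_vac)]
      simp
    calc ‖f (ζ z)‖ = ‖Ψ (cfc f (x 0) * vacuum q (x 0)) z (M.basis M.vac)‖ := by
          rw [h2, norm_smul, hv, mul_one]
      _ ≤ ‖Ψ (cfc f (x 0) * vacuum q (x 0)) z‖ * ‖M.basis M.vac‖ :=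
          ContinuousLinearMap.le_opNorm _ _
      _ ≤ C := by
          rw [hv, mul_one]
          exact ContinuousMap.norm_coe_le_norm _ z

end IsFockHom

/-! ### The closed ideal of a self-adjoint element -/

theorem star_mem_idealSpan {e y : A} (he : star e = e) (hy : y ∈ idealSpan e) :
    star y ∈ idealSpan e := by
  induction hy using Submodule.span_induction with
  | mem y hy =>
    obtain ⟨p, rfl⟩ := hy
    refine Submodule.subset_span ⟨(star p.2, star p.1), ?_⟩
    simp [he, mul_assoc]
  | zero => simp
  | add y z _ _ hy hz => rw [star_add]; exact add_mem hy hz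
  | smul c y _ hy => rw [star_smul]; exact Submodule.smul_mem _ _ hy

/-- The closed two-sided ideal generated by a self-adjoint element, as a `*`-subalgebra. -/
def closedIdealStar (e : A) (he : star e = e) : NonUnitalStarSubalgebra ℂ A where
  carrier := closure (idealSpan e)
  zero_mem' := subset_closure (zero_mem _)
  add_mem' ha hb := map_mem_closure₂ continuous_add ha hb fun _ h _ h' => add_mem h h'
  mul_mem' ha hb := map_mem_closure₂ continuous_mul ha hb fun _ _ _ h' => mul_mem_idealSpan _ h'
  smul_mem' c _ ha := map_mem_closure (continuous_const_smul c) ha fun _ h =>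
    Submodule.smul_mem _ _ h
  star_mem' ha := map_mem_closure continuous_star ha fun _ h => star_mem_idealSpan he h

theorem isClosed_closedIdealStar {e : A} {he : star e = e} :
    IsClosed (closedIdealStar e he : Set A) := isClosed_closure

theorem mul_mem_closedIdealStar {e : A} {he : star e = e} {y : A} (a : A)
    (hy : y ∈ closedIdealStar e he) : a * y ∈ closedIdealStar e he :=
  map_mem_closure (continuous_const_mul a) hy fun _ h => mul_mem_idealSpan a h

theorem closedIdealStar_mul_mem {e : A} {he : star e = e} {y : A} (a : A)
    (hy : y ∈ closedIdealStar e he) : y * a ∈ closedIdealStar e he :=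
  map_mem_closure (f := fun y => y * a) (continuous_mul_const a) hy
    fun _ h => idealSpan_mul_mem a h

/-- An element of the closed ideal generated by `e` vanishes as soon as all its compressions
`e a y c e` vanish. -/
theorem eq_zero_of_corner_eq_zero {e : A} {he : star e = e} {y : A}
    (hy : y ∈ closedIdealStar e he) (h : ∀ a c, e * a * y * c * e = 0) : y = 0 := by
  have h1 : ∀ u ∈ idealSpan e, ∀ v ∈ idealSpan e, u * y * v = 0 := by
    intro u hu v hv
    induction hu using Submodule.span_induction with
    | mem u hu =>
      obtain ⟨p, rfl⟩ := hu
      induction hv using Submodule.span_induction with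
      | mem v hv =>
        obtain ⟨r, rfl⟩ := hv
        have := h p.2 r.1
        calc p.1 * e * p.2 * y * (r.1 * e * r.2) = p.1 * (e * p.2 * y * r.1 * e) * r.2 := by
              simp only [mul_assoc]
          _ = 0 := by rw [this]; simp
      | zero => simp
      | add v w _ _ hv hw => rw [mul_add, hv, hw, add_zero]
      | smul c v _ hv => rw [mul_smul_comm, hv, smul_zero]
    | zero => simp
    | add u w _ _ hu hw => rw [add_mul, add_mul, hu, hw, add_zero]
    | smul c u _ hu => rw [smul_mul_assoc, smul_mul_assoc, hu, smul_zero]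
  have h2 : ∀ u ∈ closedIdealStar e he, ∀ v ∈ closedIdealStar e he, u * y * v = 0 := by
    intro u hu v hv
    have := map_mem_closure₂ (f := fun u v => u * y * v) (u := {0}) (by fun_prop) hu hv
      fun u hu v hv => h1 u hu v hv
    simpa using this
  -- with `u = v = y*` this gives `(y* y)² = 0`
  have h3 := h2 _ (star_mem hy) _ (star_mem hy)
  have h4 : star (star y * y) * (star y * y) = 0 := by
    rw [star_mul, star_star, ← mul_assoc, h3, MulZeroClass.zero_mul]
  rw [CStarRing.star_mul_self_eq_zero_iff, CStarRing.star_mul_self_eq_zero_iff] at h4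
  exact h4

end

/-! ### The ideal of the vacuum projection is `C(X) ⊗ K` -/

section

variable {A : Type*} [CStarAlgebra A] {n : ℕ} {q : ℝ} {x : Fin (n + 1) → A}
  {X : Type*} [TopologicalSpace X]

/-- The inverse of an injective `*`-homomorphism of `*`-subalgebras onto its image. -/
theorem exists_inverse_onto {B : Type*} [CStarAlgebra B] (J : NonUnitalStarSubalgebra ℂ A)
    (S : NonUnitalStarSubalgebra ℂ B) (Φ : J →⋆ₙₐ[ℂ] B) (hΦ : Function.Injective Φ)
    (hmem : ∀ y, Φ y ∈ S) (hsurj : ∀ F ∈ S, ∃ y, Φ y = F) :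
    ∃ ι : S →⋆ₙₐ[ℂ] A, Function.Injective ι ∧ Set.range ι = (J : Set A) := by
  let Φ' : J →⋆ₙₐ[ℂ] S := NonUnitalStarAlgHom.codRestrict Φ S hmem
  have hbij : Function.Bijective Φ' := by
    refine ⟨fun y z hyz => hΦ (congrArg Subtype.val hyz), fun F => ?_⟩
    obtain ⟨y, hy⟩ := hsurj F F.2
    exact ⟨y, Subtype.ext hy⟩
  let E := StarAlgEquiv.ofBijective Φ' hbij
  refine ⟨(NonUnitalStarSubalgebraClass.subtype J).comp (E.symm : S →⋆ₙₐ[ℂ] J),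
    fun F G hFG => E.symm.injective (Subtype.ext hFG), ?_⟩
  ext y
  constructor
  · rintro ⟨F, rfl⟩
    exact (E.symm F).2
  · intro hy
    exact ⟨E ⟨y, hy⟩, congrArg Subtype.val (E.symm_apply_apply ⟨y, hy⟩)⟩

/-- Induction over the elements of a C*-algebra that is generated by the tuple `x`. -/
theorem closure_eq_univ_induction {p : A → Prop}
    (hgen : closure (StarAlgebra.adjoin ℂ (Set.range x) : Set A) = Set.univ)
    (mem : ∀ i, p (x i)) (star_mem : ∀ i, p (star (x i))) (scalar : ∀ r, p (algebraMap ℂ A r))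
    (add : ∀ a b, p a → p b → p (a + b)) (mul : ∀ a b, p a → p b → p (a * b))
    (closed : IsClosed {a | p a}) (a : A) : p a := by
  have ha : a ∈ closure (StarAlgebra.adjoin ℂ (Set.range x) : Set A) := hgen ▸ Set.mem_univ a
  refine closure_minimal (t := {a | p a}) (fun a ha => ?_) closed ha
  rw [SetLike.mem_coe, ← StarSubalgebra.mem_toSubalgebra, StarAlgebra.adjoin_toSubalgebra] at ha
  induction ha using Algebra.adjoin_induction with
  | mem a ha =>
    rcases ha with ⟨j, rfl⟩ | ⟨j, hj⟩
    · exact mem j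
    · have : a = star (x j) := by rw [hj, star_star]
      rw [this]
      exact star_mem j
  | algebraMap r => exact scalar r
  | add a b _ _ ha hb => exact add a b ha hb
  | mul a b _ _ ha hb => exact mul a b ha hb

namespace IsFockHom

variable {M : FockModel q n} {ζ : C(X, ℂ)} {Ψ : A →⋆ₐ[ℂ] C(X, BOp)}

/-- The restriction of a homomorphism to the closed ideal generated by the vacuum projection. -/
def idealHom (q : ℝ) (x : Fin (n + 1) → A) (Ψ : A →⋆ₐ[ℂ] C(X, BOp)) :
    closedIdealStar (vacuum q (x 0)) (star_vacuum (x 0)) →⋆ₙₐ[ℂ] C(X, BOp) :=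
  (Ψ : A →⋆ₙₐ[ℂ] C(X, BOp)).comp (NonUnitalStarSubalgebraClass.subtype _)

theorem idealHom_apply (y : closedIdealStar (vacuum q (x 0)) (star_vacuum (x 0))) :
    idealHom q x Ψ y = Ψ y := rfl

variable [CompactSpace X]

theorem map_mul_mem_tensorCompact (hΨ : IsFockHom M x ζ Ψ)
    (hgen : closure (StarAlgebra.adjoin ℂ (Set.range x) : Set A) = Set.univ) (a : A) :
    ∀ F ∈ tensorCompact X, Ψ a * F ∈ tensorCompact X := by
  induction a using closure_eq_univ_induction (x := x) hgen with
  | mem i =>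
    intro F hF
    by_cases hi : i = 0
    · rw [hi, hΨ.map_zero_gen]
      exact funTensor_mul_mem_tensorCompact _ _ hF
    · rw [hΨ.map_succ_gen hi]
      exact funTensor_mul_mem_tensorCompact _ _ hF
  | star_mem i =>
    intro F hF
    rw [map_star]
    by_cases hi : i = 0
    · rw [hi, hΨ.map_zero_gen, star_funTensor]
      exact funTensor_mul_mem_tensorCompact _ _ hF
    · rw [hΨ.map_succ_gen hi, star_funTensor]
      exact funTensor_mul_mem_tensorCompact _ _ hF
  | scalar r =>
    intro F hF
    rw [AlgHomClass.commutes, ← Algebra.smul_def]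
    exact SMulMemClass.smul_mem r hF
  | add a b ha hb =>
    intro F hF
    rw [map_add, add_mul]
    exact add_mem (ha F hF) (hb F hF)
  | mul a b ha hb =>
    intro F hF
    rw [map_mul, mul_assoc]
    exact ha _ (hb F hF)
  | closed =>
    have hc : Continuous Ψ := map_continuous Ψ
    simp only [Set.ofPred_forall]
    exact isClosed_iInter fun _ => isClosed_iInter fun _ =>
      isClosed_tensorCompact.preimage (hc.mul continuous_const)

theorem mul_map_mem_tensorCompact (hΨ : IsFockHom M x ζ Ψ)
    (hgen : closure (StarAlgebra.adjoin ℂ (Set.range x) : Set A) = Set.univ) (a : A)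
    {F : C(X, BOp)} (hF : F ∈ tensorCompact X) : F * Ψ a ∈ tensorCompact X := by
  have h := star_mem (map_mul_mem_tensorCompact hΨ hgen (star a) _ (star_mem hF))
  have e : star (Ψ (star a) * star F) = F * Ψ a := by
    rw [map_star]
    ext1 z
    simp
  rwa [e] at h

theorem map_mem_tensorCompact (h : SphereRel q x) (hq : 1 < |q|) (hΨ : IsFockHom M x ζ Ψ)
    (hgen : closure (StarAlgebra.adjoin ℂ (Set.range x) : Set A) = Set.univ) {y : A}
    (hy : y ∈ closure (idealSpan (vacuum q (x 0)) : Set A)) : Ψ y ∈ tensorCompact X := by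
  have hc : Continuous Ψ := map_continuous Ψ
  refine closure_minimal (t := Ψ ⁻¹' (tensorCompact X : Set C(X, BOp))) (fun y hy => ?_)
    (isClosed_tensorCompact.preimage hc) hy
  rw [Set.mem_preimage]
  rw [SetLike.mem_coe] at hy ⊢
  induction hy using Submodule.span_induction with
  | mem y hy =>
    obtain ⟨p, rfl⟩ := hy
    simp only [map_mul, map_vacuum h hq hΨ]
    exact mul_map_mem_tensorCompact hΨ hgen _ (map_mul_mem_tensorCompact hΨ hgen _ _
      (funTensor_mem_tensorCompact _ (matUnit_mem_compactOps _ _ _)))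
  | zero => simp
  | add y z _ _ hy hz => rw [map_add]; exact add_mem hy hz
  | smul c y _ hy => rw [map_smul]; exact SMulMemClass.smul_mem c hy

theorem eq_zero_of_map_eq_zero (h : SphereRel q x) (hq : 1 < |q|) (hΨ : IsFockHom M x ζ Ψ)
    (hspec : ∀ t ∈ spectrum ℂ (x 0), ‖t‖ = 1 → ∃ z, ζ z = t)
    (hgen : closure (StarAlgebra.adjoin ℂ (Set.range x) : Set A) = Set.univ) {y : A}
    (hy : y ∈ closure (idealSpan (vacuum q (x 0)) : Set A)) (hy0 : Ψ y = 0) : y = 0 := by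
  refine eq_zero_of_corner_eq_zero (he := star_vacuum _) hy fun a c => ?_
  have := norm_corner_le h hq hΨ hspec hgen (a * y * c)
  have e : Ψ (vacuum q (x 0) * (a * y * c) * vacuum q (x 0)) = 0 := by
    simp [hy0]
  rw [e, norm_zero] at this
  simpa only [mul_assoc] using norm_le_zero_iff.1 this

/-- The operators `x_j*` raise the vacuum vector to all basis vectors, uniformly in the phase. -/
theorem exists_raise (hΨ : IsFockHom M x ζ Ψ) (k : M.ι) :
    ∃ r : A, ∀ z, Ψ r z (M.basis M.vac) = M.basis k := by
  obtain ⟨w, c, hc, hw⟩ := M.raise k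
  refine ⟨c⁻¹ • (w.map fun j => star (x j.succ)).prod, fun z => ?_⟩
  have e : evalHom Ψ z (w.map fun j => star (x j.succ)).prod =
      (w.map fun j => star (M.op j.succ)).prod := by
    rw [map_list_prod, List.map_map]
    congr 2
    funext j
    simp only [Function.comp_apply, map_star]
    rw [evalHom_apply, hΨ.apply, M.twist_of_ne _ (Fin.succ_ne_zero j)]
  rw [map_smul, ContinuousMap.smul_apply, smul_apply, ← evalHom_apply, e, hw, smul_smul,
    inv_mul_cancel₀ hc, one_smul]

/-- The image of the ideal contains all `f ⊗ |b_k⟩⟨b_l|`, by the Stone–Weierstrass theorem. -/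
theorem funTensor_matUnit_mem (h : SphereRel q x) (hq : 1 < |q|) (hΨ : IsFockHom M x ζ Ψ)
    (hζ : Function.Injective ζ) {S : NonUnitalStarSubalgebra ℂ C(X, BOp)}
    (hS : IsClosed (S : Set C(X, BOp)))
    (hmem : ∀ y ∈ idealSpan (vacuum q (x 0)), Ψ y ∈ S)
    (hmul : ∀ (a b : A), ∀ F ∈ S, Ψ a * F * Ψ b ∈ S) (f : C(X, ℂ)) (k l : M.ι) :
    funTensor f (matUnit M.basis k l) ∈ S := by
  have hE : matUnit M.basis M.vac M.vac * matUnit M.basis M.vac M.vac =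
    matUnit M.basis M.vac M.vac := matUnit_mul_matUnit ..
  -- the functions `f` with `f ⊗ |b₀⟩⟨b₀|` in the image
  let T : StarSubalgebra ℂ C(X, ℂ) :=
    { carrier := {f | funTensor f (matUnit M.basis M.vac M.vac) ∈ S}
      mul_mem' := fun {f g} hf hg => by
        have := MulMemClass.mul_mem (S := NonUnitalStarSubalgebra ℂ C(X, BOp)) hf hg
        rwa [funTensor_mul, hE] at this
      add_mem' := fun {f g} hf hg => by
        have := add_mem (S := NonUnitalStarSubalgebra ℂ C(X, BOp)) hf hg
        have e : funTensor f (matUnit M.basis M.vac M.vac) +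
            funTensor g (matUnit M.basis M.vac M.vac) =
            funTensor (f + g) (matUnit M.basis M.vac M.vac) := by
          ext1 z
          simp [add_smul]
        rwa [e] at this
      algebraMap_mem' := fun r => by
        have h1 := SMulMemClass.smul_mem r (hmem _ (self_mem_idealSpan _))
        rw [map_vacuum h hq hΨ] at h1
        have e : r • funTensor 1 (matUnit M.basis M.vac M.vac) =
            funTensor (algebraMap ℂ C(X, ℂ) r) (matUnit M.basis M.vac M.vac) := by
          ext1 z
          simp
        rwa [e] at h1
      star_mem' := fun {f} hf => by
        have h1 := star_mem (S := NonUnitalStarSubalgebra ℂ C(X, BOp)) hf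
        rwa [star_funTensor, star_matUnit] at h1 }
  have hT : IsClosed (T : Set C(X, ℂ)) := hS.preimage (continuous_funTensor_left _)
  have hζT : ζ ∈ T := by
    have h1 := hmem _ (mul_mem_idealSpan (x 0) (self_mem_idealSpan (vacuum q (x 0))))
    rw [map_mul, hΨ.map_zero_gen, map_vacuum h hq hΨ, funTensor_mul] at h1
    have e : M.op 0 * matUnit M.basis M.vac M.vac = matUnit M.basis M.vac M.vac := by
      ext1 v
      rw [mul_apply_eq_comp, matUnit_apply, map_smul, M.zero_vac]
    rwa [e, mul_one] at h1
  have hsep : T.toSubalgebra.SeparatesPoints := fun z w hzw =>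
    ⟨ζ, ⟨ζ, hζT, rfl⟩, fun h => hzw (hζ h)⟩
  have htop := ContinuousMap.starSubalgebra_topologicalClosure_eq_top_of_separatesPoints T hsep
  have hf : f ∈ T := by
    have : f ∈ T.topologicalClosure := htop ▸ StarSubalgebra.mem_top
    rwa [← SetLike.mem_coe, StarSubalgebra.topologicalClosure_coe, hT.closure_eq] at this
  obtain ⟨r, hr⟩ := exists_raise hΨ k
  obtain ⟨s, hs⟩ := exists_raise hΨ l
  have h1 := hmul r (star s) _ hf
  have e : Ψ r * funTensor f (matUnit M.basis M.vac M.vac) * Ψ (star s) =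
      funTensor f (matUnit M.basis k l) := by
    rw [map_star]
    ext1 z
    ext1 v
    simp only [ContinuousMap.mul_apply, ContinuousMap.star_apply, mul_apply_eq_comp,
      funTensor_apply, smul_apply, matUnit_apply, ContinuousLinearMap.star_eq_adjoint,
      ContinuousLinearMap.adjoint_inner_right, map_smul, hr, hs]
  rwa [e] at h1

/-- A closed `*`-subalgebra of `C(X, B(ℓ²(ℕ)))` that contains the image of the ideal and is
invariant under the image of `A` contains `C(X) ⊗ K`. -/
theorem tensorCompact_le_of_map_mem (h : SphereRel q x) (hq : 1 < |q|) (hΨ : IsFockHom M x ζ Ψ)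
    (hζ : Function.Injective ζ) {S : NonUnitalStarSubalgebra ℂ C(X, BOp)}
    (hS : IsClosed (S : Set C(X, BOp)))
    (hmem : ∀ y ∈ idealSpan (vacuum q (x 0)), Ψ y ∈ S)
    (hmul : ∀ (a b : A), ∀ F ∈ S, Ψ a * F * Ψ b ∈ S) : tensorCompact X ≤ S := by
  refine tensorCompact_le hS fun f T hT => ?_
  have h2 : ∀ R ∈ Submodule.span ℂ (Set.range fun p : M.ι × M.ι => matUnit M.basis p.1 p.2),
      funTensor f R ∈ S := by
    intro R hR
    induction hR using Submodule.span_induction with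
    | mem R hR =>
      obtain ⟨p, rfl⟩ := hR
      exact funTensor_matUnit_mem h hq hΨ hζ hS hmem hmul f _ _
    | zero =>
      have e : funTensor f 0 = 0 := by ext1 z; simp
      rw [e]
      exact zero_mem S
    | add R T _ _ hR hT =>
      have e : funTensor f (R + T) = funTensor f R + funTensor f T := by ext1 z; simp
      rw [e]
      exact add_mem (S := NonUnitalStarSubalgebra ℂ C(X, BOp)) hR hT
    | smul c R _ hR =>
      have e : funTensor f (c • R) = c • funTensor f R := by
        ext1 z
        simp [smul_comm c]
      rw [e]
      exact SMulMemClass.smul_mem c hR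
  exact closure_minimal (t := funTensor f ⁻¹' (S : Set C(X, BOp))) h2
    (hS.preimage (continuous_funTensor_right f)) (mem_closure_span_matUnit M.basis hT)

theorem idealHom_injective (h : SphereRel q x) (hq : 1 < |q|) (hΨ : IsFockHom M x ζ Ψ)
    (hspec : ∀ t ∈ spectrum ℂ (x 0), ‖t‖ = 1 → ∃ z, ζ z = t)
    (hgen : closure (StarAlgebra.adjoin ℂ (Set.range x) : Set A) = Set.univ) :
    Function.Injective (idealHom q x Ψ) := by
  intro y z hyz
  have h1 : Ψ ((y : A) - z) = 0 := by
    rw [map_sub, sub_eq_zero]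
    exact hyz
  have h2 := eq_zero_of_map_eq_zero h hq hΨ hspec hgen
    (sub_mem y.2 z.2 : (y : A) - z ∈ closedIdealStar _ (star_vacuum (x 0))) h1
  exact Subtype.ext (sub_eq_zero.1 h2)

/-- An injective `*`-homomorphism of C*-algebras is isometric and so has closed range. -/
theorem isClosed_range_idealHom (h : SphereRel q x) (hq : 1 < |q|) (hΨ : IsFockHom M x ζ Ψ)
    (hspec : ∀ t ∈ spectrum ℂ (x 0), ‖t‖ = 1 → ∃ z, ζ z = t)
    (hgen : closure (StarAlgebra.adjoin ℂ (Set.range x) : Set A) = Set.univ) :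
    IsClosed (Set.range (idealHom q x Ψ)) := by
  have hJ : IsClosed (closedIdealStar (vacuum q (x 0)) (star_vacuum (x 0)) : Set A) :=
    isClosed_closedIdealStar
  let _ : NonUnitalCStarAlgebra (closedIdealStar (vacuum q (x 0)) (star_vacuum (x 0))) :=
    NonUnitalStarSubalgebra.nonUnitalCStarAlgebra _
  exact (NonUnitalStarAlgHom.isometry (idealHom q x Ψ)
    (idealHom_injective h hq hΨ hspec hgen)).isClosedEmbedding.isClosed_range

theorem exists_idealHom_eq (h : SphereRel q x) (hq : 1 < |q|) (hΨ : IsFockHom M x ζ Ψ)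
    (hζ : Function.Injective ζ) (hspec : ∀ t ∈ spectrum ℂ (x 0), ‖t‖ = 1 → ∃ z, ζ z = t)
    (hgen : closure (StarAlgebra.adjoin ℂ (Set.range x) : Set A) = Set.univ)
    {F : C(X, BOp)} (hF : F ∈ tensorCompact X) : ∃ y, idealHom q x Ψ y = F := by
  let S : NonUnitalStarSubalgebra ℂ C(X, BOp) := NonUnitalStarAlgHom.range (idealHom q x Ψ)
  have hS : ∀ G, G ∈ S ↔ ∃ y, idealHom q x Ψ y = G := fun G => NonUnitalStarAlgHom.mem_range _
  have hcl : IsClosed (S : Set C(X, BOp)) := isClosed_range_idealHom h hq hΨ hspec hgen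
  refine (hS F).1 (tensorCompact_le_of_map_mem h hq hΨ hζ hcl (fun y hy => ?_)
    (fun a b G hG => ?_) hF)
  · exact (hS _).2 ⟨⟨y, subset_closure hy⟩, rfl⟩
  · obtain ⟨y, rfl⟩ := (hS G).1 hG
    refine (hS _).2 ⟨⟨a * y * b, closedIdealStar_mul_mem (he := star_vacuum _) b
        (mul_mem_closedIdealStar a y.2)⟩, ?_⟩
    rw [idealHom_apply, idealHom_apply, map_mul, map_mul]

/-- A Fock homomorphism whose phases are distinct and exhaust the spectrum of `x₀` on the unit
circle maps the closed ideal of the vacuum projection isomorphically onto `C(X) ⊗ K`. -/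
theorem exists_embedding (h : SphereRel q x) (hq : 1 < |q|) (hΨ : IsFockHom M x ζ Ψ)
    (hζ : Function.Injective ζ) (hspec : ∀ t ∈ spectrum ℂ (x 0), ‖t‖ = 1 → ∃ z, ζ z = t)
    (hgen : closure (StarAlgebra.adjoin ℂ (Set.range x) : Set A) = Set.univ) :
    ∃ ι : tensorCompact X →⋆ₙₐ[ℂ] A, Function.Injective ι ∧
      Set.range ι = closure (idealSpan (vacuum q (x 0)) : Set A) :=
  exists_inverse_onto (closedIdealStar (vacuum q (x 0)) (star_vacuum (x 0)))
    (tensorCompact X) (idealHom q x Ψ) (idealHom_injective h hq hΨ hspec hgen)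
    (fun y => map_mem_tensorCompact h hq hΨ hgen y.2)
    (fun _ hF => exists_idealHom_eq h hq hΨ hζ hspec hgen hF)

end IsFockHom

end

/-! ### Existence of the Fock model -/

section WeightedShift

variable {ι : Type*} (b : HilbertBasis ι ℂ Hilb)

theorem hilb_ext {v w : Hilb} (h : ∀ k, inner ℂ (b k) v = inner ℂ (b k) w) : v = w := by
  refine b.repr.injective ?_
  ext k
  rw [b.repr_apply_apply, b.repr_apply_apply, h]

theorem exists_isometry_of_orthonormal {v : ι → Hilb} (hv : Orthonormal ℂ v) :
    ∃ T : BOp, (∀ k, T (b k) = v k) ∧ ∀ u, ‖T u‖ = ‖u‖ := by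
  classical
  refine ⟨(hv.orthogonalFamily.linearIsometry.comp
    b.repr.toLinearIsometry).toContinuousLinearMap, fun k => ?_, fun u => ?_⟩
  · simp [b.repr_self, OrthogonalFamily.linearIsometry_apply_single]
  · exact LinearIsometry.norm_map _ u

/-- Weighted shifts with real weights of modulus at most one exist: the weight `w` is the mean
value of the phases `w ± i √(1 - w²)`, and for phases the shift is an isometry. -/
theorem exists_weightedShift {σ : ι → ι} (hσ : Function.Injective σ) {w : ι → ℝ}
    (hw : ∀ k, |w k| ≤ 1) : ∃ T : BOp, ∀ k, T (b k) = (w k : ℂ) • b (σ k) := by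
  have key : ∀ s : ℝ, s ^ 2 = 1 → ∃ T : BOp, ∀ k,
      T (b k) = (⟨w k, s * √(1 - w k ^ 2)⟩ : ℂ) • b (σ k) := by
    intro s hs
    have hu : ∀ k, ‖(⟨w k, s * √(1 - w k ^ 2)⟩ : ℂ)‖ = 1 := by
      intro k
      have h1 : w k ^ 2 ≤ 1 := (sq_le_one_iff_abs_le_one _).2 (hw k)
      rw [← sq_eq_sq₀ (norm_nonneg _) zero_le_one, ← Complex.normSq_eq_norm_sq,
        Complex.normSq_mk]
      have h2 := Real.mul_self_sqrt (show 0 ≤ 1 - w k ^ 2 by linarith)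
      linear_combination s ^ 2 * h2 + (1 - w k ^ 2) * hs
    obtain ⟨T, hT, -⟩ := exists_isometry_of_orthonormal b
      (v := fun k => (⟨w k, s * √(1 - w k ^ 2)⟩ : ℂ) • b (σ k))
      ⟨fun k => by rw [norm_smul, hu, b.orthonormal.1, one_mul], fun k l hkl => by
        beta_reduce
        rw [inner_smul_left, inner_smul_right, b.orthonormal.2 (hσ.ne hkl)]
        simp⟩
    exact ⟨T, hT⟩
  obtain ⟨T, hT⟩ := key 1 (by norm_num)
  obtain ⟨S, hS⟩ := key (-1) (by norm_num)
  refine ⟨(2⁻¹ : ℂ) • (T + S), fun k => ?_⟩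
  rw [smul_apply, add_apply, hT, hS, ← add_smul, smul_smul]
  congr 1
  apply Complex.ext <;> simp; ring

theorem star_weightedShift_apply {σ : ι → ι} (hσ : Function.Injective σ) {w : ι → ℝ} {T : BOp}
    (hT : ∀ k, T (b k) = (w k : ℂ) • b (σ k)) (k : ι) :
    (star T) (b (σ k)) = (w k : ℂ) • b k := by
  classical
  refine hilb_ext b fun l => ?_
  rw [ContinuousLinearMap.star_eq_adjoint, ContinuousLinearMap.adjoint_inner_right, hT,
    inner_smul_left, inner_smul_right, orthonormal_iff_ite.1 b.orthonormal,
    orthonormal_iff_ite.1 b.orthonormal]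
  by_cases h : l = k
  · simp [h]
  · simp [h, hσ.ne h]

theorem star_weightedShift_apply_of_notMem {σ : ι → ι} {w : ι → ℝ} {T : BOp}
    (hT : ∀ k, T (b k) = (w k : ℂ) • b (σ k)) {m : ι} (hm : m ∉ Set.range σ) :
    (star T) (b m) = 0 := by
  refine hilb_ext b fun l => ?_
  rw [ContinuousLinearMap.star_eq_adjoint, ContinuousLinearMap.adjoint_inner_right, hT,
    inner_smul_left, b.orthonormal.2 (fun h => hm ⟨l, h⟩)]
  simp

theorem exists_hilbertBasis_of_equiv (e : ι ≃ ℕ) : Nonempty (HilbertBasis ι ℂ Hilb) := by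
  let b₀ : HilbertBasis ℕ ℂ Hilb := HilbertBasis.ofRepr (LinearIsometryEquiv.refl ℂ Hilb)
  refine ⟨HilbertBasis.mk (v := fun k => b₀ (e k)) (b₀.orthonormal.comp _ e.injective) ?_⟩
  have : Set.range (fun k => b₀ (e k)) = Set.range b₀ := e.surjective.range_comp b₀
  rw [this, b₀.dense_span]

end WeightedShift

section Weights

variable {n : ℕ}

/-- The multi-index `k + e_j`. -/
def up (j : Fin n) (k : Fin n → ℕ) : Fin n → ℕ := Function.update k j (k j + 1)

theorem up_injective (j : Fin n) : Function.Injective (up j) := by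
  intro k l h
  funext i
  have := congrFun h i
  by_cases hi : i = j
  · subst hi
    simpa [up] using this
  · simpa [up, hi] using this

theorem up_comm {i j : Fin n} (hij : i ≠ j) (k : Fin n → ℕ) : up i (up j k) = up j (up i k) := by
  simp only [up, Function.update_of_ne hij, Function.update_of_ne hij.symm]
  exact Function.update_comm hij.symm _ _ _

theorem mem_range_up {j : Fin n} {k : Fin n → ℕ} (hk : k j ≠ 0) : ∃ k', k = up j k' := by
  refine ⟨Function.update k j (k j - 1), ?_⟩
  funext i
  by_cases hi : i = j
  · subst hi
    simp only [up, Function.update_self]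
    omega
  · simp [up, hi]

theorem notMem_range_up {j : Fin n} {k : Fin n → ℕ} (hk : k j = 0) : k ∉ Set.range (up j) := by
  rintro ⟨k', rfl⟩
  simp [up] at hk

/-- The partial sum `∑_{i ≥ m} k_i`. -/
def tailSum (k : Fin n → ℕ) (m : ℕ) : ℕ := ∑ i with m ≤ i.val, k i

theorem tailSum_up (j : Fin n) (k : Fin n → ℕ) (m : ℕ) :
    tailSum (up j k) m = tailSum k m + if m ≤ j.val then 1 else 0 := by
  simp only [tailSum, Finset.sum_filter]
  have : ∀ i : Fin n, (if m ≤ i.val then up j k i else 0) =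
      (if m ≤ i.val then k i else 0) + if i = j then (if m ≤ j.val then 1 else 0) else 0 := by
    intro i
    by_cases hi : i = j
    · subst hi
      simp only [up, Function.update_self]
      split_ifs <;> simp
    · simp [up, hi]
  rw [Finset.sum_congr rfl fun i _ => this i, Finset.sum_add_distrib, Finset.sum_ite_eq']
  simp

theorem tailSum_eq_add (k : Fin n → ℕ) (j : Fin n) :
    tailSum k j.val = k j + tailSum k (j.val + 1) := by
  have : (Finset.univ.filter fun i : Fin n => j.val ≤ i.val) =
      Finset.cons j (Finset.univ.filter fun i : Fin n => j.val + 1 ≤ i.val) (by simp) := by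
    ext i
    simp only [Finset.mem_filter, Finset.mem_univ, true_and, Finset.mem_cons, Fin.ext_iff]
    omega
  rw [tailSum, this, Finset.sum_cons, tailSum]

theorem tailSum_of_le (k : Fin n → ℕ) : tailSum k n = 0 := by
  refine Finset.sum_eq_zero fun i hi => ?_
  have := i.isLt
  simp only [Finset.mem_filter, Finset.mem_univ, true_and] at hi
  omega

theorem sum_filter_lt_telescope (g : ℕ → ℝ) (m : ℕ) (hm : m ≤ n) :
    ∑ i : Fin n with i.val < m, (g (i + 1) - g i) = g m - g 0 := by
  rw [Finset.sum_filter,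
    Fin.sum_univ_eq_sum_range (fun i => if i < m then g (i + 1) - g i else 0) n,
    ← Finset.sum_filter]
  have : (Finset.range n).filter (fun i => i < m) = Finset.range m := by
    ext i
    simp only [Finset.mem_filter, Finset.mem_range]
    omega
  rw [this, Finset.sum_range_sub]

/-- The weight of the raising operator `x_j*` of the Fock model, with `p = q⁻¹`. -/
def raiseWeight (p : ℝ) (j : Fin n) (k : Fin n → ℕ) : ℝ :=
  √(1 - (p ^ 2) ^ (k j + 1)) * p ^ tailSum k (j + 1)

variable {p : ℝ}

theorem pow_succ_lt_one_of_abs (hp : |p| < 1) (m : ℕ) : (p ^ 2) ^ (m + 1) < 1 := by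
  have h : p ^ 2 < 1 := by
    rw [← sq_abs]
    exact pow_lt_one₀ (abs_nonneg p) hp (by norm_num)
  exact pow_lt_one₀ (sq_nonneg p) h (by omega)

theorem abs_raiseWeight_le (hp : |p| < 1) (j : Fin n) (k : Fin n → ℕ) :
    |raiseWeight p j k| ≤ 1 := by
  rw [raiseWeight, abs_mul, abs_pow, abs_of_nonneg (Real.sqrt_nonneg _)]
  refine mul_le_one₀ ?_ (by positivity) (pow_le_one₀ (abs_nonneg p) hp.le)
  rw [Real.sqrt_le_one]
  have : 0 ≤ (p ^ 2) ^ (k j + 1) := by positivity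
  linarith

theorem raiseWeight_ne_zero (hp : |p| < 1) (hp0 : p ≠ 0) (j : Fin n) (k : Fin n → ℕ) :
    raiseWeight p j k ≠ 0 := by
  refine mul_ne_zero (Real.sqrt_ne_zero'.2 ?_) (pow_ne_zero _ hp0)
  linarith [pow_succ_lt_one_of_abs hp (k j)]

theorem raiseWeight_sq (hp : |p| < 1) (j : Fin n) (k : Fin n → ℕ) :
    raiseWeight p j k ^ 2 =
      (p ^ 2) ^ tailSum k (j + 1) - (p ^ 2) ^ (tailSum k j + 1) := by
  rw [raiseWeight, mul_pow, Real.sq_sqrt (by linarith [pow_succ_lt_one_of_abs hp (k j)]),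
    tailSum_eq_add]
  ring

theorem raiseWeight_up_of_lt {i j : Fin n} (hij : i < j) (k : Fin n → ℕ) :
    raiseWeight p i (up j k) = p * raiseWeight p i k := by
  have h1 : up j k i = k i := by simp [up, hij.ne]
  have h2 : i.val + 1 ≤ j.val := hij
  rw [raiseWeight, raiseWeight, h1, tailSum_up, if_pos h2, pow_succ]
  ring

theorem raiseWeight_up_of_gt {i j : Fin n} (hij : j < i) (k : Fin n → ℕ) :
    raiseWeight p i (up j k) = raiseWeight p i k := by
  have h1 : up j k i = k i := by simp [up, hij.ne']
  have h2 : ¬ i.val + 1 ≤ j.val := by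
    have : j.val < i.val := hij
    omega
  rw [raiseWeight, raiseWeight, h1, tailSum_up, if_neg h2, add_zero]

end Weights

section Model

variable {n : ℕ} {q : ℝ} {b : HilbertBasis (Fin n → ℕ) ℂ Hilb} {D : BOp} {R : Fin n → BOp}

/-- The diagonal operator `D` and the raising operators `R_j` of the Fock model. -/
structure IsRaising (q : ℝ) (b : HilbertBasis (Fin n → ℕ) ℂ Hilb) (D : BOp)
    (R : Fin n → BOp) : Prop where
  diag : ∀ k, D (b k) = ((q⁻¹ ^ tailSum k 0 : ℝ) : ℂ) • b k
  raise : ∀ j k, R j (b k) = (raiseWeight q⁻¹ j k : ℂ) • b (up j k)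

namespace IsRaising

theorem star_diag (h : IsRaising q b D R) : star D = D := by
  refine clm_ext_basis b fun k => ?_
  have := star_weightedShift_apply b (σ := id) Function.injective_id h.diag k
  rw [h.diag]
  exact this

theorem star_raise (h : IsRaising q b D R) (j : Fin n) (k : Fin n → ℕ) :
    (star (R j)) (b (up j k)) = (raiseWeight q⁻¹ j k : ℂ) • b k :=
  star_weightedShift_apply b (up_injective j) (h.raise j) k

theorem star_raise_eq_zero (h : IsRaising q b D R) {j : Fin n} {k : Fin n → ℕ} (hk : k j = 0) :
    (star (R j)) (b k) = 0 :=
  star_weightedShift_apply_of_notMem b (h.raise j) (notMem_range_up hk)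

theorem raise_mul_star (h : IsRaising q b D R) (hq : 1 < |q|) (j : Fin n) (k : Fin n → ℕ) :
    (R j * star (R j)) (b k) = (((q⁻¹ ^ 2) ^ tailSum k (j + 1) -
      (q⁻¹ ^ 2) ^ tailSum k j : ℝ) : ℂ) • b k := by
  have hp : |q⁻¹| < 1 := by rw [abs_inv]; exact inv_lt_one_of_one_lt₀ hq
  rw [mul_apply_eq_comp]
  by_cases hk : k j = 0
  · rw [h.star_raise_eq_zero hk, tailSum_eq_add, hk, zero_add, sub_self]
    simp
  · obtain ⟨k, rfl⟩ := mem_range_up hk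
    rw [h.star_raise, map_smul, h.raise, smul_smul, tailSum_up, tailSum_up, if_pos le_rfl,
      if_neg (by omega), add_zero, ← raiseWeight_sq hp, sq]
    push_cast
    rfl

theorem star_mul_raise (h : IsRaising q b D R) (hq : 1 < |q|) (j : Fin n) (k : Fin n → ℕ) :
    (star (R j) * R j) (b k) = (((q⁻¹ ^ 2) ^ tailSum k (j + 1) -
      (q⁻¹ ^ 2) ^ (tailSum k j + 1) : ℝ) : ℂ) • b k := by
  have hp : |q⁻¹| < 1 := by rw [abs_inv]; exact inv_lt_one_of_one_lt₀ hq
  rw [mul_apply_eq_comp, h.raise, map_smul, h.star_raise, smul_smul, ← raiseWeight_sq hp, sq]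
  push_cast
  rfl

theorem diag_mul_diag (h : IsRaising q b D R) (k : Fin n → ℕ) :
    (star D * D) (b k) = (((q⁻¹ ^ 2) ^ tailSum k 0 : ℝ) : ℂ) • b k := by
  rw [h.star_diag, mul_apply_eq_comp, h.diag, map_smul, h.diag, smul_smul, ← pow_mul,
    mul_comm 2, pow_mul, sq]
  push_cast
  rfl

theorem raise_mul_diag (h : IsRaising q b D R) (hq : q ≠ 0) (j : Fin n) :
    R j * D = (q : ℂ) • (D * R j) := by
  have hqc : (q : ℂ) ≠ 0 := by exact_mod_cast hq
  refine clm_ext_basis b fun k => ?_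
  rw [smul_apply, mul_apply_eq_comp, mul_apply_eq_comp, h.diag, map_smul, h.raise, map_smul,
    h.diag, tailSum_up, if_pos (Nat.zero_le _), smul_smul, smul_smul, smul_smul]
  congr 1
  push_cast
  rw [pow_succ]
  field_simp

theorem raise_mul_raise (h : IsRaising q b D R) (hq : q ≠ 0) {i j : Fin n} (hij : i < j) :
    R j * R i = (q : ℂ) • (R i * R j) := by
  have hqc : (q : ℂ) ≠ 0 := by exact_mod_cast hq
  refine clm_ext_basis b fun k => ?_
  rw [smul_apply, mul_apply_eq_comp, mul_apply_eq_comp, h.raise, map_smul, h.raise, h.raise,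
    map_smul, h.raise, raiseWeight_up_of_lt hij, raiseWeight_up_of_gt hij, up_comm hij.ne,
    smul_smul, smul_smul, smul_smul]
  congr 1
  push_cast
  field_simp

theorem raise_mul_lower (h : IsRaising q b D R) (hq : q ≠ 0) {i j : Fin n} (hij : i ≠ j) :
    R i * star (R j) = (q : ℂ) • (star (R j) * R i) := by
  have hqc : (q : ℂ) ≠ 0 := by exact_mod_cast hq
  refine clm_ext_basis b fun k => ?_
  rw [smul_apply, mul_apply_eq_comp, mul_apply_eq_comp]
  by_cases hk : k j = 0
  · have hk' : up i k j = 0 := by simpa [up, hij.symm] using hk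
    rw [h.star_raise_eq_zero hk, h.raise, map_smul, h.star_raise_eq_zero hk']
    simp
  · obtain ⟨k, rfl⟩ := mem_range_up hk
    rw [h.star_raise, map_smul, h.raise, h.raise, map_smul, up_comm hij, h.star_raise,
      smul_smul, smul_smul, smul_smul]
    congr 1
    rcases lt_or_gt_of_ne hij with hlt | hgt
    · rw [raiseWeight_up_of_lt hlt, raiseWeight_up_of_gt hlt]
      push_cast
      field_simp
    · rw [raiseWeight_up_of_gt hgt, raiseWeight_up_of_lt hgt]
      push_cast
      field_simp

/-- The generators of the Fock model: `x₀ = D` and the lowering operators `x_j = R_j*`. -/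
def gen (D : BOp) (R : Fin n → BOp) : Fin (n + 1) → BOp := Fin.cons D fun j => star (R j)

@[simp]
theorem gen_zero : gen D R 0 = D := rfl

@[simp]
theorem gen_succ (j : Fin n) : gen D R j.succ = star (R j) := by simp [gen]

/-- The partial radius `s_m` is diagonal, with eigenvalues `q^{-2 ∑_{i ≥ m} k_i}`. -/
theorem radius_apply (h : IsRaising q b D R) (hq : 1 < |q|) (m : ℕ) (hm : m ≤ n)
    (k : Fin n → ℕ) :
    (star D * D + ∑ j : Fin n with j.val < m, R j * star (R j)) (b k) =
      (((q⁻¹ ^ 2) ^ tailSum k m : ℝ) : ℂ) • b k := by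
  rw [add_apply, sum_apply, h.diag_mul_diag,
    Finset.sum_congr rfl fun j _ => h.raise_mul_star hq j k, ← Finset.sum_smul,
    ← Complex.ofReal_sum, sum_filter_lt_telescope (fun m => (q⁻¹ ^ 2) ^ tailSum k m) m hm, ← add_smul]
  congr 1
  push_cast
  ring

theorem rel (h : IsRaising q b D R) (hq : 1 < |q|) : SphereRel q (gen D R) := by
  have hq0 : q ≠ 0 := by
    rintro rfl
    simp at hq
    linarith
  refine ⟨?_, fun i j hij => ?_, fun i j hij => ?_, fun i hi => ?_, ?_⟩
  · rw [gen_zero, h.star_diag]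
  · induction j using Fin.cases with
    | zero => simp at hij
    | succ j =>
      induction i using Fin.cases with
      | zero =>
        have := congrArg star (h.raise_mul_diag hq0 j)
        simpa [h.star_diag] using this
      | succ i =>
        have := congrArg star (h.raise_mul_raise hq0 (i := i) (j := j) (by simpa using hij))
        simpa using this
  · induction i using Fin.cases with
    | zero =>
      induction j using Fin.cases with
      | zero => simp at hij
      | succ j =>
        have := congrArg star (h.raise_mul_diag hq0 j)
        simpa [h.star_diag] using this
    | succ i =>
      induction j using Fin.cases with
      | zero => simpa using h.raise_mul_diag hq0 i
      | succ j => simpa using h.raise_mul_lower hq0 (i := i) (j := j) (by simpa using hij)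
  · obtain ⟨j, rfl⟩ := Fin.exists_succ_eq.2 hi
    rw [sum_Iio_fin_succ]
    simp only [gen_zero, gen_succ, star_star]
    have hIio : Finset.Iio j = Finset.univ.filter fun i : Fin n => i.val < j.val := by
      ext i
      simp
    rw [hIio]
    refine clm_ext_basis b fun k => ?_
    rw [smul_apply, h.radius_apply hq j.val j.isLt.le, sub_apply, h.star_mul_raise hq,
      h.raise_mul_star hq, ← sub_smul, smul_smul]
    congr 1
    push_cast
    rw [pow_succ]
    ring
  · rw [Fin.sum_univ_succ]
    simp only [gen_zero, gen_succ, star_star]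
    have huniv : (Finset.univ : Finset (Fin n)) = Finset.univ.filter fun i : Fin n => i.val < n := by
      ext i
      simp
    rw [huniv]
    refine clm_ext_basis b fun k => ?_
    rw [h.radius_apply hq n le_rfl, tailSum_of_le]
    simp

/-- Every basis vector is reached from the vacuum vector by raising operators. -/
theorem exists_raise (h : IsRaising q b D R) (hq : 1 < |q|) (m : ℕ) :
    ∀ k : Fin n → ℕ, tailSum k 0 = m → ∃ (w : List (Fin n)) (c : ℂ), c ≠ 0 ∧
      ((w.map fun j => star (gen D R j.succ)).prod : BOp) (b 0) = c • b k := by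
  have hp : |q⁻¹| < 1 := by rw [abs_inv]; exact inv_lt_one_of_one_lt₀ hq
  have hp0 : q⁻¹ ≠ 0 := by
    refine inv_ne_zero ?_
    rintro rfl
    simp at hq
    linarith
  induction m with
  | zero =>
    intro k hk
    refine ⟨[], 1, one_ne_zero, ?_⟩
    have : k = 0 := by
      funext i
      simp only [tailSum, Finset.sum_eq_zero_iff] at hk
      exact hk i (by simp)
    simp [this]
  | succ m ih =>
    intro k hk
    obtain ⟨j, hj⟩ : ∃ j, k j ≠ 0 := by
      by_contra! h0
      have : tailSum k 0 = 0 := Finset.sum_eq_zero fun i _ => h0 i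
      omega
    obtain ⟨k, rfl⟩ := mem_range_up hj
    rw [tailSum_up, if_pos (Nat.zero_le _)] at hk
    obtain ⟨w, c, hc, hw⟩ := ih k (by omega)
    refine ⟨j :: w, c * raiseWeight q⁻¹ j k, mul_ne_zero hc ?_, ?_⟩
    · exact_mod_cast raiseWeight_ne_zero hp hp0 j k
    · rw [List.map_cons, List.prod_cons, mul_apply_eq_comp, hw, gen_succ, star_star, map_smul,
        h.raise, smul_smul]

end IsRaising

/-- The Fock model on `ℓ²(ℕⁿ)`. It is infinite-dimensional because `n ≥ 1`, so it can be realized on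
`ℓ²(ℕ)`. -/
theorem exists_fockModel (hq : 1 < |q|) (hn : 1 ≤ n) : Nonempty (FockModel q n) := by
  have hp : |q⁻¹| < 1 := by rw [abs_inv]; exact inv_lt_one_of_one_lt₀ hq
  have : Nonempty (Fin n) := ⟨⟨0, hn⟩⟩
  have : Infinite (Fin n → ℕ) := inferInstance
  obtain ⟨e⟩ : Nonempty ((Fin n → ℕ) ≃ ℕ) := nonempty_equiv_of_countable
  obtain ⟨b⟩ := exists_hilbertBasis_of_equiv e
  obtain ⟨D, hD⟩ := exists_weightedShift b (σ := id) Function.injective_id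
    (w := fun k => q⁻¹ ^ tailSum k 0) fun k => by
      rw [abs_pow]
      exact pow_le_one₀ (abs_nonneg _) hp.le
  choose R hR using fun j => exists_weightedShift b (up_injective j) (abs_raiseWeight_le hp j)
  have h : IsRaising q b D R := ⟨hD, hR⟩
  exact ⟨{
    ι := Fin n → ℕ
    basis := b
    vac := 0
    op := IsRaising.gen D R
    rel := h.rel hq
    star_zero := h.star_diag
    zero_vac := by
      rw [IsRaising.gen_zero, h.diag]
      simp [tailSum]
    zero_apply := fun k hk => by
      refine ⟨q⁻¹ ^ tailSum k 0, ?_, h.diag k⟩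
      have : tailSum k 0 ≠ 0 := by
        intro h0
        refine hk (funext fun i => ?_)
        simp only [tailSum, Finset.sum_eq_zero_iff] at h0
        exact h0 i (by simp)
      rw [abs_pow, ← abs_inv]
      exact pow_le_of_le_one (abs_nonneg _) hp.le this
    raise := fun k => h.exists_raise hq _ k rfl }⟩

end Model

/-! ### The powers of `1 - x₀* x₀` -/

section

variable {A : Type*} [CStarAlgebra A] {n : ℕ} {q : ℝ} {x : Fin (n + 1) → A}

theorem SphereRel.norm_le_one_of_mem_spectrum (h : SphereRel q x) {t : ℂ}
    (ht : t ∈ spectrum ℂ (x 0)) : ‖t‖ ≤ 1 := by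
  let P := CStarAlgebra.spectralOrder A
  have hP := CStarAlgebra.spectralOrderedRing A
  have := h.isStarNormal
  have h1 : star (x 0) * x 0 ≤ 1 := by
    rw [← sub_nonneg, ← h.sum_succ]
    exact Finset.sum_nonneg fun j _ => star_mul_self_nonneg _
  have h2 : ‖star (x 0) * x 0‖ ≤ 1 :=
    (CStarAlgebra.norm_le_one_iff_of_nonneg _ (star_mul_self_nonneg _)).2 h1
  rw [CStarRing.norm_star_mul_self, ← sq, sq_le_one_iff₀ (norm_nonneg _)] at h2
  have : Nontrivial A := by
    by_contra hA
    rw [not_nontrivial_iff_subsingleton] at hA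
    simp [spectrum.of_subsingleton] at ht
  exact (spectrum.norm_le_norm_of_mem ht).trans h2

/-- The element `(1 - x₀* x₀)ᴺ`. In representations of the sphere relations these elements converge
strongly to the projection onto the kernel of `x₀`. -/
def residue (x₀ : A) (N : ℕ) : A := (1 - star x₀ * x₀) ^ N

theorem SphereRel.cfc_residue (h : SphereRel q x) (N : ℕ) :
    cfc (fun t : ℂ => (1 - star t * t) ^ N) (x 0) = residue (x 0) N := by
  have := h.isStarNormal
  rw [cfc_pow _ _ _, h.cfc_norm_sq, residue]

theorem one_sub_star_mul_self_eq (t : ℂ) : 1 - star t * t = ((1 - ‖t‖ ^ 2 : ℝ) : ℂ) := by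
  rw [Complex.star_def, ← Complex.normSq_eq_conj_mul_self, Complex.normSq_eq_norm_sq]
  push_cast
  rfl

theorem SphereRel.norm_residue_le (h : SphereRel q x) (N : ℕ) : ‖residue (x 0) N‖ ≤ 1 := by
  rw [← h.cfc_residue]
  refine norm_cfc_le zero_le_one fun t ht => ?_
  have h1 := h.norm_le_one_of_mem_spectrum ht
  rw [one_sub_star_mul_self_eq, norm_pow, Complex.norm_real, Real.norm_eq_abs]
  refine pow_le_one₀ (abs_nonneg _) ?_
  rw [abs_le]
  constructor <;> nlinarith [norm_nonneg t]

/-- Bernoulli's inequality gives `N s (1 - s)ᴺ ≤ 1`. -/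
theorem mul_one_sub_pow_le {s : ℝ} (h0 : 0 ≤ s) (h1 : s ≤ 1) (N : ℕ) :
    N * s * (1 - s) ^ N ≤ 1 := by
  have h2 : 1 + N * s ≤ (1 + s) ^ N := one_add_mul_le_pow (by linarith) N
  have h3 : 0 ≤ (1 - s) ^ N := pow_nonneg (by linarith) N
  calc N * s * (1 - s) ^ N ≤ (1 + s) ^ N * (1 - s) ^ N := by
        refine mul_le_mul_of_nonneg_right ?_ h3
        linarith
    _ = (1 - s ^ 2) ^ N := by
        rw [← mul_pow]
        ring
    _ ≤ 1 := pow_le_one₀ (by nlinarith) (by nlinarith)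

theorem SphereRel.norm_mul_residue_le (h : SphereRel q x) (N : ℕ) :
    ‖x 0 * residue (x 0) (N + 1)‖ ^ 2 ≤ 1 / ((N : ℝ) + 1) := by
  have := h.isStarNormal
  have h1 : ‖x 0 * residue (x 0) (N + 1)‖ ≤ √(1 / ((N : ℝ) + 1)) := by
    have e : cfc (fun t : ℂ => t * (1 - star t * t) ^ (N + 1)) (x 0) =
        x 0 * residue (x 0) (N + 1) := by
      rw [_root_.cfc_mul _ _ _, h.cfc_residue, cfc_id' ℂ (x 0)]
    rw [← e]
    refine norm_cfc_le (Real.sqrt_nonneg _) fun t ht => Real.le_sqrt_of_sq_le ?_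
    have h1 := h.norm_le_one_of_mem_spectrum ht
    have h2 : ‖t‖ ^ 2 ≤ 1 := by nlinarith [norm_nonneg t]
    have h3 := mul_one_sub_pow_le (sq_nonneg ‖t‖) h2 (N + 1)
    have h4 : (1 - ‖t‖ ^ 2) ^ (N + 1) ≤ 1 := pow_le_one₀ (by linarith) (by nlinarith)
    have h5 : 0 ≤ (1 - ‖t‖ ^ 2) ^ (N + 1) := pow_nonneg (by linarith) _
    rw [one_sub_star_mul_self_eq, norm_mul, norm_pow, Complex.norm_real, Real.norm_eq_abs,
      abs_of_nonneg (by linarith), le_div_iff₀ (by positivity), mul_pow]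
    push_cast at h3
    have h6 : ((1 - ‖t‖ ^ 2) ^ (N + 1)) ^ 2 ≤ (1 - ‖t‖ ^ 2) ^ (N + 1) := by nlinarith
    have h7 : 0 ≤ ((N : ℝ) + 1) * ‖t‖ ^ 2 := by positivity
    nlinarith [mul_le_mul_of_nonneg_left h6 h7]
  calc _ ≤ √(1 / ((N : ℝ) + 1)) ^ 2 := by gcongr
    _ = _ := Real.sq_sqrt (by positivity)

end

/-! ### Separable Hilbert spaces embed into `ℓ²(ℕ)` -/

theorem separableSpace_of_closure_adjoin {A : Type*} [CStarAlgebra A] {n : ℕ} {x : Fin n → A}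
    (hgen : closure (StarAlgebra.adjoin ℂ (Set.range x) : Set A) = Set.univ) :
    TopologicalSpace.SeparableSpace A := by
  rw [← TopologicalSpace.isSeparable_univ_iff, ← hgen]
  refine TopologicalSpace.IsSeparable.closure ?_
  have h1 : (StarAlgebra.adjoin ℂ (Set.range x) : Set A) =
      (Submodule.span ℂ (Submonoid.closure (Set.range x ∪ star (Set.range x)) : Set A) : Set A) := by
    rw [← Algebra.adjoin_eq_span, Subalgebra.coe_toSubmodule, ← StarAlgebra.adjoin_toSubalgebra]
    rfl
  rw [h1]
  refine TopologicalSpace.IsSeparable.span (Set.Countable.isSeparable ?_)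
  have hc : (Set.range x ∪ star (Set.range x)).Countable := by
    refine (Set.countable_range x).union ?_
    rw [← Set.image_star]
    exact (Set.countable_range x).image _
  have : Countable ↥(Set.range x ∪ star (Set.range x)) := hc.to_subtype
  rw [Submonoid.closure_eq_mrange, MonoidHom.coe_mrange]
  have : Countable (FreeMonoid ↥(Set.range x ∪ star (Set.range x))) :=
    inferInstanceAs (Countable (List _))
  exact Set.countable_range _

theorem exists_linearIsometry_hilb (H : Type*) [NormedAddCommGroup H] [InnerProductSpace ℂ H]
    [CompleteSpace H] [TopologicalSpace.SeparableSpace H] : Nonempty (H →ₗᵢ[ℂ] Hilb) := by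
  classical
  obtain ⟨w, b, hb⟩ := exists_hilbertBasis ℂ H
  have hd : Pairwise fun i j : w => 1 ≤ dist (b i) (b j) := fun i j hij => by
    have h2 : ‖b i - b j‖ ^ 2 = 2 := by
      rw [@norm_sub_sq ℂ, b.orthonormal.1, b.orthonormal.1, b.orthonormal.2 hij]
      norm_num
    change 1 ≤ dist (b i) (b j)
    rw [dist_eq_norm]
    nlinarith [norm_nonneg (b i - b j)]
  -- balls of radius `1/2` around the basis vectors are disjoint, so the basis is countable
  have hcount : Countable w := by
    refine Pairwise.countable_of_isOpen_disjoint (s := fun i : w => Metric.ball (b i) (1 / 2))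
      (fun i j hij => ?_) (fun i => Metric.isOpen_ball) (fun i => ⟨b i, by simp⟩)
    refine Metric.ball_disjoint_ball ?_
    have := hd hij
    norm_num
    exact this
  obtain ⟨e, he⟩ := hcount.exists_injective_nat
  have hv : Orthonormal ℂ fun k : w => (lp.single 2 (e k) 1 : Hilb) := by
    refine ⟨fun k => by simp [lp.norm_single], fun i j hij => ?_⟩
    have := he.ne hij
    simp [lp.inner_single_left, lp.single_apply, this]
  exact ⟨hv.orthogonalFamily.linearIsometry.comp b.repr.toLinearIsometry⟩

/-! ### A state that vanishes on the first generator -/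

section

open scoped ComplexOrder InnerProductSpace
open Filter Topology

variable {A : Type*} [CStarAlgebra A] {n : ℕ} {q : ℝ} {x : Fin (n + 1) → A}

/-- The vector functional `b ↦ ⟪u, ρ(b) u⟫`. -/
def vectorFunctional (ρ : A →⋆ₐ[ℂ] BOp) (u : Hilb) : A →L[ℂ] ℂ :=
  (innerSL ℂ u).comp ((ContinuousLinearMap.apply ℂ Hilb u).comp
    (⟨ρ.toLinearMap, map_continuous ρ⟩ : A →L[ℂ] BOp))

theorem vectorFunctional_apply (ρ : A →⋆ₐ[ℂ] BOp) (u : Hilb) (b : A) :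
    vectorFunctional ρ u b = ⟪u, ρ b u⟫_ℂ := rfl

theorem vectorFunctional_star_mul_self (ρ : A →⋆ₐ[ℂ] BOp) (u : Hilb) (b : A) :
    vectorFunctional ρ u (star b * b) = ((‖ρ b u‖ ^ 2 : ℝ) : ℂ) := by
  rw [vectorFunctional_apply, map_mul, map_star, mul_apply_eq_comp,
    ContinuousLinearMap.star_eq_adjoint, ContinuousLinearMap.adjoint_inner_right,
    inner_self_eq_norm_sq_to_K]
  push_cast
  rfl

theorem norm_vectorFunctional_le (ρ : A →⋆ₐ[ℂ] BOp) {u : Hilb} (hu : ‖u‖ ≤ 1) :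
    ‖vectorFunctional ρ u‖ ≤ 1 := by
  refine ContinuousLinearMap.opNorm_le_bound _ zero_le_one fun b => ?_
  rw [vectorFunctional_apply, one_mul]
  calc ‖⟪u, ρ b u⟫_ℂ‖ ≤ ‖u‖ * (‖ρ b‖ * ‖u‖) :=
        (norm_inner_le_norm _ _).trans (by gcongr; exact (ρ b).le_opNorm u)
    _ ≤ 1 * (‖b‖ * 1) := by
        gcongr
        exact NonUnitalStarAlgHom.norm_apply_le ρ b
    _ = ‖b‖ := by ring

/-- If the norms `‖a (1 - x₀* x₀)ᴺ‖` stay above `c`, then vectors at which these operators are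
large produce, in the weak-* limit, a positive functional that vanishes on `x₀* x₀` and is at least
`c²` on `a* a`. -/
theorem SphereRel.exists_functional (h : SphereRel q x)
    (hfaith : ∀ (a : A) (c : ℝ), 0 ≤ c → c < ‖a‖ → ∃ ρ : A →⋆ₐ[ℂ] BOp, c < ‖ρ a‖)
    {a : A} {c : ℝ} (hc0 : 0 ≤ c) (hc : ∀ N, c < ‖a * residue (x 0) N‖) :
    ∃ φ : A →L[ℂ] ℂ, (∀ b, 0 ≤ φ (star b * b)) ∧ ‖φ 1‖ ≤ 1 ∧ φ (star (x 0) * x 0) = 0 ∧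
      c ^ 2 ≤ (φ (star a * a)).re := by
  have h1 : ∀ N, ∃ (ρ : A →⋆ₐ[ℂ] BOp) (v : Hilb),
      ‖v‖ ≤ 1 ∧ c < ‖ρ (a * residue (x 0) (N + 1)) v‖ := fun N => by
      obtain ⟨ρ, hρ⟩ := hfaith _ c hc0 (hc (N + 1))
      obtain ⟨v, hv1, hv⟩ := ContinuousLinearMap.exists_lt_apply_of_lt_opNorm _ hρ
      exact ⟨ρ, v, hv1.le, hv⟩
  choose ρ v hv hcv using h1
  let u : ℕ → Hilb := fun N => ρ N (residue (x 0) (N + 1)) (v N)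
  have hle : ∀ N (b : A), ‖ρ N b (v N)‖ ≤ ‖b‖ := fun N b =>
    calc ‖ρ N b (v N)‖ ≤ ‖ρ N b‖ * ‖v N‖ := (ρ N b).le_opNorm _
      _ ≤ ‖b‖ * 1 := by
        gcongr
        · exact NonUnitalStarAlgHom.norm_apply_le (ρ N) b
        · exact hv N
      _ = ‖b‖ := mul_one _
  have hu : ∀ N, ‖u N‖ ≤ 1 := fun N => (hle N _).trans (h.norm_residue_le _)
  let f : ℕ → WeakDual ℂ A := fun N => StrongDual.toWeakDual (vectorFunctional (ρ N) (u N))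
  have hcomp := WeakDual.isCompact_closedBall (𝕜 := ℂ) (E := A) 0 1
  -- a limit point of the vector functionals, by the Banach–Alaoglu theorem
  obtain ⟨φ, -, hφ⟩ := hcomp.ultrafilter_le_nhds ((hyperfilter ℕ).map f) (by
    rw [le_principal_iff, Ultrafilter.coe_map, mem_map]
    refine univ_mem' fun N => ?_
    simpa [f] using norm_vectorFunctional_le (ρ N) (hu N))
  have hlim : ∀ b : A, Tendsto (fun N => vectorFunctional (ρ N) (u N) b) (hyperfilter ℕ)
      (𝓝 (φ b)) := fun b =>
    ((WeakDual.eval_continuous b).tendsto φ).comp (show Tendsto f (hyperfilter ℕ) (𝓝 φ) from hφ)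
  have happ : ∀ N b, ρ N b (u N) = ρ N (b * residue (x 0) (N + 1)) (v N) := fun N b => by
    rw [map_mul]
    rfl
  have hsq : ∀ b : A, Tendsto (fun N => ((‖ρ N b (u N)‖ ^ 2 : ℝ) : ℂ)) (hyperfilter ℕ)
      (𝓝 (φ (star b * b))) := fun b => by
    simpa only [vectorFunctional_star_mul_self] using hlim (star b * b)
  refine ⟨WeakDual.toStrongDual φ, fun b => ?_, ?_, ?_, ?_⟩
  · exact ge_of_tendsto (hsq b) (Eventually.of_forall fun N => by positivity)
  · refine le_of_tendsto (hlim 1).norm (Eventually.of_forall fun N => ?_)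
    rw [vectorFunctional_apply, map_one, one_apply_eq_self, inner_self_eq_norm_sq_to_K]
    simpa using hu N
  · refine tendsto_nhds_unique (hsq (x 0)) ?_
    have h0 : Tendsto (fun N => ‖ρ N (x 0) (u N)‖ ^ 2) (hyperfilter ℕ) (𝓝 0) := by
      refine squeeze_zero (fun N => by positivity) (fun N => ?_)
        (tendsto_one_div_add_atTop_nhds_zero_nat.mono_left Nat.hyperfilter_le_atTop)
      refine le_trans ?_ (h.norm_mul_residue_le N)
      rw [happ]
      gcongr
      exact hle N _
    simpa [Function.comp_def] using (Complex.continuous_ofReal.tendsto 0).comp h0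
  · refine ge_of_tendsto ((Complex.continuous_re.tendsto _).comp (hsq a))
      (Eventually.of_forall fun N => ?_)
    simp only [Function.comp_apply, Complex.ofReal_re]
    gcongr
    rw [happ]
    exact (hcv N).le

/-- The kernel of `x₀` is invariant, because `x₀` commutes with all generators and their adjoints
up to scalars. -/
theorem SphereRel.apply_eq_zero_of_apply_eq_zero (h : SphereRel q x) (hq : q ≠ 0)
    (hgen : closure (StarAlgebra.adjoin ℂ (Set.range x) : Set A) = Set.univ)
    {H : Type*} [NormedAddCommGroup H] [InnerProductSpace ℂ H] [CompleteSpace H]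
    (σ : A →⋆ₐ[ℂ] (H →L[ℂ] H)) (b : A) : ∀ v, σ (x 0) v = 0 → σ (x 0) (σ b v) = 0 := by
  have hqc : (q : ℂ) ≠ 0 := by exact_mod_cast hq
  have hmul : ∀ (b : A) (c : ℂ), x 0 * b = c • (b * x 0) → ∀ v, σ (x 0) v = 0 →
      σ (x 0) (σ b v) = 0 := fun b c hb v hv => by
    rw [← mul_apply_eq_comp, ← map_mul, hb, map_smul, map_mul]
    simp [hv]
  refine closure_eq_univ_induction hgen
    (p := fun b => ∀ v, σ (x 0) v = 0 → σ (x 0) (σ b v) = 0) (fun j => ?_) (fun j => ?_)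
    (fun r v hv => ?_) (fun a b ha hb v hv => ?_) (fun a b ha hb v hv => ?_) ?_ b
  · by_cases hj : j = 0
    · subst hj
      exact hmul _ 1 (by simp)
    · exact hmul _ q (h.zero_mul hj)
  · by_cases hj : j = 0
    · subst hj
      exact hmul _ 1 (by rw [one_smul, h.normal])
    · refine hmul _ (q : ℂ)⁻¹ ?_
      rw [h.star_comm j 0 hj, smul_smul, inv_mul_cancel₀ hqc, one_smul]
  · rw [Algebra.algebraMap_eq_smul_one, map_smul, map_one]
    simp [hv]
  · rw [map_add, add_apply, map_add, ha v hv, hb v hv, add_zero]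
  · rw [map_mul, mul_apply_eq_comp]
    exact ha _ (hb v hv)
  · simp only [Set.ofPred_forall]
    have hσ : Continuous σ := map_continuous σ
    refine isClosed_iInter fun v => isClosed_iInter fun hv => isClosed_eq (by fun_prop) (by fun_prop)

/-- The GNS representation of the limit functional. It annihilates `x₀`, because the kernel of `x₀` is
invariant and contains the cyclic vector. The norm condition `hfaith` says that the
representations on `ℓ²(ℕ)` determine the norm of `A`. -/
theorem SphereRel.exists_representation {A : Type} [CStarAlgebra A] {x : Fin (n + 1) → A}
    (h : SphereRel q x) (hq : q ≠ 0)
    (hgen : closure (StarAlgebra.adjoin ℂ (Set.range x) : Set A) = Set.univ)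
    (hfaith : ∀ (a : A) (c : ℝ), 0 ≤ c → c < ‖a‖ → ∃ ρ : A →⋆ₐ[ℂ] BOp, c < ‖ρ a‖)
    {a : A} {c : ℝ} (hc0 : 0 ≤ c) (hc : ∀ N, c < ‖a * residue (x 0) N‖) :
    ∃ (H : Type) (_ : NormedAddCommGroup H) (_ : InnerProductSpace ℂ H) (_ : CompleteSpace H)
      (_ : TopologicalSpace.SeparableSpace H) (σ : A →⋆ₐ[ℂ] (H →L[ℂ] H)),
      σ (x 0) = 0 ∧ c ≤ ‖σ a‖ := by
  let P := CStarAlgebra.spectralOrder A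
  have hP := CStarAlgebra.spectralOrderedRing A
  obtain ⟨φ, hpos, hφ1, hφ0, hφa⟩ := h.exists_functional hfaith hc0 hc
  let f : A →ₚ[ℂ] ℂ := PositiveLinearMap.mk₀ φ.toLinearMap fun b hb => by
    obtain ⟨d, rfl⟩ := CStarAlgebra.nonneg_iff_eq_star_mul_self.1 hb
    exact hpos d
  have hf : ∀ b, f b = φ b := fun b => rfl
  let σ := f.gnsStarAlgHom
  let ξ : f.GNS := ((f.toPreGNS 1 : f.PreGNS) : f.GNS)
  have hσ : ∀ b, σ b ξ = ((f.toPreGNS b : f.PreGNS) : f.GNS) := fun b => by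
    change f.gnsNonUnitalStarAlgHom b ((f.toPreGNS 1 : f.PreGNS) : f.GNS) = _
    rw [f.gnsNonUnitalStarAlgHom_apply_coe]
    simp
  have hnorm : ∀ b, ((‖σ b ξ‖ ^ 2 : ℝ) : ℂ) = φ (star b * b) := fun b => by
    rw [hσ, UniformSpace.Completion.norm_coe, Complex.ofReal_pow, f.preGNS_norm_sq]
    rfl
  have hdense : DenseRange fun b => σ b ξ := by
    have e : (fun b => σ b ξ) = ((↑) : f.PreGNS → f.GNS) ∘ f.toPreGNS := funext hσ
    rw [e]
    exact UniformSpace.Completion.denseRange_coe.comp f.toPreGNS.surjective.denseRange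
      (UniformSpace.Completion.continuous_coe _)
  have hcont : Continuous fun b => σ b ξ := by
    have hσ : Continuous σ := map_continuous σ
    fun_prop
  have hsepA := separableSpace_of_closure_adjoin hgen
  have hsep : TopologicalSpace.SeparableSpace f.GNS := hdense.separableSpace hcont
  refine ⟨f.GNS, inferInstance, inferInstance, inferInstance, hsep, σ, ?_, ?_⟩
  · have h0 : σ (x 0) ξ = 0 := by
      have := hnorm (x 0)
      rw [hφ0] at this
      simpa using this
    ext v
    refine hdense.induction_on (p := fun v => σ (x 0) v = (0 : f.GNS →L[ℂ] f.GNS) v) v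
      (isClosed_eq (by fun_prop) (by fun_prop)) fun b => ?_
    exact h.apply_eq_zero_of_apply_eq_zero hq hgen σ b ξ h0
  · have hξ : ‖ξ‖ ≤ 1 := by
      have := hnorm 1
      rw [map_one, one_apply_eq_self, star_one, one_mul] at this
      rw [← this, Complex.norm_real, norm_pow, norm_norm] at hφ1
      exact (sq_le_one_iff₀ (norm_nonneg _)).1 hφ1
    rw [← hnorm, Complex.ofReal_re] at hφa
    calc c ≤ ‖σ a ξ‖ := (sq_le_sq₀ hc0 (norm_nonneg _)).1 hφa
      _ ≤ ‖σ a‖ * ‖ξ‖ := (σ a).le_opNorm ξ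
      _ ≤ ‖σ a‖ := mul_le_of_le_one_right (norm_nonneg _) hξ

end

/-! ### Comparison with the representations of the smaller sphere -/

theorem SphereRel.prod {A B : Type*} [Ring A] [StarRing A] [Algebra ℂ A] [Ring B] [StarRing B]
    [Algebra ℂ B] {n : ℕ} {q : ℝ} {x : Fin (n + 1) → A} {y : Fin (n + 1) → B}
    (hx : SphereRel q x) (hy : SphereRel q y) : SphereRel q fun i => (x i, y i) where
  normal := Prod.ext hx.normal hy.normal
  comm i j hij := Prod.ext (hx.comm i j hij) (hy.comm i j hij)
  star_comm i j hij := Prod.ext (hx.star_comm i j hij) (hy.star_comm i j hij)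
  commutator i hi := Prod.ext (by simpa [Prod.fst_sum] using hx.commutator i hi)
    (by simpa [Prod.snd_sum] using hy.commutator i hi)
  radius := Prod.ext (by simpa [Prod.fst_sum] using hx.radius)
    (by simpa [Prod.snd_sum] using hy.radius)

/-- The character that sends `xₙ` to `1` and all other generators to `0`. -/
theorem sphereRel_single (q : ℝ) (n : ℕ) :
    SphereRel q (Pi.single (Fin.last n) 1 : Fin (n + 1) → ℂ) where
  normal := mul_comm _ _
  comm i j hij := by
    rw [Pi.single_eq_of_ne (hij.trans_le (Fin.le_last j)).ne]
    simp
  star_comm i j hij := by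
    by_cases hi : i = Fin.last n
    · rw [Pi.single_eq_of_ne (hi ▸ hij.symm : j ≠ Fin.last n)]
      simp
    · rw [Pi.single_eq_of_ne hi]
      simp
  commutator i hi := by
    rw [mul_comm, sub_self, Finset.sum_eq_zero, smul_zero]
    intro j hj
    rw [Pi.single_eq_of_ne ((Finset.mem_Iio.1 hj).trans_le (Fin.le_last i)).ne]
    simp
  radius := by
    rw [Finset.sum_eq_single (Fin.last n)]
    · simp
    · intro j _ hj
      rw [Pi.single_eq_of_ne hj]
      simp
    · simp

section Corner

variable {H : Type*} [NormedAddCommGroup H] [InnerProductSpace ℂ H] [CompleteSpace H]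
  (V : H →ₗᵢ[ℂ] Hilb)

theorem adjoint_comp_isometry (V : H →ₗᵢ[ℂ] Hilb) (v : H) :
    ContinuousLinearMap.adjoint V.toContinuousLinearMap (V v) = v := by
  refine ext_inner_left ℂ fun w => ?_
  rw [ContinuousLinearMap.adjoint_inner_right]
  exact V.inner_map_map w v

/-- An isometry `V : H → ℓ²(ℕ)` extends operators on `H` to `ℓ²(ℕ)`, acting as a scalar on the
orthogonal complement of the range. -/
def cornerHom : ((H →L[ℂ] H) × ℂ) →⋆ₐ[ℂ] BOp where
  toFun p := V.toContinuousLinearMap ∘L p.1 ∘L ContinuousLinearMap.adjoint V.toContinuousLinearMap +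
    p.2 • (1 - V.toContinuousLinearMap ∘L ContinuousLinearMap.adjoint V.toContinuousLinearMap)
  map_one' := by
    ext1 v
    simp
  map_mul' a b := by
    ext1 v
    simp [adjoint_comp_isometry, mul_smul, smul_sub]
  map_zero' := by simp
  map_add' a b := by
    ext1 v
    simp [add_smul]
    abel
  commutes' r := by
    ext1 v
    simp [Algebra.algebraMap_eq_smul_one, smul_sub]
  map_star' a := by
    simp [ContinuousLinearMap.star_eq_adjoint, ContinuousLinearMap.adjoint_comp,
      ContinuousLinearMap.comp_assoc]

theorem cornerHom_apply (p : (H →L[ℂ] H) × ℂ) (v : H) : cornerHom V p (V v) = V (p.1 v) := by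
  simp [cornerHom, adjoint_comp_isometry]

end Corner

/-! ### Evaluation of families at representations -/

section Families

variable {I J : Type}

theorem continuous_starAlgHom {A B : Type*} [CStarAlgebra A] [CStarAlgebra B] (φ : A →⋆ₐ[ℂ] B) :
    Continuous φ :=
  map_continuous φ

/-- Restriction of families along a map between the index sets. -/
def restrictHom (r : J → I) : Families I →⋆ₐ[ℂ] Families J where
  toFun a := ⟨fun ρ => a.1 (r ρ), memℓp_infty ⟨‖a‖, by
    rintro _ ⟨ρ, rfl⟩
    exact lp.norm_apply_le_norm ENNReal.top_ne_zero a (r ρ)⟩⟩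
  map_one' := rfl
  map_mul' _ _ := rfl
  map_zero' := rfl
  map_add' _ _ := rfl
  commutes' _ := rfl
  map_star' _ := rfl

/-- The value of a family at an index. -/
def evalHom (ρ : I) : Families I →⋆ₐ[ℂ] BOp where
  toFun a := a.1 ρ
  map_one' := rfl
  map_mul' _ _ := rfl
  map_zero' := rfl
  map_add' _ _ := rfl
  commutes' _ := rfl
  map_star' _ := rfl

theorem exists_lt_norm_evalHom (a : Families I) {c : ℝ} (hc : 0 ≤ c) (h : c < ‖a‖) :
    ∃ ρ, c < ‖evalHom ρ a‖ := by
  by_contra! hcon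
  exact absurd (lp.norm_le_of_forall_le hc hcon) (not_le.2 h)

theorem closure_adjoin_eq_univ {k : Type*} (g : k → Families I)
    (S : StarSubalgebra ℂ (Families I))
    (hS : S = (StarAlgebra.adjoin ℂ (Set.range g)).topologicalClosure)
    (g' : k → S) (hg : ∀ i, (g' i : Families I) = g i) :
    closure (StarAlgebra.adjoin ℂ (Set.range g') : Set S) = Set.univ := by
  refine Set.eq_univ_of_forall fun a => ?_
  rw [closure_subtype]
  have h1 : (Subtype.val '' (StarAlgebra.adjoin ℂ (Set.range g') : Set S)) =
      (StarAlgebra.adjoin ℂ (Set.range g) : Set (Families I)) := by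
    have := StarAlgHom.map_adjoin S.subtype (Set.range g')
    rw [← Set.range_comp] at this
    have e : (S.subtype ∘ g') = g := funext hg
    rw [e] at this
    rw [← this]
    rfl
  rw [h1]
  rw [← StarSubalgebra.topologicalClosure_coe, ← hS]
  exact a.2

end Families

variable (q : ℝ) (n : ℕ)

/-- The inclusion of `C(S^{2n}_q)` into the families of operators. -/
def evenIncl : CEven q n →⋆ₐ[ℂ] Families (EvenRep q n) where
  toFun a := a.1
  map_one' := rfl
  map_mul' _ _ := rfl
  map_zero' := rfl
  map_add' _ _ := rfl
  commutes' _ := rfl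
  map_star' _ := rfl

/-- The inclusion of `C(S^{2n-1}_q)` into the families of operators. -/
def oddIncl : COdd q n →⋆ₐ[ℂ] Families (OddRep q n) where
  toFun a := a.1
  map_one' := rfl
  map_mul' _ _ := rfl
  map_zero' := rfl
  map_add' _ _ := rfl
  commutes' _ := rfl
  map_star' _ := rfl

variable {q n}

/-- The representation of `C(S^{2n}_q)` given by operators that satisfy the relations. -/
def evenEval (ρ : EvenRep q n) : CEven q n →⋆ₐ[ℂ] BOp := (evalHom ρ).comp (evenIncl q n)

/-- The representation of `C(S^{2n-1}_q)` given by operators that satisfy the relations. -/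
def oddEval (ρ : OddRep q n) : COdd q n →⋆ₐ[ℂ] BOp := (evalHom ρ).comp (oddIncl q n)

theorem evenEval_ext {a b : CEven q n} (h : ∀ ρ, evenEval ρ a = evenEval ρ b) : a = b :=
  Subtype.ext (Subtype.ext (funext h))

theorem oddEval_ext {a b : COdd q n} (h : ∀ ρ, oddEval ρ a = oddEval ρ b) : a = b :=
  Subtype.ext (Subtype.ext (funext h))

theorem exists_lt_norm_evenEval (a : CEven q n) (c : ℝ) (hc : 0 ≤ c) (h : c < ‖a‖) :
    ∃ ρ : CEven q n →⋆ₐ[ℂ] BOp, c < ‖ρ a‖ := by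
  obtain ⟨ρ, hρ⟩ := exists_lt_norm_evalHom (evenIncl q n a) hc h
  exact ⟨evenEval ρ, hρ⟩

theorem exists_lt_norm_oddEval (a : COdd q n) (c : ℝ) (hc : 0 ≤ c) (h : c < ‖a‖) :
    ∃ ρ : COdd q n →⋆ₐ[ℂ] BOp, c < ‖ρ a‖ := by
  obtain ⟨ρ, hρ⟩ := exists_lt_norm_evalHom (oddIncl q n a) hc h
  exact ⟨oddEval ρ, hρ⟩

theorem closure_adjoin_evenGen :
    closure (StarAlgebra.adjoin ℂ (Set.range (evenGen q n)) : Set (CEven q n)) = Set.univ :=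
  closure_adjoin_eq_univ (evenFamily q n) (evenAlg q n) rfl (evenGen q n) fun _ => rfl

theorem closure_adjoin_oddGen :
    closure (StarAlgebra.adjoin ℂ (Set.range (oddGen q n)) : Set (COdd q n)) = Set.univ :=
  closure_adjoin_eq_univ (oddFamily q n) (oddAlg q n) rfl (oddGen q n) fun _ => rfl

theorem evenRel_evenGen : EvenRel q (evenGen q n) where
  selfAdjoint := evenEval_ext fun ρ => by
    rw [map_star]
    exact ρ.2.selfAdjoint
  comm i j hij := evenEval_ext fun ρ => by
    simp only [map_mul, map_smul]
    exact ρ.2.comm i j hij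
  star_comm i j hij := evenEval_ext fun ρ => by
    rw [map_mul, map_smul, map_mul, map_star]
    exact ρ.2.star_comm i j hij
  commutator i hi := evenEval_ext fun ρ => by
    rw [map_sub, map_smul, map_sum]
    simp_rw [map_mul, map_star]
    exact ρ.2.commutator i hi
  radius := evenEval_ext fun ρ => by
    rw [map_sum, map_one]
    simp_rw [map_mul, map_star]
    exact ρ.2.radius

theorem oddRel_oddGen : OddRel q (oddGen q n) where
  selfAdjoint := oddEval_ext fun ρ => by
    rw [map_star]
    exact ρ.2.selfAdjoint
  comm i j hij := oddEval_ext fun ρ => by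
    simp only [map_mul, map_smul]
    exact ρ.2.comm i j hij
  star_comm i j hij := oddEval_ext fun ρ => by
    rw [map_mul, map_smul, map_mul, map_star]
    exact ρ.2.star_comm i j hij
  commutator i hi := oddEval_ext fun ρ => by
    rw [map_sub, map_smul, map_sum]
    simp_rw [map_mul, map_star]
    exact ρ.2.commutator i hi
  radius := oddEval_ext fun ρ => by
    rw [map_sum, map_one]
    simp_rw [map_mul, map_star]
    exact ρ.2.radius
  zero := oddEval_ext fun ρ => by
    rw [map_zero]
    exact ρ.2.zero

/-- The generator `x₀ = 0` is redundant. -/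
theorem closure_adjoin_tail_oddGen :
    closure (StarAlgebra.adjoin ℂ (Set.range (Fin.tail (oddGen q (n + 1)))) :
      Set (COdd q (n + 1))) = Set.univ := by
  refine Set.univ_subset_iff.1 (closure_adjoin_oddGen.symm.subset.trans (closure_mono ?_))
  refine StarAlgebra.adjoin_le ?_
  rintro _ ⟨i, rfl⟩
  induction i using Fin.cases with
  | zero =>
    rw [oddRel_oddGen.zero]
    exact zero_mem (StarAlgebra.adjoin ℂ (Set.range (Fin.tail (oddGen q (n + 1)))))
  | succ i => exact StarAlgebra.subset_adjoin ℂ _ ⟨i, rfl⟩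

/-- Every representation with `x₀ = 0` is a representation of the even sphere. -/
theorem exists_evenQuotient (q : ℝ) (n : ℕ) :
    ∃ π : CEven q n →⋆ₐ[ℂ] COdd q n, ∀ i, π (evenGen q n i) = oddGen q n i := by
  let r : OddRep q n → EvenRep q n := fun ρ => ⟨ρ.1, ρ.2.toEvenRel⟩
  let Φ := (restrictHom r).comp (evenIncl q n)
  have hcl : IsClosed (oddAlg q n : Set (Families (OddRep q n))) :=
    StarSubalgebra.isClosed_topologicalClosure _
  have hmem : ∀ a, Φ a ∈ oddAlg q n := fun a => by
    refine closure_eq_univ_induction (p := fun a => Φ a ∈ oddAlg q n)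
      closure_adjoin_evenGen (fun i => (oddGen q n i).2) (fun i => ?_) (fun c => ?_)
      (fun a b ha hb => ?_) (fun a b ha hb => ?_) (hcl.preimage (continuous_starAlgHom Φ)) a
    · rw [map_star]
      exact star_mem (s := oddAlg q n) (oddGen q n i).2
    · rw [AlgHomClass.commutes]
      exact algebraMap_mem (oddAlg q n) c
    · rw [map_add]
      exact add_mem ha hb
    · rw [map_mul]
      exact mul_mem ha hb
  exact ⟨Φ.codRestrict (oddAlg q n) hmem, fun i => rfl⟩

/-- Every representation of the smaller odd sphere gives one of the larger odd sphere with
`x₁ = 0`. -/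
theorem exists_oddQuotient (q : ℝ) (n : ℕ) :
    ∃ π : COdd q (n + 1) →⋆ₐ[ℂ] COdd q n, ∀ i, π (Fin.tail (oddGen q (n + 1)) i) = oddGen q n i := by
  let r : OddRep q n → OddRep q (n + 1) := fun ρ => ⟨Fin.cons 0 ρ.1, ρ.2.cons_zero⟩
  let Φ := (restrictHom r).comp (oddIncl q (n + 1))
  have hcl : IsClosed (oddAlg q n : Set (Families (OddRep q n))) :=
    StarSubalgebra.isClosed_topologicalClosure _
  have hgen : ∀ i, Φ (Fin.tail (oddGen q (n + 1)) i) = (oddGen q n i).1 := fun i => rfl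
  have hmem : ∀ a, Φ a ∈ oddAlg q n := fun a => by
    refine closure_eq_univ_induction (p := fun a => Φ a ∈ oddAlg q n)
      closure_adjoin_tail_oddGen (fun i => (oddGen q n i).2) (fun i => ?_) (fun c => ?_)
      (fun a b ha hb => ?_) (fun a b ha hb => ?_) (hcl.preimage (continuous_starAlgHom Φ)) a
    · rw [map_star, hgen]
      exact star_mem (s := oddAlg q n) (oddGen q n i).2
    · rw [AlgHomClass.commutes]
      exact algebraMap_mem (oddAlg q n) c
    · rw [map_add]
      exact add_mem ha hb
    · rw [map_mul]
      exact mul_mem ha hb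
  exact ⟨Φ.codRestrict (oddAlg q n) hmem, fun i => Subtype.ext (hgen i)⟩

/-! ### The kernel and the range of the quotient map -/

section

variable {A : Type} [CStarAlgebra A] {n : ℕ} {q : ℝ} {x : Fin (n + 1) → A}
  {π : A →⋆ₐ[ℂ] COdd q n}

/-- A representation on a separable space in which `x₀` vanishes factors through the smaller
sphere. -/
theorem SphereRel.norm_apply_le (h : SphereRel q x) (hn : 1 ≤ n)
    (hgen : closure (StarAlgebra.adjoin ℂ (Set.range x) : Set A) = Set.univ)
    (hπ : ∀ i, π (x i) = oddGen q n i) {H : Type*} [NormedAddCommGroup H]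
    [InnerProductSpace ℂ H] [CompleteSpace H] [TopologicalSpace.SeparableSpace H]
    (σ : A →⋆ₐ[ℂ] (H →L[ℂ] H)) (hσ : σ (x 0) = 0) (a : A) : ‖σ a‖ ≤ ‖π a‖ := by
  obtain ⟨V⟩ := exists_linearIsometry_hilb H
  -- on the orthogonal complement of `V H` a character of the sphere is used, so that the extension
  -- of `σ` is a unital representation on `ℓ²(ℕ)`
  let z : Fin (n + 1) → (H →L[ℂ] H) × ℂ :=
    fun i => (σ (x i), (Pi.single (Fin.last n) 1 : Fin (n + 1) → ℂ) i)
  have hz : SphereRel q z := (h.map σ).prod (sphereRel_single q n)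
  have hz0 : z 0 = 0 := by
    have h0 : (0 : Fin (n + 1)) ≠ Fin.last n := by
      rw [Ne, Fin.ext_iff]
      simp
      omega
    exact Prod.ext hσ (Pi.single_eq_of_ne h0 1)
  let y : Fin (n + 1) → BOp := fun i => cornerHom V (z i)
  have hy0 : y 0 = 0 := by
    change cornerHom V (z 0) = 0
    rw [hz0, map_zero]
  let ρ : OddRep q n := ⟨y, (hz.map (cornerHom V)).evenRel (by
    change star (y 0) = y 0
    rw [hy0, star_zero]), hy0⟩
  let τ : A →⋆ₐ[ℂ] BOp := (oddEval ρ).comp π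
  have hτ : ∀ i, τ (x i) = cornerHom V (z i) := fun i => by
    change oddEval ρ (π (x i)) = _
    rw [hπ]
    rfl
  have key : ∀ v, τ a (V v) = V (σ a v) := by
    have hcτ : Continuous τ := map_continuous τ
    have hcσ : Continuous σ := map_continuous σ
    refine closure_eq_univ_induction hgen (p := fun a => ∀ v, τ a (V v) = V (σ a v))
      (fun i v => ?_) (fun i v => ?_) (fun c v => ?_) (fun a b ha hb v => ?_)
      (fun a b ha hb v => ?_) ?_ a
    · rw [hτ, cornerHom_apply]
    · rw [map_star, hτ, ← map_star, cornerHom_apply, map_star]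
      rfl
    · rw [Algebra.algebraMap_eq_smul_one, map_smul, map_smul, map_one, map_one]
      simp
    · rw [map_add, map_add, add_apply, add_apply, ha, hb, map_add]
    · rw [map_mul, map_mul, mul_apply_eq_comp, mul_apply_eq_comp, hb, ha]
    · simp only [Set.ofPred_forall]
      exact isClosed_iInter fun v => isClosed_eq (by fun_prop)
        (V.continuous.comp (hcσ.clm_apply continuous_const))
  refine ContinuousLinearMap.opNorm_le_bound _ (norm_nonneg _) fun v => ?_
  calc ‖σ a v‖ = ‖τ a (V v)‖ := by rw [key, V.norm_map]
    _ ≤ ‖τ a‖ * ‖V v‖ := (τ a).le_opNorm _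
    _ ≤ ‖π a‖ * ‖v‖ := by
      rw [V.norm_map]
      gcongr
      exact NonUnitalStarAlgHom.norm_apply_le (oddEval ρ) (π a)

/-- The norm of `π a` is at least the infimum of the norms `‖a (1 - x₀* x₀)ᴺ‖`. -/
theorem SphereRel.exists_norm_mul_residue_le (h : SphereRel q x) (hq : q ≠ 0) (hn : 1 ≤ n)
    (hgen : closure (StarAlgebra.adjoin ℂ (Set.range x) : Set A) = Set.univ)
    (hfaith : ∀ (a : A) (c : ℝ), 0 ≤ c → c < ‖a‖ → ∃ ρ : A →⋆ₐ[ℂ] BOp, c < ‖ρ a‖)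
    (hπ : ∀ i, π (x i) = oddGen q n i) (a : A) {ε : ℝ} (hε : 0 < ε) :
    ∃ N, ‖a * residue (x 0) N‖ ≤ ‖π a‖ + ε := by
  by_contra! hcon
  obtain ⟨H, _, _, _, _, σ, hσ, hσa⟩ := h.exists_representation hq hgen hfaith (by positivity) hcon
  have := h.norm_apply_le hn hgen hπ σ hσ a
  linarith

theorem map_residue (hπ : ∀ i, π (x i) = oddGen q n i) (N : ℕ) : π (residue (x 0) N) = 1 := by
  rw [residue, map_pow, map_sub, map_mul, map_one, hπ, oddRel_oddGen.zero]
  simp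

theorem sub_mul_residue_mem (a x₀ : A) (N : ℕ) :
    a - a * residue x₀ N ∈ idealSpan (star x₀ * x₀) := by
  induction N with
  | zero => simp [residue]
  | succ N ih =>
    have e : a - a * residue x₀ (N + 1) =
        (a - a * residue x₀ N) + a * residue x₀ N * (star x₀ * x₀) := by
      rw [residue, residue, pow_succ]
      noncomm_ring
    rw [e]
    exact add_mem ih (mul_mem_idealSpan _ (self_mem_idealSpan _))

theorem closure_idealSpan_subset {e f : A} (h : e ∈ closure (idealSpan f : Set A)) :
    closure (idealSpan e : Set A) ⊆ closure (idealSpan f : Set A) := by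
  refine closure_minimal ?_ isClosed_closure
  rw [← Submodule.topologicalClosure_coe]
  refine SetLike.coe_subset_coe.2 (Submodule.span_le.2 ?_)
  rintro _ ⟨⟨a, b⟩, rfl⟩
  exact map_mem_closure (f := fun y => a * y * b) (by fun_prop) h
    fun y hy => idealSpan_mul_mem b (mul_mem_idealSpan a hy)

theorem map_eq_zero_of_mem_closure {e a : A} (he : π e = 0)
    (ha : a ∈ closure (idealSpan e : Set A)) : π a = 0 := by
  have hc : IsClosed {a | π a = 0} := isClosed_eq (continuous_starAlgHom π) continuous_const
  refine closure_minimal (t := {a | π a = 0}) (fun a ha => ?_) hc ha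
  induction ha using Submodule.span_induction with
  | mem a ha =>
    obtain ⟨p, rfl⟩ := ha
    change π (p.1 * e * p.2) = 0
    rw [map_mul, map_mul, he, MulZeroClass.mul_zero, MulZeroClass.zero_mul]
  | zero => exact map_zero π
  | add a b _ _ ha hb =>
    change π (a + b) = 0
    rw [map_add, ha, hb, add_zero]
  | smul c a _ ha =>
    change π (c • a) = 0
    rw [map_smul, ha, smul_zero]

/-- The kernel of the quotient map is generated by any element of it whose closed ideal contains
`x₀* x₀`. -/
theorem SphereRel.ker_eq (h : SphereRel q x) (hq : q ≠ 0) (hn : 1 ≤ n)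
    (hgen : closure (StarAlgebra.adjoin ℂ (Set.range x) : Set A) = Set.univ)
    (hfaith : ∀ (a : A) (c : ℝ), 0 ≤ c → c < ‖a‖ → ∃ ρ : A →⋆ₐ[ℂ] BOp, c < ‖ρ a‖)
    (hπ : ∀ i, π (x i) = oddGen q n i) {e : A} (he : π e = 0)
    (hx : star (x 0) * x 0 ∈ closure (idealSpan e : Set A)) :
    {a | π a = 0} = closure (idealSpan e : Set A) := by
  ext a
  refine ⟨fun ha => ?_, fun ha => map_eq_zero_of_mem_closure he ha⟩
  refine closure_idealSpan_subset hx (Metric.mem_closure_iff.2 fun ε hε => ?_)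
  obtain ⟨N, hN⟩ := h.exists_norm_mul_residue_le hq hn hgen hfaith hπ a (half_pos hε)
  refine ⟨_, sub_mul_residue_mem a (x 0) N, ?_⟩
  rw [show π a = 0 from ha, norm_zero, zero_add] at hN
  rw [dist_eq_norm, sub_sub_cancel]
  linarith

/-- The quotient map is onto: the `*`-algebra generated by the generators lies in its range, and
its elements have preimages of comparable norm. -/
theorem SphereRel.surjective (h : SphereRel q x) (hq : q ≠ 0) (hn : 1 ≤ n)
    (hgen : closure (StarAlgebra.adjoin ℂ (Set.range x) : Set A) = Set.univ)
    (hfaith : ∀ (a : A) (c : ℝ), 0 ≤ c → c < ‖a‖ → ∃ ρ : A →⋆ₐ[ℂ] BOp, c < ‖ρ a‖)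
    (hπ : ∀ i, π (x i) = oddGen q n i) : Function.Surjective π := by
  let f : NormedAddGroupHom A (COdd q n) :=
    { toFun := π
      map_add' := map_add π
      bound' := ⟨1, fun a => by
        rw [one_mul]
        exact NonUnitalStarAlgHom.norm_apply_le π a⟩ }
  have hf : ∀ a, f a = π a := fun a => rfl
  have h2 : f.SurjectiveOnWith f.range 2 := by
    rintro _ ⟨a, rfl⟩
    by_cases ha : π a = 0
    · exact ⟨0, by simp [hf, ha], by simp [hf, ha]⟩
    · -- multiplication by `(1 - x₀* x₀)ᴺ` does not change the image under `π`
      obtain ⟨N, hN⟩ := h.exists_norm_mul_residue_le hq hn hgen hfaith hπ a (norm_pos_iff.2 ha)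
      refine ⟨a * residue (x 0) N, ?_, ?_⟩
      · change π (a * residue (x 0) N) = π a
        rw [map_mul, map_residue hπ, mul_one]
      · change _ ≤ 2 * ‖π a‖
        linarith
  have h3 := controlled_closure_of_complete two_pos one_pos h2
  intro b
  have hb : b ∈ f.range.topologicalClosure := by
    have h4 := closure_adjoin_oddGen (q := q) (n := n)
    have h5 : b ∈ closure (StarAlgebra.adjoin ℂ (Set.range (oddGen q n)) : Set (COdd q n)) :=
      h4 ▸ Set.mem_univ b
    refine closure_mono (fun c hc => ?_) h5
    have h6 : StarAlgebra.adjoin ℂ (Set.range (oddGen q n)) ≤ π.range := by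
      refine StarAlgebra.adjoin_le ?_
      rintro _ ⟨i, rfl⟩
      exact ⟨x i, hπ i⟩
    obtain ⟨a, ha⟩ := h6 hc
    exact ⟨a, ha⟩
  obtain ⟨a, ha, -⟩ := h3 b hb
  exact ⟨a, ha⟩

/-- The ideal generated by an element is automatically a complex subspace, because the algebra is
unital. -/
theorem coe_idealSpan (e : A) : (idealSpan e : Set A) = TwoSidedIdeal.span {e} := by
  refine Set.Subset.antisymm (fun a ha => ?_) fun a ha => ?_
  · have he : e ∈ TwoSidedIdeal.span {e} := TwoSidedIdeal.subset_span rfl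
    induction ha using Submodule.span_induction with
    | mem a ha =>
      obtain ⟨p, rfl⟩ := ha
      exact TwoSidedIdeal.mul_mem_right _ _ _ (TwoSidedIdeal.mul_mem_left _ _ _ he)
    | zero => exact zero_mem (TwoSidedIdeal.span {e})
    | add a b _ _ ha hb => exact add_mem (S := TwoSidedIdeal A) ha hb
    | smul c a _ ha =>
      rw [← one_mul a, ← smul_mul_assoc]
      exact TwoSidedIdeal.mul_mem_left _ _ _ ha
  · induction ha using TwoSidedIdeal.span_induction with
    | mem a ha =>
      rw [Set.mem_singleton_iff] at ha
      exact ha ▸ self_mem_idealSpan a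
    | zero => exact zero_mem (idealSpan e)
    | add a b _ _ ha hb => exact add_mem (S := Submodule ℂ A) ha hb
    | neg a _ ha => exact neg_mem (S := Submodule ℂ A) ha
    | left_absorb a b _ hb => exact mul_mem_idealSpan a hb
    | right_absorb a b _ hb => exact idealSpan_mul_mem a hb

theorem SphereRel.ker_eq_closedIdeal (h : SphereRel q x) (hq : q ≠ 0) (hn : 1 ≤ n)
    (hgen : closure (StarAlgebra.adjoin ℂ (Set.range x) : Set A) = Set.univ)
    (hfaith : ∀ (a : A) (c : ℝ), 0 ≤ c → c < ‖a‖ → ∃ ρ : A →⋆ₐ[ℂ] BOp, c < ‖ρ a‖)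
    (hπ : ∀ i, π (x i) = oddGen q n i) : {a | π a = 0} = closedIdeal (x 0) := by
  rw [closedIdeal, ← coe_idealSpan]
  refine h.ker_eq hq hn hgen hfaith hπ (by rw [hπ, oddRel_oddGen.zero])
    (subset_closure (mul_mem_idealSpan _ (self_mem_idealSpan _)))

end

/-! ### The extensions -/

section

variable {A : Type} [CStarAlgebra A] {n : ℕ} {q : ℝ} {x : Fin (n + 1) → A}
  {X : Type*} [TopologicalSpace X]

/-- A family of representations that is continuous on the generators is continuous. -/
theorem exists_hom_of_continuous
    (hgen : closure (StarAlgebra.adjoin ℂ (Set.range x) : Set A) = Set.univ)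
    (ev : X → A →⋆ₐ[ℂ] BOp) (hev : ∀ i, Continuous fun z => ev z (x i)) :
    ∃ Ψ : A →⋆ₐ[ℂ] C(X, BOp), ∀ a z, Ψ a z = ev z a := by
  have hcont : ∀ a, Continuous fun z => ev z a := fun a => by
    refine closure_eq_univ_induction hgen (p := fun a => Continuous fun z => ev z a) hev
      (fun i => ?_) (fun c => ?_) (fun a b ha hb => ?_) (fun a b ha hb => ?_) ?_ a
    · simp_rw [map_star]
      exact (hev i).star
    · simp_rw [AlgHomClass.commutes]
      exact continuous_const
    · simp_rw [map_add]
      exact ha.add hb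
    · simp_rw [map_mul]
      exact ha.mul hb
    · refine isClosed_of_closure_subset fun a ha => ?_
      refine continuous_of_uniform_approx_of_continuous fun u hu => ?_
      obtain ⟨ε, hε, hu⟩ := Metric.mem_uniformity_dist.1 hu
      obtain ⟨b, hb, hab⟩ := Metric.mem_closure_iff.1 ha ε hε
      refine ⟨fun z => ev z b, hb, fun z => hu ?_⟩
      rw [dist_eq_norm, ← map_sub]
      refine (NonUnitalStarAlgHom.norm_apply_le (ev z) _).trans_lt ?_
      rwa [← dist_eq_norm]
  exact ⟨
    { toFun := fun a => ⟨fun z => ev z a, hcont a⟩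
      map_one' := by ext1 z; exact map_one (ev z)
      map_mul' := fun a b => by ext1 z; exact map_mul (ev z) a b
      map_zero' := by ext1 z; exact map_zero (ev z)
      map_add' := fun a b => by ext1 z; exact map_add (ev z) a b
      commutes' := fun c => by ext1 z; exact AlgHomClass.commutes (ev z) c
      map_star' := fun a => by ext1 z; exact map_star (ev z) a }, fun a z => rfl⟩

theorem closure_adjoin_invTuple (hq : q ≠ 0)
    (hgen : closure (StarAlgebra.adjoin ℂ (Set.range x) : Set A) = Set.univ) :
    closure (StarAlgebra.adjoin ℂ (Set.range (invTuple q x)) : Set A) = Set.univ := by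
  refine Set.univ_subset_iff.1 (hgen.symm.subset.trans (closure_mono ?_))
  refine StarAlgebra.adjoin_le ?_
  rintro _ ⟨i, rfl⟩
  have h1 : invTuple q x i ∈ StarAlgebra.adjoin ℂ (Set.range (invTuple q x)) :=
    StarAlgebra.subset_adjoin ℂ _ ⟨i, rfl⟩
  have h2 : x i = invTuple q⁻¹ (invTuple q x) i := by rw [invTuple_invTuple hq]
  rw [h2]
  exact SMulMemClass.smul_mem _ (star_mem h1)

/-- The Fock representations with phases `ζ z` combine to an embedding of `C(X) ⊗ K` onto the
kernel of the quotient map, for `|q| > 1`. -/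
theorem SphereRel.exists_embedding_of_one_lt (h : SphereRel q x) (hq : 1 < |q|) (hn : 1 ≤ n)
    (hgen : closure (StarAlgebra.adjoin ℂ (Set.range x) : Set A) = Set.univ)
    [CompactSpace X] {ζ : C(X, ℂ)} (hζ : Function.Injective ζ) (hζ1 : ∀ z, ‖ζ z‖ = 1)
    (hspec : ∀ t ∈ spectrum ℂ (x 0), ‖t‖ = 1 → ∃ z, ζ z = t)
    (hev : ∀ y : Fin (n + 1) → BOp, SphereRel q y →
      (∃ z T, star T = T ∧ y 0 = ζ z • T) → ∃ ρ : A →⋆ₐ[ℂ] BOp, ∀ i, ρ (x i) = y i) :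
    ∃ ι : tensorCompact X →⋆ₙₐ[ℂ] A, Function.Injective ι ∧
      Set.range ι = closure (idealSpan (vacuum q (x 0)) : Set A) := by
  obtain ⟨M⟩ := exists_fockModel hq hn
  choose ev hev using fun z => hev (M.twist (ζ z)) (M.twist_rel (hζ1 z))
    ⟨z, M.op 0, M.star_zero, M.twist_zero _⟩
  obtain ⟨Ψ, hΨ⟩ := exists_hom_of_continuous hgen ev fun i => by
    simp_rw [hev]
    by_cases hi : i = 0
    · subst hi
      simp_rw [M.twist_zero]
      exact ζ.continuous.smul continuous_const
    · simp_rw [M.twist_of_ne _ hi]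
      exact continuous_const
  have hF : IsFockHom M x ζ Ψ := ⟨hζ1, fun i z => by rw [hΨ, hev]⟩
  exact hF.exists_embedding h hq hζ hspec hgen

/-- The kernel of the quotient map is `C(X) ⊗ K`, where `X` parametrizes the possible phases of `x₀`
on the vacuum. For `|q| < 1` the vacuum projection is that of
the rescaled adjoints of the generators, which satisfy the relations for `q⁻¹`. -/
theorem SphereRel.exists_embedding (h : SphereRel q x) (hq : q ≠ 0) (hq1 : |q| ≠ 1) (hn : 1 ≤ n)
    (hgen : closure (StarAlgebra.adjoin ℂ (Set.range x) : Set A) = Set.univ)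
    (hfaith : ∀ (a : A) (c : ℝ), 0 ≤ c → c < ‖a‖ → ∃ ρ : A →⋆ₐ[ℂ] BOp, c < ‖ρ a‖)
    {π : A →⋆ₐ[ℂ] COdd q n} (hπ : ∀ i, π (x i) = oddGen q n i)
    [CompactSpace X] {ζ : C(X, ℂ)} (hζ : Function.Injective ζ) (hζ1 : ∀ z, ‖ζ z‖ = 1)
    (hspec : ∀ t, t ∈ spectrum ℂ (x 0) ∨ t ∈ spectrum ℂ (QuantumSphere.invTuple q x 0) →
      ‖t‖ = 1 → ∃ z, ζ z = t)
    (hev : ∀ y : Fin (n + 1) → BOp, SphereRel q y →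
      (∃ z T, star T = T ∧ (y 0 = ζ z • T ∨ y 0 = star (ζ z) • T)) →
      ∃ ρ : A →⋆ₐ[ℂ] BOp, ∀ i, ρ (x i) = y i) :
    ∃ ι : tensorCompact X →⋆ₙₐ[ℂ] A, Function.Injective ι ∧ Set.range ι = {a | π a = 0} := by
  have hqc : (q : ℂ) ≠ 0 := by exact_mod_cast hq
  have hπ0 : π (x 0) = 0 := by rw [hπ, oddRel_oddGen.zero]
  rcases lt_or_gt_of_ne hq1 with hlt | hgt
  · have hq' : 1 < |q⁻¹| := by
      rw [abs_inv]
      exact one_lt_inv_iff₀.2 ⟨abs_pos.2 hq, hlt⟩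
    have hy := h.invTuple hq
    obtain ⟨ι, hι, hr⟩ := hy.exists_embedding_of_one_lt hq' hn (closure_adjoin_invTuple hq hgen) hζ
      hζ1 (fun t ht => hspec t (Or.inr ht)) fun y hy ⟨z, T, hT, hyT⟩ => by
        have h1 := hy.invTuple (inv_ne_zero hq)
        rw [inv_inv] at h1
        obtain ⟨ρ, hρ⟩ := hev _ h1 ⟨z, ((q : ℂ)⁻¹)⁻¹ ^ (n - 0) • T, by simp [hT], Or.inr (by
          simp only [QuantumSphere.invTuple, hyT, star_smul, hT, smul_smul, Fin.val_zero]
          rw [mul_comm, Complex.ofReal_inv])⟩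
        refine ⟨ρ, fun i => ?_⟩
        have h2 := invTuple_invTuple (inv_ne_zero hq) y
        rw [inv_inv] at h2
        rw [← h2]
        simp only [QuantumSphere.invTuple, map_smul, map_star, hρ]
    refine ⟨ι, hι, hr.trans (h.ker_eq hq hn hgen hfaith hπ ?_ ?_).symm⟩
    · rw [← hy.star_mul_vacuum hq', star_invTuple, map_mul, map_mul, map_smul, hπ0]
      simp
    · have h3 := hy.zero_mem_closure hq'
      have h4 : star (x 0) * x 0 =
          x 0 * ((q : ℂ) ^ n • QuantumSphere.invTuple q x 0) := by
        rw [h.normal, QuantumSphere.invTuple, smul_smul]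
        simp [hqc]
      rw [h4, mul_smul_comm, ← smul_mul_assoc]
      exact map_mem_closure (continuous_const_mul _) h3 fun _ => mul_mem_idealSpan _
  · obtain ⟨ι, hι, hr⟩ := h.exists_embedding_of_one_lt hgt hn hgen hζ hζ1
      (fun t ht => hspec t (Or.inl ht)) fun y hy ⟨z, T, hT, hyT⟩ => hev y hy ⟨z, T, hT, Or.inl hyT⟩
    refine ⟨ι, hι, hr.trans (h.ker_eq hq hn hgen hfaith hπ ?_ ?_).symm⟩
    · rw [← h.star_mul_vacuum hgt, map_mul, map_mul, hπ0]
      simp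
    · exact map_mem_closure (continuous_const_mul _) (h.zero_mem_closure hgt)
        fun _ => mul_mem_idealSpan _

end

/-- Pairs of compact operators are the compact-operator-valued functions on a two-point space. -/
theorem exists_prod_equiv : ∃ e : Compact × Compact →⋆ₙₐ[ℂ] tensorCompact Bool,
    Function.Bijective e := by
  have hmem : ∀ p : Compact × Compact,
      (⟨fun b => cond b p.1.1 p.2.1, continuous_of_discreteTopology⟩ : C(Bool, BOp)) ∈
        tensorCompact Bool := fun p => by
    have h1 := funTensor_mem_tensorCompact (X := Bool)
      ⟨fun b => cond b 1 0, continuous_of_discreteTopology⟩ p.1.2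
    have h2 := funTensor_mem_tensorCompact (X := Bool)
      ⟨fun b => cond b 0 1, continuous_of_discreteTopology⟩ p.2.2
    have h3 := add_mem (S := NonUnitalStarSubalgebra ℂ C(Bool, BOp)) h1 h2
    convert h3 using 1
    ext1 b
    cases b <;> simp [funTensor_apply]
  let e : Compact × Compact →⋆ₙₐ[ℂ] C(Bool, BOp) :=
    { toFun := fun p => ⟨fun b => cond b p.1.1 p.2.1, continuous_of_discreteTopology⟩
      map_smul' := fun c p => by ext1 b; cases b <;> rfl
      map_zero' := by ext1 b; cases b <;> rfl
      map_add' := fun p r => by ext1 b; cases b <;> rfl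
      map_mul' := fun p r => by ext1 b; cases b <;> rfl
      map_star' := fun p => by ext1 b; cases b <;> rfl }
  refine ⟨NonUnitalStarAlgHom.codRestrict e (tensorCompact Bool) hmem, fun p r hpr => ?_,
    fun F => ?_⟩
  · have h : ∀ b : Bool, cond b p.1.1 p.2.1 = cond b r.1.1 r.2.1 := fun b =>
      congrArg (fun F : tensorCompact Bool => F.1 b) hpr
    exact Prod.ext (Subtype.ext (h true)) (Subtype.ext (h false))
  · refine ⟨(⟨F.1 true, apply_mem_compactOps F.2 true⟩,
      ⟨F.1 false, apply_mem_compactOps F.2 false⟩), Subtype.ext ?_⟩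
    ext1 b
    cases b <;> rfl

/-- Here the phases are `1` and `-1`, because `x₀` is self-adjoint. -/
theorem exists_even_extension {q : ℝ} (hq₀ : q ≠ 0) (hq₁ : |q| ≠ 1) {n : ℕ} (hn : 1 ≤ n) :
    ∃ (ι : Compact × Compact →⋆ₙₐ[ℂ] CEven q n) (π : CEven q n →⋆ₐ[ℂ] COdd q n),
      Function.Injective ι ∧ Set.range ι = {a | π a = 0} ∧ Function.Surjective π ∧
      (∀ i, π (evenGen q n i) = oddGen q n i) ∧ {a | π a = 0} = closedIdeal (evenGen q n 0) := by
  obtain ⟨π, hπ⟩ := exists_evenQuotient q n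
  have h := (evenRel_evenGen (q := q) (n := n)).sphereRel
  have hsa : IsSelfAdjoint (evenGen q n 0) := evenRel_evenGen.selfAdjoint
  have hsa' : IsSelfAdjoint (invTuple q (evenGen q n) 0) := by
    rw [isSelfAdjoint_iff, star_invTuple, invTuple, evenRel_evenGen.selfAdjoint]
  let ζ : C(Bool, ℂ) := ⟨fun b => cond b 1 (-1), continuous_of_discreteTopology⟩
  have hζs : ∀ z, star (ζ z) = ζ z := fun z => by cases z <;> simp [ζ]
  -- the spectrum of a self-adjoint element meets the unit circle only in `1` and `-1`
  have hspec : ∀ y : CEven q n, IsSelfAdjoint y → ∀ t ∈ spectrum ℂ y, ‖t‖ = 1 → ∃ z, ζ z = t := by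
    intro y hy t ht ht1
    have h1 : t = (t.re : ℂ) := hy.mem_spectrum_eq_re ht
    rw [h1, Complex.norm_real, Real.norm_eq_abs] at ht1
    rcases eq_or_eq_neg_of_abs_eq ht1 with h2 | h2
    · exact ⟨true, by rw [h1, h2]; simp [ζ]⟩
    · exact ⟨false, by rw [h1, h2]; simp [ζ]⟩
  obtain ⟨ι, hι, hr⟩ := h.exists_embedding (X := Bool) (ζ := ζ) hq₀ hq₁ hn closure_adjoin_evenGen
    exists_lt_norm_evenEval hπ
    (fun a b hab => by
      cases a <;> cases b <;> simp [ζ] at hab ⊢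
      · norm_num at hab
      · norm_num at hab)
    (fun z => by cases z <;> simp [ζ])
    (fun t ht => ht.elim (hspec _ hsa t) (hspec _ hsa' t))
    (fun y hy ⟨z, T, hT, hyT⟩ => by
      rw [hζs, or_self] at hyT
      exact ⟨evenEval ⟨y, hy.evenRel (by rw [hyT, star_smul, hζs, hT])⟩, fun i => rfl⟩)
  obtain ⟨e, he⟩ := exists_prod_equiv
  refine ⟨ι.comp e, π, hι.comp he.1, ?_,
    h.surjective hq₀ hn closure_adjoin_evenGen exists_lt_norm_evenEval hπ, hπ,
    h.ker_eq_closedIdeal hq₀ hn closure_adjoin_evenGen exists_lt_norm_evenEval hπ⟩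
  rw [← hr]
  exact he.2.range_comp ι

/-- Here all phases occur, because the first nonzero generator is merely normal. -/
theorem exists_odd_extension {q : ℝ} (hq₀ : q ≠ 0) (hq₁ : |q| ≠ 1) {n : ℕ} (hn : 1 ≤ n) :
    ∃ (ι : CircleTensorCompact →⋆ₙₐ[ℂ] COdd q (n + 1)) (π : COdd q (n + 1) →⋆ₐ[ℂ] COdd q n),
      Function.Injective ι ∧ Set.range ι = {a | π a = 0} ∧ Function.Surjective π ∧
      (∀ i : Fin (n + 1), π (oddGen q (n + 1) i.succ) = oddGen q n i) ∧
      {a | π a = 0} = closedIdeal (oddGen q (n + 1) 1) := by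
  obtain ⟨π, hπ⟩ := exists_oddQuotient q n
  have h := (oddRel_oddGen (q := q) (n := n + 1)).sphereRel_tail
  let ζ : C(Circle, ℂ) := ⟨fun z => (z : ℂ), continuous_subtype_val⟩
  obtain ⟨ι, hι, hr⟩ := h.exists_embedding (X := Circle) (ζ := ζ) hq₀ hq₁ hn
    closure_adjoin_tail_oddGen exists_lt_norm_oddEval hπ Circle.coe_injective Circle.norm_coe
    (fun t _ ht => ⟨⟨t, mem_sphere_zero_iff_norm.2 ht⟩, rfl⟩)
    (fun y hy _ => ⟨oddEval ⟨Fin.cons 0 y, oddRel_cons_iff.2 hy⟩, fun i => rfl⟩)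
  exact ⟨ι, π, hι, hr,
    h.surjective hq₀ hn closure_adjoin_tail_oddGen exists_lt_norm_oddEval hπ, hπ,
    h.ker_eq_closedIdeal hq₀ hn closure_adjoin_tail_oddGen exists_lt_norm_oddEval hπ⟩

end QuantumSphere

end

theorem mainTheorem4 (q : ℝ) (hq₀ : q ≠ 0) (hq₁ : |q| ≠ 1) (n : ℕ) (hn : 1 ≤ n) :
    (∃ (ι : QuantumSphere.Compact × QuantumSphere.Compact →⋆ₙₐ[ℂ] QuantumSphere.CEven q n)
        (π : QuantumSphere.CEven q n →⋆ₐ[ℂ] QuantumSphere.COdd q n),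
      Function.Injective ι ∧ Function.Exact ι π ∧ Function.Surjective π ∧
      π (QuantumSphere.evenGen q n 0) = 0 ∧
      (∀ i : Fin n, π (QuantumSphere.evenGen q n i.succ) = QuantumSphere.oddGen q n i.succ) ∧
      Set.range ι = QuantumSphere.closedIdeal (QuantumSphere.evenGen q n 0)) ∧
    (∃ (ι : QuantumSphere.CircleTensorCompact →⋆ₙₐ[ℂ] QuantumSphere.COdd q (n + 1))
        (π : QuantumSphere.COdd q (n + 1) →⋆ₐ[ℂ] QuantumSphere.COdd q n),
      Function.Injective ι ∧ Function.Exact ι π ∧ Function.Surjective π ∧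
      π (QuantumSphere.oddGen q (n + 1) 1) = 0 ∧
      (∀ i : Fin n, π (QuantumSphere.oddGen q (n + 1) i.succ.succ) =
        QuantumSphere.oddGen q n i.succ) ∧
      Set.range ι = QuantumSphere.closedIdeal (QuantumSphere.oddGen q (n + 1) 1)) := by
  constructor
  · obtain ⟨ι, π, hι, hr, hs, hπ, hI⟩ := QuantumSphere.exists_even_extension hq₀ hq₁ hn
    exact ⟨ι, π, hι, fun a => (Set.ext_iff.1 hr a).symm, hs,
      (hπ 0).trans QuantumSphere.oddRel_oddGen.zero, fun i => hπ i.succ, hr.trans hI⟩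
  · obtain ⟨ι, π, hι, hr, hs, hπ, hI⟩ := QuantumSphere.exists_odd_extension hq₀ hq₁ hn
    exact ⟨ι, π, hι, fun a => (Set.ext_iff.1 hr a).symm, hs,
      (hπ 0).trans QuantumSphere.oddRel_oddGen.zero, fun i => hπ i.succ, hr.trans hI⟩
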